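/- A $d$-dimensional \emph{Büchi reset VASS} over a finite alphabet $\Sigma$ is a tuple $\mathcal V=(Q,q_0,T,F)$ with a finite set $Q$ of states, an initial state $q_0\in Q$, a set $F\subseteq Q$ of final states, and a finite set of transitions $T\subseteq Q\times(\mathbb Z^d\cup\{\mathsf r_1,\dots,\mathsf r_d\})\times\Sigma^*\times Q$. Its configurations are the elements of $Q\times\mathbb N^d$. A transition $(q,x,w,q')\in T$ allows the step $(q,\mathbf m)\xrightarrow{w}(q',\mathbf m')$ if either $x\in\mathbb Z^d$ and $\mathbf m'=\mathbf m+x\in\mathbb N^d$, or $x=\mathsf r_i$, $\mathbf m'(i)=0$ and $\mathbf m'(j)=\mathbf m(j)$ for all $j\ne i$ (a \emph{reset transition}). The language $L(\mathcal V)\subseteq\Sigma^\omega$ consists of the infinite words $w_1w_2\cdots$ that label an infinite run $(q_0,\mathbf 0)\xrightarrow{w_1}(q_1,\mathbf m_1)\xrightarrow{w_2}\cdots$ visiting $F$ infinitely often. $\mathcal V$ is \emph{weak} if in its control graph there is no path (of length $\ge 0$) from a final state to the source of a reset transition. \textbf{Theorem.} (1) There is an algorithm that, given a weak Büchi reset VASS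 $\mathcal V$ (of any dimension, over any finite alphabet), decides whether $L(\mathcal V)=\emptyset$. (2) For all weak Büchi reset VASS $\mathcal V_1,\mathcal V_2$ over the same alphabet there is a weak Büchi reset VASS $\mathcal V$ over that alphabet with $L(\mathcal V)=L(\mathcal V_1)\cap L(\mathcal V_2)$. (3) There is an algorithm that, given weak Büchi reset VASS $\mathcal V_1,\mathcal V_2$ over the same alphabet, decides whether $L(\mathcal V_1)\cap L(\mathcal V_2)=\emptyset$. -/

import Mathlib

/-- The effect of a transition on `d` counters: `Sum.inl δ` adds the vector `δ`,
`Sum.inr i` resets counter `i` to zero. -/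
abbrev CounterOp (d : ℕ) : Type := (Fin d → ℤ) ⊕ Fin d

/-- `CounterOp.Fires x m m'`: the operation `x` is enabled in the counter valuation `m` and
leads to `m'`. Counter values are natural numbers, so an addition that would make a counter
negative is not enabled. -/
def CounterOp.Fires {d : ℕ} : CounterOp d → (Fin d → ℕ) → (Fin d → ℕ) → Prop
  | Sum.inl δ, m, m' => ∀ i, (m' i : ℤ) = (m i : ℤ) + δ i
  | Sum.inr i, m, m' => m' i = 0 ∧ ∀ j, j ≠ i → m' j = m j

/-- A transition `(q, x, w, q')` with `x` a counter operation and `w` a finite word. -/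
structure ResetTransition (Q A : Type*) (d : ℕ) where
  source : Q
  op : CounterOp d
  label : List A
  target : Q

/-- A transition is a reset transition if its operation resets a counter. -/
def ResetTransition.IsReset {Q A : Type*} {d : ℕ} (t : ResetTransition Q A d) : Prop :=
  ∃ i : Fin d, t.op = Sum.inr i

/-- A `d`-dimensional Büchi reset VASS with states `Q` over the alphabet `A`. The finite sets of
transitions and of final states are given by listing their elements (in any order, repetitions
allowed); only membership in the lists matters for the semantics. -/
structure BuchiResetVASS (Q A : Type*) (d : ℕ) where
  init : Q
  transitions : List (ResetTransition Q A d)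
  final : List Q

/-- The concatenation `ℓ 0 ++ ℓ 1 ++ ⋯ ++ ℓ (n - 1)`. -/
def concatLabels {A : Type*} (ℓ : ℕ → List A) (n : ℕ) : List A :=
  ((List.range n).map ℓ).flatten

/-- The infinite concatenation `ℓ 0 ++ ℓ 1 ++ ⋯` is the infinite word `w`: each finite
concatenation is a prefix of `w`, and their lengths are unbounded. -/
def IsInfiniteConcat {A : Type*} (ℓ : ℕ → List A) (w : ℕ → A) : Prop :=
  (∀ n, concatLabels ℓ n = (List.range (concatLabels ℓ n).length).map w) ∧
    ∀ N, ∃ n, N ≤ (concatLabels ℓ n).length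

namespace BuchiResetVASS

variable {Q A : Type*} {d : ℕ}

/-- The infinite sequence of configurations `c` and transitions `t` is a run: it starts in the
initial configuration `(q₀, 0)`, and `t n` leads from `c n` to `c (n + 1)`. -/
def IsRun (V : BuchiResetVASS Q A d) (c : ℕ → Q × (Fin d → ℕ))
    (t : ℕ → ResetTransition Q A d) : Prop :=
  c 0 = (V.init, fun _ => 0) ∧
    ∀ n, t n ∈ V.transitions ∧ (t n).source = (c n).1 ∧ (t n).target = (c (n + 1)).1 ∧
      (t n).op.Fires (c n).2 (c (n + 1)).2

/-- The language: all infinite words that label a run visiting final states infinitely often. -/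
def language (V : BuchiResetVASS Q A d) : Set (ℕ → A) :=
  {w | ∃ c t, V.IsRun c t ∧ (∀ N, ∃ n, N ≤ n ∧ (c n).1 ∈ V.final) ∧
    IsInfiniteConcat (fun n => (t n).label) w}

/-- The edge relation of the control graph. -/
def Edge (V : BuchiResetVASS Q A d) (p q : Q) : Prop :=
  ∃ t ∈ V.transitions, t.source = p ∧ t.target = q

/-- Weakness: no path (possibly of length zero) in the control graph leads from a final state to
the source of a reset transition. -/
def IsWeak (V : BuchiResetVASS Q A d) : Prop :=
  ∀ q ∈ V.final, ∀ t ∈ V.transitions, t.IsReset → ¬ Relation.ReflTransGen V.Edge q t.source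

end BuchiResetVASS

/-- Encoded transitions: states, counters and letters are numbers, vectors are lists. -/
abbrev TransitionCode : Type := ℕ × (List ℤ ⊕ ℕ) × List ℕ × ℕ

/-- Encoded Büchi reset VASS: number of states, size of the alphabet, dimension, initial state,
list of transitions, list of final states. -/
abbrev VASSCode : Type := ℕ × ℕ × ℕ × ℕ × List TransitionCode × List ℕ

/-- The explicit description of a transition. -/
def ResetTransition.code {n k d : ℕ} (t : ResetTransition (Fin n) (Fin k) d) : TransitionCode :=
  (t.source.val, Sum.map (fun δ => List.ofFn δ) (fun i => i.val) t.op,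
    t.label.map (fun a => a.val), t.target.val)

/-- The explicit finite description of a Büchi reset VASS with states `0, …, n - 1` over the
alphabet `0, …, k - 1`; this is the input of a decision procedure. -/
def BuchiResetVASS.code {n k d : ℕ} (V : BuchiResetVASS (Fin n) (Fin k) d) : VASSCode :=
  (n, k, d, V.init.val, V.transitions.map ResetTransition.code, V.final.map (fun q => q.val))

/-! Emptiness of one language is emptiness of its intersection with itself, so both algorithms come
from a single product construction, and the same product proves closure under intersection.

The product runs both automata side by side on disjoint sets of counters. Firing a transition of one
automaton loads its label as a pending word, and a letter is read when both pending words begin with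
it. This synchronises labels of different lengths. A phase starts at 0 and then cycles through 1, 2,
3: resets occur only in phase 0, leaving 1 needs a final state of the first automaton, leaving 2
needs one of the second, and leaving 3 reads a letter. By weakness two accepting runs are eventually
free of resets, so phase 0 can be left late enough (`exists_isOutRun`). Conversely, visiting phase 3
infinitely often while reading an infinite word forces both Büchi conditions
(`IsOutRun.mem_languages`).

Mark the letters read in phase 3. The intersection is nonempty iff the product has a run with
infinitely many marks, and no reset follows a mark. By Dickson's lemma two marked configurations of
such a run have the same state and comparable counters. By monotonicity a nondecreasing reset-free
loop can be repeated for ever. So nonemptiness amounts to a lasso: a reachable configuration with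
such a loop starting with a mark (`nonempty_iff_hasLasso`).

A lasso is a finite object that can be searched for. Its absence has finite certificates too. The
configurations from which no loop is reachable are downward closed and closed under steps, and at
each state they form a finite union of ideals, each given by strict bounds on some counters.
Consider the graph whose nodes are the ideals and whose edges are the reset-free transitions,
weighted by their effect. A closed walk of nonnegative effect through a marked edge could be
executed inside its ideal, which is excluded. By Farkas' lemma, used repeatedly on ever fewer edges,
the graph then has a lexicographic ranking by nonnegative linear functions of the counters plus
potentials, and marked edges decrease it (`exists_lex_ranking`, `exists_isInvariant`). Conversely,
ideals with such a ranking exclude lassos: iterating the loop repeats a node, which closes a walk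
that the ranking forbids (`IsInvariant.not_hasLasso`). Both kinds of witness can be checked
primitive recursively, so a parallel search decides which one exists. -/

/-! ### Farkas' lemma and nonnegative integral weights. -/

open Finset in
/-- Farkas' lemma for finitely many functionals over an ordered field (Bartl's proof). -/
theorem farkas_functionals {W κ : Type*} [AddCommGroup W] [Module ℚ W] [DecidableEq κ]
    (s : Finset κ) : ∀ (a : κ → W →ₗ[ℚ] ℚ) (b : W →ₗ[ℚ] ℚ),
    (∃ x : κ → ℚ, (∀ j, 0 ≤ x j) ∧ ∑ j ∈ s, x j • a j = b) ∨
      ∃ y : W, (∀ j ∈ s, 0 ≤ a j y) ∧ b y < 0 := by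
  induction s using Finset.induction_on with
  | empty =>
    intro a b
    by_cases hb : b = 0
    · exact Or.inl ⟨0, by simp, by simp [hb]⟩
    · obtain ⟨y, hy⟩ : ∃ y, b y ≠ 0 := by
        by_contra! h
        exact hb (LinearMap.ext h)
      rcases lt_or_gt_of_ne hy with h | h
      · exact Or.inr ⟨y, by simp, h⟩
      · exact Or.inr ⟨-y, by simp, by simpa using h⟩
  | insert k s hk ih =>
    intro a b
    have hsum : ∀ (x : κ → ℚ) (c : ℚ) (f : κ → W →ₗ[ℚ] ℚ),
        ∑ j ∈ insert k s, (Function.update x k c) j • f j = c • f k + ∑ j ∈ s, x j • f j := by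
      intro x c f
      rw [Finset.sum_insert hk, Function.update_self]
      congr 1
      refine Finset.sum_congr rfl fun j hj => ?_
      rw [Function.update_of_ne (by rintro rfl; exact hk hj)]
    rcases ih a b with ⟨x, hx, hxb⟩ | ⟨y, hy, hyb⟩
    · refine Or.inl ⟨Function.update x k 0, fun j => ?_, by rw [hsum, hxb]; simp⟩
      by_cases h : j = k
      · subst h; simp
      · simpa [h] using hx j
    · rcases le_or_gt 0 (a k y) with hk0 | hk0
      · refine Or.inr ⟨y, fun j hj => ?_, hyb⟩
        rcases Finset.mem_insert.1 hj with rfl | hj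
        exacts [hk0, hy j hj]
      -- Here `y` separates `b` from `s` but is negative on `a k`. Subtracting multiples of `a k`
      -- makes all functionals vanish at `y`. A solution for them is completed by a coefficient of
      -- `a k` that is nonnegative by the signs at `y`; a separating `z` is moved along `y` until `a
      -- k` vanishes.
      · rcases ih (fun j => a j - (a j y / a k y) • a k) (b - (b y / a k y) • a k) with
          ⟨x, hx, hxb⟩ | ⟨z, hz, hzb⟩
        · refine Or.inl ⟨Function.update x k (b y / a k y - ∑ j ∈ s, x j * (a j y / a k y)),
            fun j => ?_, ?_⟩
          · by_cases h : j = k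
            · subst h
              rw [Function.update_self]
              have h1 : 0 ≤ b y / a j y := (div_pos_of_neg_of_neg hyb hk0).le
              have h2 : ∑ i ∈ s, x i * (a i y / a j y) ≤ 0 :=
                Finset.sum_nonpos fun i hi => mul_nonpos_of_nonneg_of_nonpos (hx i)
                  (div_nonpos_of_nonneg_of_nonpos (hy i hi) hk0.le)
              linarith
            · simpa [h] using hx j
          · rw [hsum]
            simp only [smul_sub, Finset.sum_sub_distrib, smul_smul, ← Finset.sum_smul] at hxb
            rw [sub_smul]
            rw [sub_eq_sub_iff_add_eq_add] at hxb
            rw [sub_add_eq_add_sub, sub_eq_iff_eq_add, add_comm, hxb]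
        · refine Or.inr ⟨z - (a k z / a k y) • y, fun j hj => ?_, ?_⟩
          · rcases Finset.mem_insert.1 hj with rfl | hj
            · simp [hk0.ne]
            · have := hz j hj
              simp only [LinearMap.sub_apply, LinearMap.smul_apply, smul_eq_mul] at this
              simp only [map_sub, map_smul, smul_eq_mul]
              calc (0:ℚ) ≤ _ := this
                _ = _ := by ring
          · simp only [LinearMap.sub_apply, LinearMap.smul_apply, smul_eq_mul] at hzb
            simp only [map_sub, map_smul, smul_eq_mul]
            calc _ = _ := by ring
              _ < (0:ℚ) := hzb

theorem exists_common_denominator {κ : Type*} (s : Finset κ) (x : κ → ℚ) (hx : ∀ j, 0 ≤ x j) :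
    ∃ (k : ℕ) (n : κ → ℕ), 0 < k ∧ ∀ j ∈ s, (n j : ℚ) = k * x j := by
  classical
  induction s using Finset.induction_on with
  | empty => exact ⟨1, 0, one_pos, by simp⟩
  | insert j s hj ih =>
    obtain ⟨k, n, hk, hn⟩ := ih
    refine ⟨k * (x j).den, fun i => if i = j then k * (x j).num.toNat else n i * (x j).den,
      by positivity, fun i hi => ?_⟩
    by_cases h : i = j
    · subst h
      have h1 : ((x i).num.toNat : ℚ) = (x i).num := by
        exact_mod_cast Int.toNat_of_nonneg (Rat.num_nonneg.2 (hx i))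
      simp only [if_true, Nat.cast_mul, h1]
      rw [mul_assoc, mul_comm ((x i).den : ℚ), Rat.mul_den_eq_num]
    · have := hn i (Finset.mem_of_mem_insert_of_ne hi h)
      simp only [h, if_false, Nat.cast_mul, this]
      ring

/-- If no combination `k • g₀ + ∑ n c • g c` with `k > 0` is nonnegative, there is a nonnegative
integral weight that is nonpositive on all `g c` and negative on `g₀`. -/
theorem exists_nat_weight {κ ι : Type*} [Fintype ι] (s : Finset κ) (g : κ → ι → ℤ)
    (g₀ : ι → ℤ)
    (h : ∀ (k : ℕ) (n : κ → ℕ), 0 < k → ¬ ∀ i, 0 ≤ k * g₀ i + ∑ c ∈ s, n c * g c i) :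
    ∃ y : ι → ℕ, (∀ c ∈ s, ∑ i, (y i : ℤ) * g c i ≤ 0) ∧ ∑ i, (y i : ℤ) * g₀ i < 0 := by
  classical
  let F : (ι → ℚ) → ((ι → ℚ) →ₗ[ℚ] ℚ) := fun v => ∑ i, v i • LinearMap.proj i
  have hF : ∀ v y, F v y = ∑ i, v i * y i := fun v y => by simp [F]
  -- The generators are the `g c` and the negated coordinates, the target is `-g₀`. A solution, with
  -- denominators cleared, is a combination that `h` forbids. A separating `z` has nonpositive
  -- coordinates, and a multiple of `-z` is the weight.
  have key := farkas_functionals (s.map Function.Embedding.inl ∪ Finset.univ.map Function.Embedding.inr)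
    (Sum.elim (fun c => F (fun i => (g c i : ℚ))) (fun i : ι => F (fun j => if j = i then -1 else 0)))
    (F (fun i => -(g₀ i : ℚ)))
  rcases key with ⟨x, hx, hxb⟩ | ⟨z, hz, hzb⟩
  · exfalso
    rw [Finset.sum_union (by simp [Finset.disjoint_left])] at hxb
    simp only [Finset.sum_map, Function.Embedding.inl_apply, Function.Embedding.inr_apply,
      Sum.elim_inl, Sum.elim_inr] at hxb
    obtain ⟨k, n, hk, hn⟩ := exists_common_denominator s (fun c => x (Sum.inl c)) (fun c => hx _)
    refine h k n hk fun i => ?_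
    have hi := congrArg (fun f => f (Pi.single i 1)) hxb
    simp only [LinearMap.add_apply, LinearMap.sum_apply, LinearMap.smul_apply, hF, smul_eq_mul,
      Pi.single_apply, mul_ite, mul_one, mul_zero, Finset.sum_ite_eq', Finset.mem_univ,
      if_true] at hi
    simp only [Finset.sum_ite_eq, Finset.mem_univ, if_true] at hi
    have h2 : (0 : ℚ) ≤ ((k * g₀ i + ∑ c ∈ s, n c * g c i : ℤ) : ℚ) := by
      push_cast
      have : ∑ c ∈ s, (n c : ℚ) * g c i = k * ∑ c ∈ s, x (Sum.inl c) * g c i := by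
        rw [Finset.mul_sum]
        refine Finset.sum_congr rfl fun c hc => ?_
        rw [hn c hc, mul_assoc]
      rw [this]
      have h3 : (∑ c ∈ s, x (Sum.inl c) * (g c i : ℚ)) = - g₀ i + x (Sum.inr i) := by linarith
      rw [h3]
      have := mul_nonneg (Nat.cast_nonneg (α := ℚ) k) (hx (Sum.inr i))
      linarith
    exact_mod_cast h2
  · have hz1 : ∀ i, 0 ≤ -z i := fun i => by
      have := hz (Sum.inr i) (by simp)
      simpa [hF] using this
    obtain ⟨k, n, hk, hn⟩ := exists_common_denominator Finset.univ (fun i => -z i) hz1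
    have e : ∀ v : ι → ℤ, ((∑ i, (n i : ℤ) * v i : ℤ) : ℚ) = -(k * ∑ i, (v i : ℚ) * z i) := by
      intro v
      push_cast
      rw [Finset.mul_sum, ← Finset.sum_neg_distrib]
      refine Finset.sum_congr rfl fun i hi => ?_
      rw [hn i hi]; ring
    have hk' : (0 : ℚ) < k := by exact_mod_cast hk
    refine ⟨n, fun c hc => ?_, ?_⟩
    · have := hz (Sum.inl c) (by simp [hc])
      simp only [Sum.elim_inl, hF] at this
      have h3 : ((∑ i, (n i : ℤ) * g c i : ℤ) : ℚ) ≤ 0 := by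
        rw [e]; have := mul_nonneg hk'.le this; linarith
      exact_mod_cast h3
    · rw [hF] at hzb
      have h3 : ((∑ i, (n i : ℤ) * g₀ i : ℤ) : ℚ) < 0 := by
        rw [e]
        have h4 : ∑ i, (g₀ i : ℚ) * z i > 0 := by
          have : ∑ i, -(g₀ i : ℚ) * z i = - ∑ i, (g₀ i : ℚ) * z i := by
            rw [← Finset.sum_neg_distrib]; simp
          linarith
        have := mul_pos hk' h4; linarith
      exact_mod_cast h3

/-! ### Lexicographic rankings of weighted graphs. -/

/-- A directed multigraph with edges `ε`, integral edge weights and marked edges. -/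
structure WeightedGraph (N ε ι : Type*) where
  src : ε → N
  tgt : ε → N
  wt : ε → ι → ℤ
  mark : ε → Prop

namespace WeightedGraph

variable {N ε ι : Type*} (G : WeightedGraph N ε ι)

/-- `G.IsWalk E u es v`: the edges `es`, all from `E`, form a walk from `u` to `v`. -/
def IsWalk (E : Finset ε) : N → List ε → N → Prop
  | u, [], v => u = v
  | u, e :: es, v => e ∈ E ∧ G.src e = u ∧ IsWalk E (G.tgt e) es v

/-- The total weight of a list of edges. -/
def eff (es : List ε) : ι → ℤ := (es.map G.wt).sum

@[simp] theorem eff_nil : G.eff [] = 0 := rfl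

@[simp] theorem eff_cons (e : ε) (es : List ε) : G.eff (e :: es) = G.wt e + G.eff es := by
  simp [eff]

@[simp] theorem eff_append (l₁ l₂ : List ε) : G.eff (l₁ ++ l₂) = G.eff l₁ + G.eff l₂ := by
  simp [eff]

variable {G} {E : Finset ε}

theorem isWalk_append {u v : N} {l₁ l₂ : List ε} :
    G.IsWalk E u (l₁ ++ l₂) v ↔ ∃ w, G.IsWalk E u l₁ w ∧ G.IsWalk E w l₂ v := by
  induction l₁ generalizing u with
  | nil => simp [IsWalk]
  | cons e es ih => simp [IsWalk, ih, and_assoc]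

theorem IsWalk.append {u v w : N} {l₁ l₂ : List ε} (h₁ : G.IsWalk E u l₁ v)
    (h₂ : G.IsWalk E v l₂ w) : G.IsWalk E u (l₁ ++ l₂) w :=
  isWalk_append.2 ⟨v, h₁, h₂⟩

theorem IsWalk.mem {u v : N} {l : List ε} (h : G.IsWalk E u l v) : ∀ e ∈ l, e ∈ E := by
  induction l generalizing u with
  | nil => simp
  | cons e es ih =>
    intro e' he'
    rcases List.mem_cons.1 he' with rfl | h'
    exacts [h.1, ih h.2.2 _ h']

theorem IsWalk.mono {E' : Finset ε} (hE : E' ⊆ E) {u v : N} {l : List ε}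
    (h : G.IsWalk E' u l v) : G.IsWalk E u l v := by
  induction l generalizing u with
  | nil => exact h
  | cons e es ih => exact ⟨hE h.1, h.2.1, ih h.2.2⟩

variable (G E) in
/-- Reachability by edges from `E`. -/
def Conn (u v : N) : Prop := ∃ es, G.IsWalk E u es v

theorem Conn.refl (u : N) : G.Conn E u u := ⟨[], rfl⟩

theorem Conn.trans {u v w : N} : G.Conn E u v → G.Conn E v w → G.Conn E u w
  | ⟨_, h₁⟩, ⟨_, h₂⟩ => ⟨_, h₁.append h₂⟩

theorem Conn.edge {e : ε} (he : e ∈ E) : G.Conn E (G.src e) (G.tgt e) :=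
  ⟨[e], he, rfl, rfl⟩

/-- A walk is reversed edge by edge, each edge being replaced by a walk back from its target to its
source. -/
theorem Conn.symm_of_forall (h : ∀ e ∈ E, G.Conn E (G.tgt e) (G.src e)) {u v : N} :
    G.Conn E u v → G.Conn E v u := by
  rintro ⟨es, hw⟩
  induction es generalizing u with
  | nil => cases hw; exact .refl _
  | cons e es ih =>
    obtain ⟨he, rfl, hw⟩ := hw
    exact (ih hw).trans (h e he)

variable (G E) in
/-- The weights of the closed walks at `v`. -/
def closedWeights (v : N) : AddSubmonoid (ι → ℤ) where
  carrier := {z | ∃ es, G.IsWalk E v es v ∧ G.eff es = z}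
  zero_mem' := ⟨[], rfl, rfl⟩
  add_mem' := by
    rintro _ _ ⟨l₁, h₁, rfl⟩ ⟨l₂, h₂, rfl⟩
    exact ⟨l₁ ++ l₂, h₁.append h₂, eff_append ..⟩

variable (G E) in
/-- A level of a lexicographic ranking: a node-dependent linear weight and a potential that
together do not increase along the edges of `E`. -/
def IsLevel [Fintype ι] (r : N → (ι → ℕ) × ℕ) : Prop :=
  ∀ e ∈ E, (r (G.src e)).1 = (r (G.tgt e)).1 ∧
    ∑ i, ((r (G.src e)).1 i : ℤ) * G.wt e i + (r (G.tgt e)).2 ≤ (r (G.src e)).2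

variable (G) in
/-- The ranking value is unchanged along `e`. -/
def Tight [Fintype ι] (r : N → (ι → ℕ) × ℕ) (e : ε) : Prop :=
  (r (G.src e)).1 = (r (G.tgt e)).1 ∧
    ∑ i, ((r (G.src e)).1 i : ℤ) * G.wt e i + (r (G.tgt e)).2 = (r (G.src e)).2

variable (G) in
/-- The ranking value decreases along `e`. -/
def Strict [Fintype ι] (r : N → (ι → ℕ) × ℕ) (e : ε) : Prop :=
  (r (G.src e)).1 = (r (G.tgt e)).1 ∧
    ∑ i, ((r (G.src e)).1 i : ℤ) * G.wt e i + (r (G.tgt e)).2 < (r (G.src e)).2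

theorem exists_split_of_not_nodup {α : Type*} {l : List α} (h : ¬ l.Nodup) :
    ∃ a x b c, l = a ++ (x :: b) ++ (x :: c) := by
  induction l with
  | nil => simp at h
  | cons y t ih =>
    by_cases hy : y ∈ t
    · obtain ⟨b, c, rfl⟩ := List.append_of_mem hy
      exact ⟨[], y, b, c, rfl⟩
    · have : ¬ t.Nodup := fun ht => h (List.nodup_cons.2 ⟨hy, ht⟩)
      obtain ⟨a, x, b, c, rfl⟩ := ih this
      exact ⟨y :: a, x, b, c, rfl⟩

/-- A closed walk that uses an edge `x` twice splits at these two places into shorter closed walks,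
one based at the source of `x` and one at the old base point. Since `P` is preserved along walks,
strong induction on the length reduces to walks without repeated edges. -/
theorem nonpos_of_nodup_nonpos (φ : (ι → ℤ) →+ ℤ) (P : N → Prop)
    (hP : ∀ u v, P u → G.Conn E u v → P v)
    (h : ∀ u es, P u → es.Nodup → G.IsWalk E u es u → φ (G.eff es) ≤ 0) (n : ℕ) :
    ∀ u es, es.length = n → P u → G.IsWalk E u es u → φ (G.eff es) ≤ 0 := by
  induction n using Nat.strong_induction_on with
  | _ n ih =>
    intro u es hn hu hw
    by_cases hd : es.Nodup
    · exact h u es hu hd hw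
    · obtain ⟨a, x, b, c, rfl⟩ := exists_split_of_not_nodup hd
      obtain ⟨w, hw1, hw2⟩ := isWalk_append.1 hw
      obtain ⟨w', hw3, hw4⟩ := isWalk_append.1 hw1
      have e1 : G.src x = w := hw2.2.1
      have e2 : G.src x = w' := hw4.2.1
      subst e1
      subst e2
      have l1 := ih (x :: b).length (by subst hn; simp only [List.length_append, List.length_cons]; omega) (G.src x) (x :: b) rfl
        (hP _ _ hu ⟨a, hw3⟩) hw4
      have l2 := ih (a ++ x :: c).length (by subst hn; simp only [List.length_append, List.length_cons]; omega) u (a ++ x :: c) rfl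
        hu (hw3.append hw2)
      have : G.eff (a ++ (x :: b) ++ (x :: c)) = G.eff (x :: b) + G.eff (a ++ x :: c) := by
        simp only [eff_append]; abel
      rw [this, map_add]
      linarith

/-- Only differences of potentials matter, so one constant larger than all absolute values at
endpoints of `E` makes them natural numbers. -/
theorem exists_nat_potential (π : N → ℤ) :
    ∃ (K : ℤ) (ρ : N → ℕ), ∀ e ∈ E, (ρ (G.src e) : ℤ) = π (G.src e) + K ∧
      (ρ (G.tgt e) : ℤ) = π (G.tgt e) + K := by
  let K : ℤ := ∑ e ∈ E, (|π (G.src e)| + |π (G.tgt e)|)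
  have hK : ∀ e ∈ E, |π (G.src e)| + |π (G.tgt e)| ≤ K := fun e he =>
    Finset.single_le_sum (f := fun e => |π (G.src e)| + |π (G.tgt e)|)
      (fun _ _ => by positivity) he
  refine ⟨K, fun u => (π u + K).toNat, fun e he => ?_⟩
  have := hK e he
  have h1 := neg_abs_le (π (G.src e))
  have h2 := neg_abs_le (π (G.tgt e))
  have h3 := abs_nonneg (π (G.src e))
  have h4 := abs_nonneg (π (G.tgt e))
  exact ⟨Int.toNat_of_nonneg (by linarith), Int.toNat_of_nonneg (by linarith)⟩

/-- The potential of a node is the number of edges reachable from it, with weight zero. It never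
grows along an edge, and it drops along `e`, which is counted at its source but not at its target.
-/
theorem exists_level_of_not_conn [Fintype ι] {e : ε} (he : e ∈ E)
    (hc : ¬ G.Conn E (G.tgt e) (G.src e)) :
    ∃ r : N → (ι → ℕ) × ℕ, G.IsLevel E r ∧ ∃ e ∈ E, G.Strict r e := by
  classical
  let R : N → Finset ε := fun u => {f ∈ E | G.Conn E u (G.src f)}
  have hsub : ∀ f ∈ E, R (G.tgt f) ⊆ R (G.src f) := by
    intro f hf g hg
    simp only [R, Finset.mem_filter] at hg ⊢
    exact ⟨hg.1, (Conn.edge hf).trans hg.2⟩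
  refine ⟨fun u => (0, (R u).card), fun f hf => ⟨rfl, ?_⟩, e, he, rfl, ?_⟩
  · simpa using Finset.card_le_card (hsub f hf)
  · have : R (G.tgt e) ⊂ R (G.src e) := by
      refine (Finset.ssubset_iff_of_subset (hsub e he)).2 ⟨e, ?_, ?_⟩
      · simp [R, he, Conn.refl]
      · simp [R, hc]
    simpa using Finset.card_lt_card this

theorem exists_level_of_conn [Finite ε] [Fintype ι]
    (hno : ∀ u es, G.IsWalk E u es u → (∃ e ∈ es, G.mark e) → ¬ 0 ≤ G.eff es)
    (hc : ∀ e ∈ E, G.Conn E (G.tgt e) (G.src e)) {e₀ : ε} (he₀ : e₀ ∈ E) (hm : G.mark e₀) :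
    ∃ r : N → (ι → ℕ) × ℕ, G.IsLevel E r ∧ ∃ e ∈ E, G.Strict r e := by
  classical
  set v := G.src e₀ with hv
  have hfin : Set.Finite {c : List ε | c.Nodup ∧ ∃ u, G.Conn E v u ∧ G.IsWalk E u c u} := by
    have := Fintype.ofFinite ε
    refine (List.finite_length_le ε (Fintype.card ε)).subset fun c hc => ?_
    exact List.Nodup.length_le_card hc.1
  have hcon : ∀ c ∈ hfin.toFinset, ∃ u p q, G.IsWalk E u c u ∧ G.IsWalk E v p u ∧
      G.IsWalk E u q v := by
    intro c hcm
    obtain ⟨-, u, hu, hw⟩ := hfin.mem_toFinset.1 hcm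
    obtain ⟨p, hp⟩ := id hu
    obtain ⟨q, hq⟩ := hu.symm_of_forall hc
    exact ⟨u, p, q, hw, hp, hq⟩
  have : Nonempty N := ⟨v⟩
  choose! u p q hu hp hq using hcon
  obtain ⟨b, hb⟩ := hc e₀ he₀
  have hW : G.IsWalk E v (e₀ :: b) v := ⟨he₀, rfl, hb⟩
  -- The walk `e₀ :: b` is extended by detours `p c`, `q c` to the base point of every simple cycle
  -- `c`, so that copies of `c` can be inserted there.
  set g₀ : ι → ℤ := G.eff (e₀ :: b) + ∑ c ∈ hfin.toFinset, (G.eff (p c) + G.eff (q c)) with hg₀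
  have hrep : ∀ c ∈ hfin.toFinset, ∀ n : ℕ,
      G.eff (p c) + n • G.eff c + G.eff (q c) ∈ G.closedWeights E v := by
    intro c hcm n
    have h1 : n • G.eff c ∈ G.closedWeights E (u c) :=
      nsmul_mem (show G.eff c ∈ G.closedWeights E (u c) from ⟨c, hu c hcm, rfl⟩) n
    obtain ⟨l, hl, hle⟩ := h1
    refine ⟨p c ++ l ++ q c, ((hp c hcm).append hl).append (hq c hcm), ?_⟩
    rw [eff_append, eff_append, hle]
  have hg₀mem : g₀ ∈ G.closedWeights E v := by
    refine add_mem ⟨_, hW, rfl⟩ (sum_mem fun c hcm => ?_)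
    simpa using hrep c hcm 0
  obtain ⟨y, hy, hy0⟩ := exists_nat_weight hfin.toFinset (fun c => G.eff c) g₀ (by
    intro k n hk hnn
    -- Of the `k` copies of `g₀`, one is unrolled: its part `e₀ :: b` supplies the mark, and its
    -- detours carry `n c` copies of each cycle `c`.
    have hr : (k - 1) • g₀ + ∑ c ∈ hfin.toFinset, (G.eff (p c) + n c • G.eff c + G.eff (q c)) ∈
        G.closedWeights E v :=
      add_mem (nsmul_mem hg₀mem _) (sum_mem fun c hcm => hrep c hcm _)
    obtain ⟨l, hl, hle⟩ := hr
    refine hno v ((e₀ :: b) ++ l) (hW.append hl) ⟨e₀, by simp, hm⟩ ?_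
    intro i
    have := hnn i
    rw [eff_append, hle]
    obtain ⟨k, rfl⟩ : ∃ j, k = j + 1 := ⟨k - 1, by omega⟩
    have e1 : G.eff (e₀ :: b) + (k • g₀ + ∑ c ∈ hfin.toFinset,
        (G.eff (p c) + n c • G.eff c + G.eff (q c))) =
        (k + 1) • g₀ + ∑ c ∈ hfin.toFinset, n c • G.eff c := by
      rw [add_smul, one_smul, hg₀]
      simp only [Finset.sum_add_distrib]
      abel
    rw [Nat.add_sub_cancel, e1]
    simpa [Finset.sum_apply] using this)
  let φ : (ι → ℤ) →+ ℤ :=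
    { toFun := fun z => ∑ i, (y i : ℤ) * z i
      map_zero' := by simp
      map_add' := fun a b => by simp [mul_add, Finset.sum_add_distrib] }
  have hφ : ∀ u es, G.Conn E v u → G.IsWalk E u es u → φ (G.eff es) ≤ 0 := fun u es hu hw =>
    nonpos_of_nodup_nonpos φ (G.Conn E v) (fun _ _ => Conn.trans)
      (fun u es hu hd hw => hy es (hfin.mem_toFinset.2 ⟨hd, u, hu, hw⟩)) _ u es rfl hu hw
  let S : N → Set ℤ := fun u => {z | ∃ es, G.IsWalk E u es v ∧ φ (G.eff es) = z}
  have hbdd : ∀ u, G.Conn E v u → BddAbove (S u) := by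
    rintro u ⟨l, hl⟩
    refine ⟨-φ (G.eff l), ?_⟩
    rintro _ ⟨es, hes, rfl⟩
    have := hφ v (l ++ es) (.refl _) (hl.append hes)
    rw [eff_append, map_add] at this
    linarith
  have hne : ∀ u, G.Conn E v u → (S u).Nonempty := by
    intro u hu
    obtain ⟨es, hes⟩ := hu.symm_of_forall hc
    exact ⟨_, es, hes, rfl⟩
  -- The maximal `φ`-weight of a walk from `u` to `v`. On the component of `v` it is finite because
  -- closed walks have weight at most zero.
  let π : N → ℤ := fun u => sSup (S u)
  have hπ : ∀ e ∈ E, G.Conn E v (G.src e) →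
      φ (G.wt e) + π (G.tgt e) ≤ π (G.src e) := by
    intro e he hs
    have ht := hs.trans (Conn.edge he)
    obtain ⟨es, hes, hz⟩ := Int.csSup_mem (hne _ ht) (hbdd _ ht)
    refine le_csSup (hbdd _ hs) ⟨e :: es, ⟨he, rfl, hes⟩, ?_⟩
    rw [eff_cons, map_add, hz]
  obtain ⟨K, ρ, hρ⟩ := exists_nat_potential (G := G) (E := E) π
  -- No edge of `E` enters or leaves the component of `v`, so the ranking may be constant outside
  -- it.
  let r : N → (ι → ℕ) × ℕ := fun u => if G.Conn E v u then (y, ρ u) else (0, 0)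
  have hiff : ∀ e ∈ E, (G.Conn E v (G.src e) ↔ G.Conn E v (G.tgt e)) := fun e he =>
    ⟨fun h => h.trans (Conn.edge he), fun h => h.trans (hc e he)⟩
  have hlev : G.IsLevel E r := by
    intro e he
    by_cases hs : G.Conn E v (G.src e)
    · have ht := (hiff e he).1 hs
      simp only [r, hs, ht, if_true, true_and]
      have := hπ e he hs
      rw [(hρ e he).1, (hρ e he).2]
      change φ (G.wt e) + _ ≤ _
      linarith
    · have ht : ¬ G.Conn E v (G.tgt e) := fun h => hs ((hiff e he).2 h)
      simp [r, hs, ht]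
  refine ⟨r, hlev, ?_⟩
  by_contra! hns
  -- If no edge were strict, the weights would telescope exactly and the closed walk with effect
  -- `g₀` would have `φ`-weight zero.
  have htight : ∀ es u, G.Conn E v u → G.IsWalk E u es v →
      φ (G.eff es) + π v = π u := by
    intro es
    induction es with
    | nil => rintro u - h; cases h; simp
    | cons e es ih =>
      rintro u hu ⟨he, rfl, hw⟩
      have ht := (hiff e he).1 hu
      have h1 := ih _ ht hw
      have h2 := hlev e he
      have h3 := hns e he
      simp only [r, Strict, hu, ht, if_true, true_and, (hρ e he).1, (hρ e he).2] at h2 h3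
      rw [eff_cons, map_add]
      change φ (G.wt e) + _ ≤ _ at h2
      change ¬ φ (G.wt e) + _ < _ at h3
      linarith
  obtain ⟨l, hl, hle⟩ := hg₀mem
  have h1 := htight l v (.refl _) hl
  rw [hle] at h1
  change φ g₀ < 0 at hy0
  linarith

/-- A finite graph without closed walks of nonnegative weight through marked edges has a
lexicographic ranking: every edge is strictly decreasing at the first level where it is not tight,
and marked edges are strictly decreasing somewhere. -/
theorem exists_lex_ranking [Finite ε] [Fintype ι] (E : Finset ε)
    (hno : ∀ u es, G.IsWalk E u es u → (∃ e ∈ es, G.mark e) → ¬ 0 ≤ G.eff es) :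
    ∃ (L : ℕ) (r : ℕ → N → (ι → ℕ) × ℕ), ∀ e ∈ E,
      (∃ l < L, G.Strict (r l) e ∧ ∀ l' < l, G.Tight (r l') e) ∨
      ((∀ l < L, G.Tight (r l) e) ∧ ¬ G.mark e) := by
  classical
  induction E using Finset.strongInduction with
  | H E ih =>
    by_cases hm : ∃ e ∈ E, G.mark e
    · obtain ⟨e₀, he₀, hm⟩ := hm
      obtain ⟨r, hr, e₁, he₁, hs₁⟩ : ∃ r : N → (ι → ℕ) × ℕ, G.IsLevel E r ∧
          ∃ e ∈ E, G.Strict r e := by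
        by_cases hc : ∀ e ∈ E, G.Conn E (G.tgt e) (G.src e)
        · exact exists_level_of_conn hno hc he₀ hm
        · push Not at hc
          obtain ⟨e, he, hc⟩ := hc
          exact exists_level_of_not_conn he hc
      -- The new level settles all strict edges. Only the tight ones need further levels, and they
      -- are strictly fewer.
      have hsub : E.filter (G.Tight r) ⊂ E := by
        refine Finset.filter_ssubset.2 ⟨e₁, he₁, fun h => ?_⟩
        exact absurd h.2 hs₁.2.ne
      obtain ⟨L, s, hs⟩ := ih _ hsub fun u es hw => hno u es (hw.mono hsub.subset)
      refine ⟨L + 1, fun l => Nat.casesOn l r s, fun e he => ?_⟩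
      by_cases ht : G.Tight r e
      · rcases hs e (Finset.mem_filter.2 ⟨he, ht⟩) with ⟨l, hl, h1, h2⟩ | ⟨h1, h2⟩
        · refine Or.inl ⟨l + 1, by omega, h1, fun l' hl' => ?_⟩
          cases l' with
          | zero => exact ht
          | succ l' => exact h2 l' (by omega)
        · refine Or.inr ⟨fun l hl => ?_, h2⟩
          cases l with
          | zero => exact ht
          | succ l => exact h1 l (by omega)
      · refine Or.inl ⟨0, by omega, ⟨(hr e he).1, lt_of_le_of_ne (hr e he).2 fun h => ht ⟨(hr e he).1, h⟩⟩, by simp⟩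
    · exact ⟨0, fun _ _ => (0, 0), fun e he => Or.inr ⟨by simp, fun h => hm ⟨e, he, h⟩⟩⟩

end WeightedGraph

/-! ### Counter systems, monotonicity and lassos. -/

/-- A transition of a counter system with states `S`: the target, the amounts subtracted from and
then added to the counters, and a kind. Kind `1` marks the transition, kind `i + 2` resets
counter `i`, kind `0` is an ordinary transition. -/
abbrev CounterTrans (S : Type*) : Type _ := S × List ℕ × List ℕ × ℕ

namespace CounterTrans

variable {S : Type*}

/-- The amount subtracted from counter `i`. -/
def pre (t : CounterTrans S) (i : ℕ) : ℕ := t.2.1.getD i 0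

/-- The amount added to counter `i`. -/
def post (t : CounterTrans S) (i : ℕ) : ℕ := t.2.2.1.getD i 0

/-- The kind of a transition. -/
def kind (t : CounterTrans S) : ℕ := t.2.2.2

/-- The effect of a transition on the counter valuation. -/
def Fires {d : ℕ} (t : CounterTrans S) (m m' : Fin d → ℕ) : Prop :=
  ∀ i : Fin d, pre t i ≤ m i ∧
    m' i = if kind t = i + 2 then 0 else m i - pre t i + post t i

theorem Fires.mono {d : ℕ} {t : CounterTrans S} {m m' n : Fin d → ℕ} (h : Fires t m m')
    (hn : m ≤ n) : ∃ n', Fires t n n' ∧ m' ≤ n' := by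
  refine ⟨fun i => if kind t = i + 2 then 0 else n i - pre t i + post t i,
    fun i => ⟨(h i).1.trans (hn i), rfl⟩, fun i => ?_⟩
  have hi : m i ≤ n i := hn i
  rw [(h i).2]
  dsimp only
  split_ifs <;> omega

/-- A reset would forget the shift `k`; for the other kinds the effect is a translation. -/
theorem Fires.add {d : ℕ} {t : CounterTrans S} {m m' : Fin d → ℕ} (h : Fires t m m')
    (hk : kind t < 2) (k : Fin d → ℕ) : Fires t (m + k) (m' + k) := by
  intro i
  have := h i
  have h2 : kind t ≠ i + 2 := by omega
  simp only [h2, if_false] at this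
  simp only [h2, if_false, Pi.add_apply]
  omega

end CounterTrans

theorem exists_seq_step {α : Type*} {A : ℕ → α → Prop} {B : ℕ → α → α → Prop} {a₀ : α}
    (h₀ : A 0 a₀) (h : ∀ n a, A n a → ∃ b, A (n + 1) b ∧ B n a b) :
    ∃ f : ℕ → α, f 0 = a₀ ∧ ∀ n, A n (f n) ∧ B n (f n) (f (n + 1)) := by
  choose! g hg using h
  let f : ℕ → α := fun n => Nat.rec a₀ (fun n a => g n a) n
  have hf : ∀ n, A n (f n) := by
    intro n
    induction n with
    | zero => exact h₀
    | succ n ih => exact (hg n _ ih).1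
  exact ⟨f, rfl, fun n => ⟨hf n, (hg n _ (hf n)).2⟩⟩

namespace CounterSystem

open CounterTrans Relation

variable {S : Type*} {d : ℕ} (out : S → List (CounterTrans S))

/-- The step from configuration `x` to `y` by the transition `t`. -/
def StepBy (t : CounterTrans S) (x y : S × (Fin d → ℕ)) : Prop :=
  t ∈ out x.1 ∧ t.1 = y.1 ∧ Fires t x.2 y.2

/-- A step by a transition whose kind satisfies `p`. -/
def Step (p : ℕ → Prop) (x y : S × (Fin d → ℕ)) : Prop :=
  ∃ t, p (kind t) ∧ StepBy out t x y

/-- Reachability of configurations. -/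
def Reach : S × (Fin d → ℕ) → S × (Fin d → ℕ) → Prop :=
  ReflTransGen (Step out fun _ => True)

/-- Reachability of configurations without resets. -/
def FreeReach : S × (Fin d → ℕ) → S × (Fin d → ℕ) → Prop :=
  ReflTransGen (Step out fun k => k < 2)

/-- A reset-free loop starting with a marked transition, not decreasing the counters,
exists at `x`. -/
def LoopAt (x : S × (Fin d → ℕ)) : Prop :=
  ∃ y z, Step out (fun k => k = 1) x y ∧ FreeReach out y z ∧ z.1 = x.1 ∧ x.2 ≤ z.2

/-- A configuration with a marked reset-free nondecreasing loop is reachable. -/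
def HasLasso (d : ℕ) (s₀ : S) : Prop :=
  ∃ x : S × (Fin d → ℕ), Reach out (s₀, 0) x ∧ LoopAt out x

/-- There is an infinite run using marked transitions infinitely often. -/
def IsMarkedRun (s₀ : S) (x : ℕ → S × (Fin d → ℕ)) (t : ℕ → CounterTrans S) : Prop :=
  x 0 = (s₀, 0) ∧ (∀ n, StepBy out (t n) (x n) (x (n + 1))) ∧ ∀ N, ∃ n, N ≤ n ∧ kind (t n) = 1

variable {out}

theorem FreeReach.add {s s' : S} {m m' : Fin d → ℕ} (h : FreeReach out (s, m) (s', m'))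
    (k : Fin d → ℕ) : FreeReach out (s, m + k) (s', m' + k) := by
  refine ReflTransGen.lift (r := Step out fun k => k < 2)
    (fun x : S × (Fin d → ℕ) => (x.1, x.2 + k)) ?_ _ _ h
  rintro a b ⟨t, ht, h1, h2, h3⟩
  exact ⟨t, ht, h1, h2, h3.add ht k⟩

theorem LoopAt.mono {s : S} {m n : Fin d → ℕ} (h : LoopAt out (s, m)) (hn : m ≤ n) :
    LoopAt out (s, n) := by
  obtain ⟨k, rfl⟩ : ∃ k, n = m + k := ⟨n - m, (add_tsub_cancel_of_le hn).symm⟩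
  obtain ⟨y, z, ⟨t, ht, h1, h2, h3⟩, hr, hz, hle⟩ := h
  refine ⟨(y.1, y.2 + k), (z.1, z.2 + k), ⟨t, ht, h1, h2, h3.add (by omega) k⟩, hr.add k, hz, ?_⟩
  exact add_le_add_left hle k

theorem FreeReach.reach {x y : S × (Fin d → ℕ)} (h : FreeReach out x y) : Reach out x y :=
  ReflTransGen.mono (fun _ _ ⟨t, _, h⟩ => ⟨t, trivial, h⟩) _ _ h

theorem Reach.mono_left {x y : S × (Fin d → ℕ)} (h : Reach out x y) {n : Fin d → ℕ}
    (hn : x.2 ≤ n) : ∃ n', Reach out (x.1, n) (y.1, n') ∧ y.2 ≤ n' := by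
  induction h with
  | refl => exact ⟨n, .refl, hn⟩
  | tail _ hs ih =>
    obtain ⟨n', hn', hle⟩ := ih
    obtain ⟨t, -, h1, h2, h3⟩ := hs
    obtain ⟨n'', h4, h5⟩ := h3.mono hle
    exact ⟨n'', hn'.tail ⟨t, trivial, h1, h2, h4⟩, h5⟩

/-- A marked loop can be reached in `n` steps. -/
def LoopIn (out : S → List (CounterTrans S)) : ℕ → S × (Fin d → ℕ) → Prop
  | 0, x => LoopAt out x
  | n + 1, x => ∃ y, Step out (fun _ => True) x y ∧ LoopIn out n y

theorem exists_loopIn {x z : S × (Fin d → ℕ)} (h : Reach out x z) (hz : LoopAt out z) :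
    ∃ n, LoopIn out n x := by
  induction h using ReflTransGen.head_induction_on with
  | refl => exact ⟨0, hz⟩
  | head hs _ ih =>
    obtain ⟨n, hn⟩ := ih
    exact ⟨n + 1, _, hs, hn⟩

/-- The loop ends in the same state with counters at least as large, so by `LoopAt.mono` it is
available again there. -/
theorem HasLasso.exists_isMarkedRun {s₀ : S} (h : HasLasso out d s₀) :
    ∃ (x : ℕ → S × (Fin d → ℕ)) (t : ℕ → CounterTrans S), IsMarkedRun out s₀ x t := by
  obtain ⟨z, hz, hl⟩ := h
  obtain ⟨n₀, hn₀⟩ := exists_loopIn hz hl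
  -- The first component counts the steps left until a configuration with a loop. At zero a marked
  -- transition fires and the countdown starts anew.
  obtain ⟨f, hf0, hf⟩ := exists_seq_step (A := fun _ (a : ℕ × (S × (Fin d → ℕ))) => LoopIn out a.1 a.2)
    (B := fun _ a b => ∃ t, StepBy out t a.2 b.2 ∧ (a.1 = 0 → kind t = 1) ∧
      ∀ k, a.1 = k + 1 → b.1 = k) (a₀ := (n₀, (s₀, 0))) hn₀ (by
    rintro - ⟨n, x⟩ hx
    cases n with
    | zero =>
      obtain ⟨y, z, ⟨t, ht, hs⟩, hr, hz, hle⟩ := id hx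
      have hz' : LoopAt out z := by
        have : z = (x.1, z.2) := Prod.ext hz rfl
        rw [this]
        exact LoopAt.mono (show LoopAt out (x.1, x.2) from hx) hle
      obtain ⟨k, hk⟩ := exists_loopIn hr.reach hz'
      exact ⟨(k, y), hk, t, hs, fun _ => ht, by simp⟩
    | succ n =>
      obtain ⟨y, ⟨t, -, hs⟩, hy⟩ := hx
      exact ⟨(n, y), hy, t, hs, by simp, by simp⟩)
  choose _ t ht using hf
  refine ⟨fun n => (f n).2, t, congrArg Prod.snd hf0, fun n => (ht n).1, ?_⟩
  have key : ∀ k N, (f N).1 = k → ∃ n, N ≤ n ∧ (f n).1 = 0 := by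
    intro k
    induction k with
    | zero => exact fun N h => ⟨N, le_rfl, h⟩
    | succ k ih =>
      intro N hN
      obtain ⟨n, hn, h0⟩ := ih (N + 1) ((ht N).2.2 k hN)
      exact ⟨n, by omega, h0⟩
  intro N
  obtain ⟨n, hn, h0⟩ := key _ N rfl
  exact ⟨n, hn, (ht n).2.1 h0⟩

/-- By Dickson's lemma two of the infinitely many marked positions have equal states and ordered
counters. No reset occurs from the first of them on, so the segment between them is the loop. -/
theorem IsMarkedRun.hasLasso {s₀ : S} {x : ℕ → S × (Fin d → ℕ)} {t : ℕ → CounterTrans S}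
    (h : IsMarkedRun out s₀ x t) (hfin : (Set.range fun n => (x n).1).Finite)
    (hfree : ∀ n k, kind (t n) = 1 → n ≤ k → kind (t k) < 2) : HasLasso out d s₀ := by
  obtain ⟨h0, hs, hm⟩ := h
  obtain ⟨g, hg, hgm⟩ := Nat.exists_strictMono_subsequence (P := fun n => kind (t n) = 1)
    (fun N => by
      obtain ⟨n, hn, h⟩ := hm (N + 1)
      exact ⟨n, by omega, h⟩)
  have : Finite (Set.range fun n => (x n).1) := hfin
  obtain ⟨i, j, hij, h1, h2⟩ := ((Finite.wellQuasiOrdered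
    (α := Set.range fun n => (x n).1) (· = ·)).prod
      (wellQuasiOrdered_le (α := Fin d → ℕ))) (fun k => (⟨_, g k, rfl⟩, (x (g k)).2))
  have hreach : ∀ n, Reach out (x 0) (x n) := by
    intro n
    induction n with
    | zero => exact .refl
    | succ n ih => exact ih.tail ⟨_, trivial, hs n⟩
  have hfr : ∀ n, FreeReach out (x (g i + 1)) (x (g i + 1 + n)) := by
    intro n
    induction n with
    | zero => exact .refl
    | succ n ih => exact ih.tail ⟨_, hfree _ _ (hgm i) (by omega), hs _⟩
  refine ⟨x (g i), h0 ▸ hreach _, x (g i + 1), x (g j), ⟨_, hgm i, hs _⟩, ?_, ?_, h2⟩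
  · have := hfr (g j - (g i + 1))
    have h3 := hg hij
    rwa [Nat.add_sub_cancel' h3] at this
  · exact (congrArg Subtype.val h1).symm

end CounterSystem

/-! ### Soundness of certificates. -/

namespace WeightedGraph

variable {N ε ι : Type*} [Fintype ι] {G : WeightedGraph N ε ι} {E : Finset ε}

/-- The linear weight is constant along the walk, so the inequalities of the single edges telescope.
-/
theorem IsWalk.ranking_le {r : N → (ι → ℕ) × ℕ} {u v : N} {es : List ε} (hw : G.IsWalk E u es v)
    (h : ∀ e ∈ es, G.Tight r e ∨ G.Strict r e) :
    (r u).1 = (r v).1 ∧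
      ∑ i, ((r u).1 i : ℤ) * G.eff es i + (r v).2 ≤ (r u).2 ∧
      ((∃ e ∈ es, G.Strict r e) → ∑ i, ((r u).1 i : ℤ) * G.eff es i + (r v).2 < (r u).2) := by
  induction es generalizing u with
  | nil => cases hw; simp
  | cons e es ih =>
    obtain ⟨he, rfl, hw⟩ := hw
    obtain ⟨h1, h2, h3⟩ := ih hw fun e' he' => h e' (List.mem_cons_of_mem _ he')
    have he := h e List.mem_cons_self
    have hy : (r (G.src e)).1 = (r (G.tgt e)).1 := he.elim And.left And.left
    have hle : ∑ i, ((r (G.src e)).1 i : ℤ) * G.wt e i + (r (G.tgt e)).2 ≤ (r (G.src e)).2 :=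
      he.elim (fun h => h.2.le) (fun h => h.2.le)
    simp only [eff_cons, Pi.add_apply, mul_add, Finset.sum_add_distrib]
    rw [← hy] at h1 h2 h3
    refine ⟨h1, by linarith, ?_⟩
    rintro ⟨e', he', hs⟩
    rcases List.mem_cons.1 he' with rfl | he'
    · have := hs.2
      linarith
    · have := h3 ⟨e', he', hs⟩
      linarith

/-- On a closed walk the potentials cancel, so a strict edge at a level where all other edges are
tight or strict would make a nonnegative combination of `G.eff es` negative. Hence, level by level,
all edges are tight, and tight edges are unmarked. -/
theorem not_mark_of_lex_ranking {L : ℕ} {r : ℕ → N → (ι → ℕ) × ℕ}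
    (h : ∀ e ∈ E, (∃ l < L, G.Strict (r l) e ∧ ∀ l' < l, G.Tight (r l') e) ∨
      ((∀ l < L, G.Tight (r l) e) ∧ ¬ G.mark e))
    {u : N} {es : List ε} (hw : G.IsWalk E u es u) (heff : 0 ≤ G.eff es) :
    ∀ e ∈ es, ¬ G.mark e := by
  have hns : ∀ l e, G.Tight (r l) e → ¬ G.Strict (r l) e := fun l e h1 h2 =>
    absurd h1.2 h2.2.ne
  have key : ∀ l ≤ L, ∀ l' < l, ∀ e ∈ es, G.Tight (r l') e := by
    intro l
    induction l with
    | zero => simp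
    | succ l ih =>
      intro hl
      have ih := ih (by omega)
      have hts : ∀ e ∈ es, G.Tight (r l) e ∨ G.Strict (r l) e := by
        intro e he
        rcases h e (hw.mem e he) with ⟨k, hk, hs, ht⟩ | ⟨ht, -⟩
        · rcases lt_trichotomy k l with hkl | rfl | hkl
          · exact absurd hs (hns _ _ (ih k hkl e he))
          · exact Or.inr hs
          · exact Or.inl (ht l hkl)
        · exact Or.inl (ht l (by omega))
      intro l' hl' e he
      rcases Nat.lt_succ_iff_lt_or_eq.1 hl' with hlt | rfl
      · exact ih l' hlt e he
      · refine (hts e he).resolve_right fun hs => ?_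
        have h1 := (hw.ranking_le hts).2.2 ⟨e, he, hs⟩
        have h2 : 0 ≤ ∑ i, ((r l' u).1 i : ℤ) * G.eff es i :=
          Finset.sum_nonneg fun i _ => mul_nonneg (by positivity) (heff i)
        linarith
  intro e he
  rcases h e (hw.mem e he) with ⟨k, hk, hs, -⟩ | ⟨-, hm⟩
  · exact absurd hs (hns _ _ (key L le_rfl k hk e he))
  · exact hm

end WeightedGraph

/-- Membership in the ideal given by a list of strict bounds, where `0` stands for no bound. -/
def InIdeal {d : ℕ} (v : ℕ → ℕ) (m : Fin d → ℕ) : Prop :=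
  ∀ i : Fin d, v i = 0 ∨ m i < v i

/-- The `i`-th bound of a list of bounds. -/
def bound (v : List ℕ) (i : ℕ) : ℕ := v.getD i 0

namespace CounterSystem

open CounterTrans Relation

variable {S : Type*} {d : ℕ} {out : S → List (CounterTrans S)}

/-- Some element of the ideal with bounds `v` enables `t`. -/
def Enables (d : ℕ) (v : List ℕ) (t : CounterTrans S) : Prop :=
  ∀ i < d, bound v i = 0 ∨ pre t i < bound v i

/-- Firing `t` leads from the ideal with bounds `v` into the ideal with bounds `w`. -/
def Covers (d : ℕ) (v : List ℕ) (t : CounterTrans S) (w : List ℕ) : Prop :=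
  ∀ i < d, bound w i = 0 ∨ kind t = i + 2 ∨
    (bound v i ≠ 0 ∧ bound v i + post t i ≤ bound w i + pre t i)

theorem Enables.of_fires {v : List ℕ} {t : CounterTrans S} {m m' : Fin d → ℕ}
    (hm : InIdeal (bound v) m) (h : Fires t m m') : Enables d v t := fun i hi =>
  (hm ⟨i, hi⟩).imp_right fun h1 => (h ⟨i, hi⟩).1.trans_lt h1

theorem Covers.inIdeal {v w : List ℕ} {t : CounterTrans S} {m m' : Fin d → ℕ}
    (hm : InIdeal (bound v) m) (h : Fires t m m') (hc : Covers d v t w) :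
    InIdeal (bound w) m' := by
  intro i
  have h1 := hm i
  have h2 := h i
  have h3 := hc i i.2
  rcases h3 with h3 | h3 | ⟨h3, h4⟩
  · exact Or.inl h3
  · simp only [h3, if_true] at h2
    omega
  · split_ifs at h2 <;> omega

/-- The edges of the graph on finitely many ideals given by the reset-free transitions. -/
def IsIdealEdge {N : Type*} (out : S → List (CounterTrans S)) (d : ℕ) (st : N → S)
    (bd : N → List ℕ) (D : List N) (e : N × CounterTrans S × N) : Prop :=
  e.1 ∈ D ∧ e.2.2 ∈ D ∧ e.2.1 ∈ out (st e.1) ∧ Enables d (bd e.1) e.2.1 ∧ kind e.2.1 < 2 ∧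
    st e.2.2 = e.2.1.1 ∧ Covers d (bd e.1) e.2.1 (bd e.2.2)

theorem finite_isIdealEdge {N : Type*} (out : S → List (CounterTrans S)) (d : ℕ) (st : N → S)
    (bd : N → List ℕ) (D : List N) : Finite {e // IsIdealEdge out d st bd D e} := by
  have h1 : Set.Finite {I | I ∈ D} := D.finite_toSet
  have h2 : Set.Finite (⋃ I ∈ {I | I ∈ D}, {t | t ∈ out (st I)}) :=
    h1.biUnion fun I _ => (out (st I)).finite_toSet
  refine Set.Finite.subset (h1.prod (h2.prod h1)) fun e he => ?_
  exact ⟨he.1, Set.mem_biUnion he.1 he.2.2.1, he.2.1⟩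

/-- The graph of ideals. -/
def idealGraph {N : Type*} (out : S → List (CounterTrans S)) (d : ℕ) (st : N → S)
    (bd : N → List ℕ) (D : List N) :
    WeightedGraph N {e // IsIdealEdge out d st bd D e} (Fin d) where
  src e := e.1.1
  tgt e := e.1.2.2
  wt e i := (post e.1.2.1 i : ℤ) - pre e.1.2.1 i
  mark e := kind e.1.2.1 = 1

/-- A node of a certificate: a state, a list of bounds, and a list of ranking values. -/
abbrev Node (S : Type*) : Type _ := S × List ℕ × List (List ℕ × ℕ)

/-- The scalar product of the first `d` entries. -/
def dot (d : ℕ) (y : List ℕ) (z : List ℕ) : ℕ :=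
  ((List.range d).map fun i => y.getD i 0 * z.getD i 0).sum

/-- The ranking value at level `l`. -/
def level (r : List (List ℕ × ℕ)) (l : ℕ) : List ℕ × ℕ := r.getD l ([], 0)

/-- A ranking level that is unchanged along a transition. -/
def TightAt (d : ℕ) (t : CounterTrans S) (a b : List ℕ × ℕ) : Prop :=
  a.1 = b.1 ∧ dot d a.1 t.2.2.1 + b.2 = dot d a.1 t.2.1 + a.2

/-- A ranking level that decreases along a transition. -/
def StrictAt (d : ℕ) (t : CounterTrans S) (a b : List ℕ × ℕ) : Prop :=
  a.1 = b.1 ∧ dot d a.1 t.2.2.1 + b.2 < dot d a.1 t.2.1 + a.2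

/-- The lexicographic condition on the rankings at both ends of a transition. -/
def LexAt (d L : ℕ) (t : CounterTrans S) (a b : List (List ℕ × ℕ)) : Prop :=
  (∃ l < L, StrictAt d t (level a l) (level b l) ∧
    ∀ l' < l, TightAt d t (level a l') (level b l')) ∨
  ((∀ l < L, TightAt d t (level a l) (level b l)) ∧ kind t ≠ 1)

/-- A certificate that no marked loop is reachable: finitely many ideals that cover
the initial configuration and are closed under steps, with a lexicographic ranking. -/
def IsInvariant (out : S → List (CounterTrans S)) (d : ℕ) (s₀ : S) (L : ℕ)
    (D : List (Node S)) : Prop :=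
  (∃ I ∈ D, I.1 = s₀) ∧
  ∀ I ∈ D, ∀ t ∈ out I.1, Enables d I.2.1 t →
    (∃ J ∈ D, J.1 = t.1 ∧ Covers d I.2.1 t J.2.1) ∧
    (kind t < 2 → ∀ J ∈ D, J.1 = t.1 → Covers d I.2.1 t J.2.1 → LexAt d L t I.2.2 J.2.2)

theorem sum_eq_dot (y z : List ℕ) :
    ∑ i : Fin d, ((y.getD i 0 : ℕ) : ℤ) * (z.getD i 0 : ℕ) = dot d y z := by
  induction d with
  | zero => simp [dot]
  | succ d ih =>
    rw [Fin.sum_univ_castSucc]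
    simp only [Fin.val_castSucc, Fin.val_last]
    rw [ih]
    simp [dot, List.range_succ]

/-- The edges between the nodes of a certificate. -/
abbrev NodeEdge (out : S → List (CounterTrans S)) (d : ℕ) (D : List (Node S)) : Type _ :=
  {e // IsIdealEdge out d (fun I : Node S => I.1) (fun I => I.2.1) D e}

/-- The graph on the nodes of a certificate. -/
abbrev nodeGraph (out : S → List (CounterTrans S)) (d : ℕ) (D : List (Node S)) :
    WeightedGraph (Node S) (NodeEdge out d D) (Fin d) :=
  idealGraph out d (fun I : Node S => I.1) (fun I => I.2.1) D

/-- The ranking of nodes at level `l`. -/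
def nodeLevel (d l : ℕ) (I : Node S) : (Fin d → ℕ) × ℕ :=
  (fun i => (level I.2.2 l).1.getD i 0, (level I.2.2 l).2)

theorem sum_mul_wt (y : List ℕ) (t : CounterTrans S) :
    ∑ i : Fin d, ((y.getD i 0 : ℕ) : ℤ) * ((post t i : ℤ) - pre t i) =
      dot d y t.2.2.1 - dot d y t.2.1 := by
  rw [← sum_eq_dot, ← sum_eq_dot, ← Finset.sum_sub_distrib]
  exact Finset.sum_congr rfl fun i _ => mul_sub _ _ _

variable {s₀ : S} {L : ℕ} {D : List (Node S)}

theorem IsInvariant.exists_node_of_stepBy (h : IsInvariant out d s₀ L D) {I : Node S} (hI : I ∈ D)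
    {x y : S × (Fin d → ℕ)} (hs : I.1 = x.1) (hx : InIdeal (bound I.2.1) x.2)
    {t : CounterTrans S} (hst : StepBy out t x y) :
    ∃ J ∈ D, J.1 = y.1 ∧ InIdeal (bound J.2.1) y.2 ∧ Covers d I.2.1 t J.2.1 := by
  obtain ⟨h1, h2, h3⟩ := hst
  obtain ⟨J, hJ, hJ1, hJ2⟩ := (h.2 I hI t (hs ▸ h1) (.of_fires hx h3)).1
  exact ⟨J, hJ, hJ1.trans h2, hJ2.inIdeal hx h3, hJ2⟩

theorem IsInvariant.exists_node (h : IsInvariant out d s₀ L D) {x : S × (Fin d → ℕ)}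
    (hx : Reach out (s₀, 0) x) : ∃ I ∈ D, I.1 = x.1 ∧ InIdeal (bound I.2.1) x.2 := by
  induction hx with
  | refl =>
    obtain ⟨I, hI, hs⟩ := h.1
    exact ⟨I, hI, hs, fun i => (Nat.eq_zero_or_pos _)⟩
  | tail _ hs ih =>
    obtain ⟨I, hI, hI1, hI2⟩ := ih
    obtain ⟨t, -, ht⟩ := hs
    obtain ⟨J, hJ, h1, h2, -⟩ := h.exists_node_of_stepBy hI hI1 hI2 ht
    exact ⟨J, hJ, h1, h2⟩

theorem IsInvariant.exists_edge (h : IsInvariant out d s₀ L D) {I : Node S} (hI : I ∈ D)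
    {x y : S × (Fin d → ℕ)} (hs : I.1 = x.1) (hx : InIdeal (bound I.2.1) x.2)
    {t : CounterTrans S} (hst : StepBy out t x y) (hk : kind t < 2) :
    ∃ J ∈ D, J.1 = y.1 ∧ InIdeal (bound J.2.1) y.2 ∧
      ∃ e : NodeEdge out d D,
        e.1.1 = I ∧ e.1.2.2 = J ∧ e.1.2.1 = t ∧
        (fun i => (y.2 i : ℤ)) = (fun i => (x.2 i : ℤ)) + (nodeGraph out d D).wt e := by
  obtain ⟨J, hJ, h1, h2, h3⟩ := h.exists_node_of_stepBy hI hs hx hst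
  refine ⟨J, hJ, h1, h2, ⟨(I, t, J), hI, hJ, by simpa [hs] using hst.1, .of_fires hx hst.2.2, hk,
    h1.trans hst.2.1.symm, h3⟩, rfl, rfl, rfl, ?_⟩
  funext i
  have := hst.2.2 i
  rw [if_neg (by omega)] at this
  simp only [Pi.add_apply, idealGraph]
  omega

theorem IsInvariant.exists_walk [Fintype (NodeEdge out d D)] (h : IsInvariant out d s₀ L D) {I : Node S} (hI : I ∈ D)
    {x y : S × (Fin d → ℕ)} (hs : I.1 = x.1) (hx : InIdeal (bound I.2.1) x.2)
    (hr : FreeReach out x y) :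
    ∃ J ∈ D, J.1 = y.1 ∧ InIdeal (bound J.2.1) y.2 ∧
      ∃ es, (nodeGraph out d D).IsWalk Finset.univ I es J ∧
        (fun i => (y.2 i : ℤ)) = (fun i => (x.2 i : ℤ)) + (nodeGraph out d D).eff es := by
  induction hr with
  | refl => exact ⟨I, hI, hs, hx, [], rfl, by simp⟩
  | tail _ hst ih =>
    obtain ⟨J, hJ, h1, h2, es, h3, h4⟩ := ih
    obtain ⟨t, hk, ht⟩ := hst
    obtain ⟨K, hK, h5, h6, e, he1, he2, -, he3⟩ := h.exists_edge hJ h1 h2 ht hk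
    refine ⟨K, hK, h5, h6, es ++ [e], h3.append ⟨Finset.mem_univ _, he1, he2⟩, ?_⟩
    rw [he3, h4, WeightedGraph.eff_append, add_assoc]
    simp

theorem IsInvariant.lex (h : IsInvariant out d s₀ L D)
    (e : NodeEdge out d D) :
    (∃ l < L, (nodeGraph out d D).Strict (nodeLevel d l) e ∧
      ∀ l' < l, (nodeGraph out d D).Tight (nodeLevel d l') e) ∨
    ((∀ l < L, (nodeGraph out d D).Tight (nodeLevel d l) e) ∧
      ¬ (nodeGraph out d D).mark e) := by
  obtain ⟨⟨I, t, J⟩, hI, hJ, ht, hen, hk, hst, hc⟩ := e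
  have htight : ∀ l, TightAt d t (level I.2.2 l) (level J.2.2 l) →
      (nodeGraph out d D).Tight (nodeLevel d l) ⟨(I, t, J), hI, hJ, ht, hen, hk, hst, hc⟩ := by
    rintro l ⟨h1, h2⟩
    refine ⟨by simp only [nodeLevel, idealGraph, h1], ?_⟩
    have := sum_mul_wt (d := d) (level I.2.2 l).1 t
    simp only [nodeLevel, idealGraph]
    rw [this]
    omega
  have hstrict : ∀ l, StrictAt d t (level I.2.2 l) (level J.2.2 l) →
      (nodeGraph out d D).Strict (nodeLevel d l) ⟨(I, t, J), hI, hJ, ht, hen, hk, hst, hc⟩ := by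
    rintro l ⟨h1, h2⟩
    refine ⟨by simp only [nodeLevel, idealGraph, h1], ?_⟩
    have := sum_mul_wt (d := d) (level I.2.2 l).1 t
    simp only [nodeLevel, idealGraph]
    rw [this]
    omega
  rcases (h.2 I hI t ht hen).2 hk J hJ hst hc with ⟨l, hl, h1, h2⟩ | ⟨h1, h2⟩
  · exact Or.inl ⟨l, hl, hstrict l h1, fun l' hl' => htight l' (h2 l' hl')⟩
  · exact Or.inr ⟨fun l hl => htight l (h1 l hl), h2⟩

/-- Let `k` be the gain of the loop. It can be iterated for ever, and the certificate follows each
iteration by a walk of effect `k` with a marked edge. As `D` is finite, two iterations start in the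
same node. The closed walk between them has nonnegative effect, against `not_mark_of_lex_ranking`.
-/
theorem IsInvariant.not_hasLasso (h : IsInvariant out d s₀ L D) : ¬ HasLasso out d s₀ := by
  rintro ⟨⟨s, m⟩, hreach, y, z, ⟨t, ht, hst⟩, hfr, hz, hle⟩
  have := finite_isIdealEdge out d (fun I : Node S => I.1) (fun I => I.2.1) D
  have := Fintype.ofFinite (NodeEdge out d D)
  set G := nodeGraph out d D with hG
  obtain ⟨k, hk⟩ : ∃ k, z.2 = m + k := ⟨z.2 - m, (add_tsub_cancel_of_le hle).symm⟩
  obtain ⟨I₀, hI₀, hs₀, hm₀⟩ := h.exists_node hreach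
  -- The node `f n` contains the configuration before the iteration with index `n`, whose counters
  -- are `m + n • k`.
  obtain ⟨f, -, hf⟩ := exists_seq_step
    (A := fun n I => I ∈ D ∧ I.1 = s ∧ InIdeal (bound I.2.1) (m + n • k))
    (B := fun n I J => ∃ es, G.IsWalk Finset.univ I es J ∧ (∃ e ∈ es, G.mark e) ∧
      G.eff es = fun i => (k i : ℤ)) (a₀ := I₀) ⟨hI₀, hs₀, by simpa using hm₀⟩ (by
    rintro n I ⟨hI, hs, hm⟩
    have hst' : StepBy out t (s, m + n • k) (y.1, y.2 + n • k) :=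
      ⟨hst.1, hst.2.1, hst.2.2.add (by omega) _⟩
    obtain ⟨J, hJ, h1, h2, e, he1, he2, he3, he4⟩ := h.exists_edge hI hs hm hst' (by omega)
    have hfr' := FreeReach.add (s := y.1) (m := y.2) (s' := z.1) (m' := z.2) hfr (n • k)
    obtain ⟨K, hK, h3, h4, es, h5, h6⟩ := h.exists_walk hJ h1 h2 hfr'
    refine ⟨K, ⟨hK, h3.trans hz, ?_⟩, e :: es, ⟨Finset.mem_univ _, he1, ?_⟩,
      ⟨e, by simp, ?_⟩, ?_⟩
    · have : z.2 + n • k = m + (n + 1) • k := by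
        rw [hk, add_smul, one_smul]; abel
      rwa [← this]
    · change G.IsWalk _ e.1.2.2 es K
      rw [he2]
      exact h5
    · rw [← he3] at ht
      exact ht
    · rw [he4, hk] at h6
      rw [WeightedGraph.eff_cons]
      funext i
      have := congrFun h6 i
      simp only [Pi.add_apply, Nat.cast_add] at this
      simp only [Pi.add_apply]
      linarith)
  have hwalk : ∀ a n, ∃ es, G.IsWalk Finset.univ (f a) es (f (a + n)) ∧ 0 ≤ G.eff es ∧
      (0 < n → ∃ e ∈ es, G.mark e) := by
    intro a n
    induction n with
    | zero => exact ⟨[], rfl, by simp, by simp⟩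
    | succ n ih =>
      obtain ⟨es, h1, h2, -⟩ := ih
      obtain ⟨es', h3, ⟨e, he, hme⟩, h4⟩ := (hf (a + n)).2
      refine ⟨es ++ es', h1.append h3, ?_, fun _ => ⟨e, by simp [he], hme⟩⟩
      rw [WeightedGraph.eff_append]
      refine add_nonneg h2 ?_
      rw [h4]
      exact fun i => Int.natCast_nonneg _
  obtain ⟨a, b, hab, heq⟩ : ∃ a b, a < b ∧ f a = f b := by
    have hfin : Finite {I | I ∈ D} := D.finite_toSet
    obtain ⟨a, b, hne, heq⟩ := Finite.exists_ne_map_eq_of_infinite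
      (fun n => (⟨f n, (hf n).1.1⟩ : {I | I ∈ D}))
    have heq := congrArg Subtype.val heq
    rcases lt_or_gt_of_ne hne with hlt | hlt
    exacts [⟨a, b, hlt, heq⟩, ⟨b, a, hlt, heq.symm⟩]
  obtain ⟨es, h1, h2, h3⟩ := hwalk a (b - a)
  rw [Nat.add_sub_cancel' hab.le, ← heq] at h1
  obtain ⟨e, he, hme⟩ := h3 (by omega)
  exact WeightedGraph.not_mark_of_lex_ranking (fun e _ => h.lex e) h1 h2 e he hme

end CounterSystem

/-! ### Completeness of certificates: ideals of configurations without reachable loops. -/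

/-- The minimal elements of the complement form an antichain, which is finite in a well-quasi-order.
-/
theorem exists_finset_basis {α : Type*} [PartialOrder α] [WellQuasiOrderedLE α] {D : Set α}
    (hD : IsLowerSet D) : ∃ B : Finset α, ∀ m, m ∈ D ↔ ∀ b ∈ B, ¬ b ≤ m := by
  have hfin : {b | Minimal (· ∉ D) b}.Finite :=
    WellQuasiOrderedLE.finite_of_isAntichain (setOfPred_minimal_antichain _)
  refine ⟨hfin.toFinset, fun m => ⟨fun hm b hb hle => ?_, fun h => ?_⟩⟩
  · exact (hfin.mem_toFinset.1 hb).1 (hD hle hm)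
  · by_contra hm
    obtain ⟨b, hle, hb⟩ := exists_minimal_le_of_wellFoundedLT (· ∉ D) m hm
    exact h b (hfin.mem_toFinset.2 hb) hle

/-- A downward closed set of vectors is a finite union of ideals. -/
theorem exists_finset_ideals {d : ℕ} {D : Set (Fin d → ℕ)} (hD : IsLowerSet D) :
    ∃ V : Finset (Fin d → ℕ), ∀ m, m ∈ D ↔ ∃ v ∈ V, ∀ i, v i = 0 ∨ m i < v i := by
  classical
  obtain ⟨B, hB⟩ := exists_finset_basis hD
  suffices h : ∃ V : Finset (Fin d → ℕ), ∀ m, (∀ b ∈ B, ¬ b ≤ m) ↔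
      ∃ v ∈ V, ∀ i, v i = 0 ∨ m i < v i by
    obtain ⟨V, hV⟩ := h
    exact ⟨V, fun m => (hB m).trans (hV m)⟩
  clear hB
  induction B using Finset.induction_on with
  | empty => exact ⟨{0}, by simp⟩
  | insert b B _ ih =>
    obtain ⟨V, hV⟩ := ih
    -- To avoid `b` some coordinate must stay below `b j`; `cut` adds this bound to the ideal.
    -- Coordinates with `b j = 0` are dropped: the condition is impossible there, and the entry `0`
    -- would mean no bound.
    let cut : (Fin d → ℕ) × Fin d → (Fin d → ℕ) := fun p =>
      Function.update p.1 p.2 (if p.1 p.2 = 0 then b p.2 else min (p.1 p.2) (b p.2))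
    refine ⟨((V ×ˢ Finset.univ).filter fun p => b p.2 ≠ 0).image cut, fun m => ?_⟩
    have hcut : ∀ v j, b j ≠ 0 → ((∀ i, cut (v, j) i = 0 ∨ m i < cut (v, j) i) ↔
        (∀ i, v i = 0 ∨ m i < v i) ∧ m j < b j) := by
      intro v j hj
      constructor
      · intro h
        refine ⟨fun i => ?_, ?_⟩
        · by_cases hij : i = j
          · subst hij
            have := h i
            simp only [cut, Function.update_self] at this
            split_ifs at this <;> omega
          · have := h i
            simpa only [cut, Function.update_of_ne hij] using this
        · have := h j
          simp only [cut, Function.update_self] at this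
          split_ifs at this <;> omega
      · rintro ⟨h1, h2⟩ i
        by_cases hij : i = j
        · subst hij
          have := h1 i
          simp only [cut, Function.update_self]
          split_ifs <;> omega
        · simpa only [cut, Function.update_of_ne hij] using h1 i
    simp only [Finset.mem_insert, forall_eq_or_imp, hV, Finset.mem_image, Finset.mem_filter,
      Finset.mem_product, Finset.mem_univ, and_true, Prod.exists]
    constructor
    · rintro ⟨hb, v, hv, hvm⟩
      obtain ⟨j, hj⟩ : ∃ j, m j < b j := by
        by_contra! hcon
        exact hb hcon
      have hj0 : b j ≠ 0 := by omega
      exact ⟨_, ⟨v, j, ⟨hv, hj0⟩, rfl⟩, (hcut v j hj0).2 ⟨hvm, hj⟩⟩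
    · rintro ⟨_, ⟨v, j, ⟨hv, hj0⟩, rfl⟩, h⟩
      obtain ⟨h1, h2⟩ := (hcut v j hj0).1 h
      exact ⟨fun hle => absurd (show b j ≤ m j from hle j) (by omega), v, hv, h1⟩

theorem bound_ofFn {d : ℕ} (v : Fin d → ℕ) (i : Fin d) : bound (List.ofFn v) i = v i := by
  simp [bound, List.getD_eq_getElem?_getD]

namespace CounterSystem

open CounterTrans Relation

variable {S : Type*} {d : ℕ} {out : S → List (CounterTrans S)}

/-- A marked loop is reachable from `x`. -/
def ReachesLoop (out : S → List (CounterTrans S)) (x : S × (Fin d → ℕ)) : Prop :=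
  ∃ z, Reach out x z ∧ LoopAt out z

theorem ReachesLoop.mono {s : S} {m n : Fin d → ℕ} (h : ReachesLoop out (s, m)) (hn : m ≤ n) :
    ReachesLoop out (s, n) := by
  obtain ⟨z, hz, hl⟩ := h
  obtain ⟨n', h1, h2⟩ := hz.mono_left hn
  exact ⟨_, h1, LoopAt.mono (show LoopAt out (z.1, z.2) from hl) h2⟩

/-- Larger counters keep a loop reachable, so for each state the valuations without reachable loop
form a downward closed set. The list collects the ideals of these sets for the states in `St`. -/
theorem exists_ideal_list (out : S → List (CounterTrans S)) (d : ℕ) (St : Finset S) :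
    ∃ D : List (S × List ℕ),
      (∀ I ∈ D, I.1 ∈ St ∧ ∀ m : Fin d → ℕ, InIdeal (bound I.2) m → ¬ ReachesLoop out (I.1, m)) ∧
      ∀ s ∈ St, ∀ m : Fin d → ℕ, ¬ ReachesLoop out (s, m) →
        ∃ I ∈ D, I.1 = s ∧ InIdeal (bound I.2) m := by
  have hV : ∀ s, ∃ V : Finset (Fin d → ℕ), ∀ m, ¬ ReachesLoop out (s, m) ↔
      ∃ v ∈ V, ∀ i, v i = 0 ∨ m i < v i := fun s =>
    exists_finset_ideals (D := {m | ¬ ReachesLoop out (s, m)})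
      (fun a b hba ha hb => ha (ReachesLoop.mono hb hba))
  choose V hV using hV
  have hI : ∀ (v m : Fin d → ℕ), InIdeal (bound (List.ofFn v)) m ↔ ∀ i, v i = 0 ∨ m i < v i := by
    intro v m
    simp only [InIdeal, bound_ofFn]
  refine ⟨St.toList.flatMap fun s => (V s).toList.map fun v => (s, List.ofFn v), ?_, ?_⟩
  · intro I hmem
    simp only [List.mem_flatMap, Finset.mem_toList, List.mem_map] at hmem
    obtain ⟨s, hs, v, hv, rfl⟩ := hmem
    exact ⟨hs, fun m hm => (hV s m).2 ⟨v, hv, (hI v m).1 hm⟩⟩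
  · intro s hs m hm
    obtain ⟨v, hv, hvm⟩ := (hV s m).1 hm
    refine ⟨(s, List.ofFn v), ?_, rfl, (hI v m).2 hvm⟩
    simp only [List.mem_flatMap, Finset.mem_toList, List.mem_map]
    exact ⟨s, hs, v, hv, rfl⟩

/-- A single generic element shows that the whole image of the ideal `I` lies in one ideal `J`. It
is maximal on the bounded coordinates, and after the subtraction it is still at least `B` on the
others. As `B` is no less than any bound in `D`, the ideal `J` containing its successor has no bound
on unbounded coordinates that are not reset. -/
theorem exists_covers {D : List (S × List ℕ)} {St : Finset S}
    (hSt : ∀ s ∈ St, ∀ t ∈ out s, t.1 ∈ St)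
    (h1 : ∀ I ∈ D, I.1 ∈ St ∧
      ∀ m : Fin d → ℕ, InIdeal (bound I.2) m → ¬ ReachesLoop out (I.1, m))
    (h2 : ∀ s ∈ St, ∀ m : Fin d → ℕ, ¬ ReachesLoop out (s, m) →
        ∃ I ∈ D, I.1 = s ∧ InIdeal (bound I.2) m)
    {I : S × List ℕ} (hI : I ∈ D) {t : CounterTrans S} (ht : t ∈ out I.1)
    (hen : Enables d I.2 t) : ∃ J ∈ D, J.1 = t.1 ∧ Covers d I.2 t J.2 := by
  obtain ⟨B, hB⟩ : ∃ B, ∀ J ∈ D, ∀ i : Fin d, bound J.2 i ≤ B := by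
    obtain ⟨B, hB⟩ := ((D.finite_toSet.prod (Set.finite_univ (α := Fin d))).image
      fun p => bound p.1.2 p.2).bddAbove
    exact ⟨B, fun J hJ i => hB ⟨(J, i), ⟨hJ, trivial⟩, rfl⟩⟩
  let m : Fin d → ℕ := fun i => if bound I.2 i = 0 then B + pre t i else bound I.2 i - 1
  let m' : Fin d → ℕ := fun i => if kind t = i + 2 then 0 else m i - pre t i + post t i
  have hm : InIdeal (bound I.2) m := by
    intro i
    simp only [m]
    split_ifs <;> omega
  have hf : Fires t m m' := by
    intro i
    refine ⟨?_, rfl⟩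
    have := hen i i.2
    simp only [m]
    split_ifs <;> omega
  have hm' : ¬ ReachesLoop out (t.1, m') := by
    rintro ⟨z, hz, hl⟩
    exact (h1 I hI).2 m hm ⟨z, ReflTransGen.head ⟨t, trivial, ht, rfl, hf⟩ hz, hl⟩
  obtain ⟨J, hJ, hJs, hJm⟩ := h2 _ (hSt _ (h1 I hI).1 t ht) m' hm'
  refine ⟨J, hJ, hJs, fun i hi => ?_⟩
  have h3 := hJm ⟨i, hi⟩
  have h4 := hen i hi
  have h5 := hB J hJ ⟨i, hi⟩
  simp only [m', m] at h3 h5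
  split_ifs at h3 <;> omega

section Graph

variable {N : Type*} {st : N → S} {bd : N → List ℕ} {D : List N}
  {E : Finset {e // IsIdealEdge out d st bd D e}}

theorem IsIdealEdge.bound_cases {e : N × CounterTrans S × N} (h : IsIdealEdge out d st bd D e)
    (i : Fin d) : bound (bd e.2.2) i = 0 ∨ (bound (bd e.1) i ≠ 0 ∧
      bound (bd e.1) i + post e.2.1 i ≤ bound (bd e.2.2) i + pre e.2.1 i) := by
  obtain ⟨-, -, -, -, hk, -, hc⟩ := h
  exact (hc i i.2).imp_right fun h => h.resolve_left (by omega)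

/-- A reset-free edge cannot lead from an unbounded coordinate to a bounded one. -/
theorem walk_bound_eq_zero {u v : N} {es : List {e // IsIdealEdge out d st bd D e}}
    (hw : (idealGraph out d st bd D).IsWalk E u es v) {i : Fin d} (h : bound (bd u) i = 0) :
    ∀ e ∈ es, bound (bd e.1.1) i = 0 ∧ bound (bd e.1.2.2) i = 0 := by
  induction es generalizing u with
  | nil => simp
  | cons e es ih =>
    obtain ⟨-, he, hw⟩ := hw
    have he : e.1.1 = u := he
    subst he
    have ht : bound (bd e.1.2.2) i = 0 := (e.2.bound_cases i).resolve_right fun h' => h'.1 h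
    intro e' he'
    rcases List.mem_cons.1 he' with rfl | he'
    exacts [⟨h, ht⟩, ih hw ht e' he']

/-- Each edge raises the bound by at least its effect. These slacks are nonnegative and add up along
the walk, so if the total slack is zero then every edge has slack zero. -/
theorem walk_bound_ne_zero {u v : N} {es : List {e // IsIdealEdge out d st bd D e}}
    (hw : (idealGraph out d st bd D).IsWalk E u es v) {i : Fin d} (h : bound (bd v) i ≠ 0) :
    bound (bd u) i ≠ 0 ∧ (bound (bd u) i : ℤ) + (idealGraph out d st bd D).eff es i ≤ bound (bd v) i ∧
    ((bound (bd v) i : ℤ) ≤ bound (bd u) i + (idealGraph out d st bd D).eff es i →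
      ∀ e ∈ es, bound (bd e.1.2.2) i ≠ 0 ∧
        bound (bd e.1.1) i + post e.1.2.1 i = bound (bd e.1.2.2) i + pre e.1.2.1 i) := by
  induction es generalizing u with
  | nil => cases hw; simpa using h
  | cons e es ih =>
    obtain ⟨-, he, hw⟩ := hw
    have he : e.1.1 = u := he
    subst he
    obtain ⟨h1, h2, h3⟩ := ih hw
    have h1 : bound (bd e.1.2.2) i ≠ 0 := h1
    obtain ⟨h4, h5⟩ := (e.2.bound_cases i).resolve_left h1
    have h2 : (bound (bd e.1.2.2) i : ℤ) + (idealGraph out d st bd D).eff es i ≤ bound (bd v) i := h2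
    have hwt : (idealGraph out d st bd D).wt e i = (post e.1.2.1 i : ℤ) - pre e.1.2.1 i := rfl
    rw [WeightedGraph.eff_cons, Pi.add_apply, hwt]
    refine ⟨h4, by omega, fun hle e' he' => ?_⟩
    rcases List.mem_cons.1 he' with rfl | he'
    · exact ⟨h1, by omega⟩
    · refine h3 ?_ e' he'
      change (bound (bd v) i : ℤ) ≤ bound (bd e.1.2.2) i + _
      omega

/-- The valuation `m` allows to fire the edges `es` starting in the node `u`. -/
def Executable (m : Fin d → ℕ) (u : N) (es : List {e // IsIdealEdge out d st bd D e}) : Prop :=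
  ∀ i : Fin d, (bound (bd u) i = 0 ∧ (∀ e ∈ es, bound (bd e.1.1) i = 0 ∧ bound (bd e.1.2.2) i = 0) ∧
      (es.map fun e => pre e.1.2.1 i).sum ≤ m i) ∨
    (m i + 1 = bound (bd u) i ∧ ∀ e ∈ es, bound (bd e.1.2.2) i ≠ 0 ∧
      bound (bd e.1.1) i + post e.1.2.1 i = bound (bd e.1.2.2) i + pre e.1.2.1 i)

/-- On a bounded coordinate `m` has the largest value of the ideal, which is enough because the
transition is enabled somewhere in it; an edge without slack leads to the largest value again. On an
unbounded coordinate `m` covers all subtractions of the walk. -/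
theorem Executable.stepBy {m : Fin d → ℕ} {e : {e // IsIdealEdge out d st bd D e}}
    {es : List {e // IsIdealEdge out d st bd D e}} (h : Executable m e.1.1 (e :: es)) :
    ∃ m', StepBy out e.1.2.1 (st e.1.1, m) (st e.1.2.2, m') ∧ Executable m' e.1.2.2 es ∧
      ∀ i, (m' i : ℤ) = m i + (idealGraph out d st bd D).wt e i := by
  obtain ⟨-, -, h1, h2, hk, h3, -⟩ := e.2
  have hpre : ∀ i : Fin d, pre e.1.2.1 i ≤ m i := by
    intro i
    have h4 := h2 i i.2
    rcases h i with ⟨h5, h6, h7⟩ | ⟨h5, h6⟩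
    · simp only [List.map_cons, List.sum_cons] at h7
      omega
    · omega
  refine ⟨fun i => m i - pre e.1.2.1 i + post e.1.2.1 i, ⟨h1, h3.symm, fun i => ⟨hpre i, ?_⟩⟩,
    fun i => ?_, fun i => ?_⟩
  · rw [if_neg (by omega)]
  · have h4 := hpre i
    rcases h i with ⟨h5, h6, h7⟩ | ⟨h5, h6⟩
    · simp only [List.map_cons, List.sum_cons] at h7
      refine Or.inl ⟨(h6 e (by simp)).2, fun e' he' => h6 e' (by simp [he']), by
        dsimp only; omega⟩
    · have h7 := h6 e (by simp)
      refine Or.inr ⟨by dsimp only; omega, fun e' he' => h6 e' (by simp [he'])⟩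
  · have h4 := hpre i
    have hwt : (idealGraph out d st bd D).wt e i = (post e.1.2.1 i : ℤ) - pre e.1.2.1 i := rfl
    dsimp only
    rw [hwt]
    omega

theorem Executable.freeReach {u v : N} {es : List {e // IsIdealEdge out d st bd D e}}
    (hw : (idealGraph out d st bd D).IsWalk E u es v) {m : Fin d → ℕ} (h : Executable m u es) :
    ∃ m', FreeReach out (st u, m) (st v, m') ∧
      ∀ i, (m' i : ℤ) = m i + (idealGraph out d st bd D).eff es i := by
  induction es generalizing u m with
  | nil => cases hw; exact ⟨m, .refl, by simp⟩
  | cons e es ih =>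
    obtain ⟨-, he, hw⟩ := hw
    have he : e.1.1 = u := he
    subst he
    obtain ⟨m₁, h1, h2, h3⟩ := h.stepBy
    obtain ⟨m', h4, h5⟩ := ih hw h2
    refine ⟨m', ReflTransGen.head ⟨_, e.2.2.2.2.2.1, h1⟩ h4, fun i => ?_⟩
    rw [h5, h3, WeightedGraph.eff_cons, Pi.add_apply]
    ring

/-- The walk is rotated to begin with its marked edge. Since it is closed and its effect is
nonnegative, `walk_bound_ne_zero` excludes slack on bounded coordinates, so it can be fired from the
top of the ideal, and it ends no lower than it began. -/
theorem exists_loopAt_of_walk {u : N} {es : List {e // IsIdealEdge out d st bd D e}}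
    (hw : (idealGraph out d st bd D).IsWalk E u es u)
    (hm : ∃ e ∈ es, (idealGraph out d st bd D).mark e)
    (heff : 0 ≤ (idealGraph out d st bd D).eff es) :
    ∃ u ∈ D, ∃ m : Fin d → ℕ, InIdeal (bound (bd u)) m ∧ LoopAt out (st u, m) := by
  obtain ⟨e, he, hm⟩ := hm
  obtain ⟨l₁, l₂, rfl⟩ := List.append_of_mem he
  obtain ⟨w, hw1, hw2⟩ := WeightedGraph.isWalk_append.1 hw
  have hwe : e.1.1 = w := hw2.2.1
  subst hwe
  have hw' := hw2.append hw1
  replace heff : 0 ≤ (idealGraph out d st bd D).eff ((e :: l₂) ++ l₁) := by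
    rwa [WeightedGraph.eff_append, add_comm, ← WeightedGraph.eff_append]
  -- On unbounded coordinates the sum of all subtractions along the walk, on bounded ones the
  -- largest value below the strict bound.
  let m : Fin d → ℕ := fun i => if bound (bd e.1.1) i = 0 then
    (((e :: l₂) ++ l₁).map fun e => pre e.1.2.1 i).sum else bound (bd e.1.1) i - 1
  have hex : Executable m e.1.1 ((e :: l₂) ++ l₁) := by
    intro i
    by_cases h0 : bound (bd e.1.1) i = 0
    · refine Or.inl ⟨h0, walk_bound_eq_zero hw' h0, ?_⟩
      simp only [m, if_pos h0, le_refl]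
    · obtain ⟨-, -, h1⟩ := walk_bound_ne_zero hw' h0
      refine Or.inr ⟨?_, h1 ?_⟩
      · simp only [m, if_neg h0]
        omega
      · have : 0 ≤ (idealGraph out d st bd D).eff ((e :: l₂) ++ l₁) i := heff i
        linarith
  obtain ⟨m₁, h1, h2, h3⟩ := Executable.stepBy hex
  obtain ⟨m', h4, h5⟩ := Executable.freeReach hw'.2.2 h2
  refine ⟨e.1.1, e.2.1, m, ?_, _, _, ⟨_, hm, h1⟩, h4, rfl, fun i => ?_⟩
  · intro i
    simp only [m]
    split_ifs <;> omega
  · have h6 := heff i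
    rw [List.cons_append, WeightedGraph.eff_cons, Pi.add_apply] at h6
    have h7 := h5 i
    rw [h3 i] at h7
    change m i ≤ m' i
    rw [List.append_eq] at h7
    simp only [Pi.zero_apply] at h6
    omega

end Graph

/-- The node of a certificate built from a state, its bounds and its ranking values. -/
def toNode {d : ℕ} (L : ℕ) (r : ℕ → S × List ℕ → (Fin d → ℕ) × ℕ) (I : S × List ℕ) : Node S :=
  (I.1, I.2, (List.range L).map fun l => (List.ofFn (r l I).1, (r l I).2))

theorem level_toNode {L l : ℕ} (hl : l < L) (r : ℕ → S × List ℕ → (Fin d → ℕ) × ℕ)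
    (I : S × List ℕ) : level (toNode L r I).2.2 l = (List.ofFn (r l I).1, (r l I).2) := by
  simp [level, toNode, List.getD_eq_getElem?_getD, hl]

theorem dot_sub_dot_ofFn (y : Fin d → ℕ) (t : CounterTrans S) :
    ∑ i, (y i : ℤ) * ((post t i : ℤ) - pre t i) =
      dot d (List.ofFn y) t.2.2.1 - dot d (List.ofFn y) t.2.1 := by
  rw [← sum_mul_wt]
  refine Finset.sum_congr rfl fun i _ => ?_
  have := bound_ofFn y i
  rw [bound] at this
  rw [this]

/-- The nodes are the ideals of configurations without reachable loop. A closed walk in their graph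
that is marked and has nonnegative effect would yield a loop inside such an ideal, so
`exists_lex_ranking` applies. -/
theorem exists_isInvariant {St : Finset S} (hSt : ∀ s ∈ St, ∀ t ∈ out s, t.1 ∈ St) {s₀ : S}
    (hs₀ : s₀ ∈ St) (h : ¬ HasLasso out d s₀) : ∃ L D, IsInvariant out d s₀ L D := by
  obtain ⟨D, h1, h2⟩ := exists_ideal_list out d St
  have := finite_isIdealEdge out d (fun I : S × List ℕ => I.1) (fun I => I.2) D
  have := Fintype.ofFinite {e // IsIdealEdge out d (fun I : S × List ℕ => I.1) (fun I => I.2) D e}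
  obtain ⟨L, r, hr⟩ := WeightedGraph.exists_lex_ranking
    (G := idealGraph out d (fun I : S × List ℕ => I.1) (fun I => I.2) D) Finset.univ (by
    intro u es hw hm heff
    obtain ⟨u, hu, m, hm, hl⟩ := exists_loopAt_of_walk hw hm heff
    exact (h1 u hu).2 m hm ⟨_, .refl, hl⟩)
  refine ⟨L, D.map (toNode L r), ?_, ?_⟩
  · obtain ⟨I, hI, hIs, -⟩ := h2 s₀ hs₀ 0 h
    exact ⟨toNode L r I, List.mem_map_of_mem hI, hIs⟩
  · intro I' hI' t ht hen
    obtain ⟨I, hI, rfl⟩ := List.mem_map.1 hI'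
    refine ⟨?_, ?_⟩
    · obtain ⟨J, hJ, h3, h4⟩ := exists_covers hSt h1 h2 hI ht hen
      exact ⟨toNode L r J, List.mem_map_of_mem hJ, h3, h4⟩
    · intro hk J' hJ' hst hc
      obtain ⟨J, hJ, rfl⟩ := List.mem_map.1 hJ'
      have hlex := hr ⟨(I, t, J), hI, hJ, ht, hen, hk, hst, hc⟩ (Finset.mem_univ _)
      have htight : ∀ l < L, (idealGraph out d (fun I : S × List ℕ => I.1) (fun I => I.2) D).Tight
          (r l) ⟨(I, t, J), hI, hJ, ht, hen, hk, hst, hc⟩ →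
          TightAt d t (level (toNode L r I).2.2 l) (level (toNode L r J).2.2 l) := by
        rintro l hl ⟨h3, h4⟩
        simp only [idealGraph] at h3 h4
        rw [level_toNode hl, level_toNode hl]
        refine ⟨by simp only [h3], ?_⟩
        rw [dot_sub_dot_ofFn] at h4
        simp only
        omega
      have hstrict : ∀ l < L, (idealGraph out d (fun I : S × List ℕ => I.1) (fun I => I.2) D).Strict
          (r l) ⟨(I, t, J), hI, hJ, ht, hen, hk, hst, hc⟩ →
          StrictAt d t (level (toNode L r I).2.2 l) (level (toNode L r J).2.2 l) := by
        rintro l hl ⟨h3, h4⟩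
        simp only [idealGraph] at h3 h4
        rw [level_toNode hl, level_toNode hl]
        refine ⟨by simp only [h3], ?_⟩
        rw [dot_sub_dot_ofFn] at h4
        simp only
        omega
      rcases hlex with ⟨l, hl, h3, h4⟩ | ⟨h3, h4⟩
      · exact Or.inl ⟨l, hl, hstrict l hl h3, fun l' hl' => htight l' (hl'.trans hl) (h4 l' hl')⟩
      · exact Or.inr ⟨fun l hl => htight l hl (h3 l hl), h4⟩

end CounterSystem

/-! ### Primitive recursive checking of witnesses and parallel search. -/

section Computability

variable {α β γ : Type*} [Primcodable α] [Primcodable β] [Primcodable γ]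

theorem PrimrecPred.forall_mem_of {f : α → List β} (hf : Primrec f) {R : α → β → Prop}
    (hR : PrimrecPred fun p : α × β => R p.1 p.2) : PrimrecPred fun a => ∀ b ∈ f a, R a b :=
  (PrimrecRel.forall_mem_list (R := fun b a => R a b)
    (hR.comp (Primrec.snd.pair Primrec.fst))).comp hf Primrec.id

theorem PrimrecPred.exists_mem_of {f : α → List β} (hf : Primrec f) {R : α → β → Prop}
    (hR : PrimrecPred fun p : α × β => R p.1 p.2) : PrimrecPred fun a => ∃ b ∈ f a, R a b :=
  (PrimrecRel.exists_mem_list (R := fun b a => R a b)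
    (hR.comp (Primrec.snd.pair Primrec.fst))).comp hf Primrec.id

theorem PrimrecPred.forall_lt_of {f : α → ℕ} (hf : Primrec f) {R : α → ℕ → Prop}
    (hR : PrimrecPred fun p : α × ℕ => R p.1 p.2) : PrimrecPred fun a => ∀ b < f a, R a b :=
  (PrimrecPred.forall_mem_of (Primrec.list_range.comp hf) hR).of_eq fun a => by simp

theorem PrimrecPred.exists_lt_of {f : α → ℕ} (hf : Primrec f) {R : α → ℕ → Prop}
    (hR : PrimrecPred fun p : α × ℕ => R p.1 p.2) : PrimrecPred fun a => ∃ b < f a, R a b :=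
  (PrimrecPred.exists_mem_of (Primrec.list_range.comp hf) hR).of_eq fun a => by simp

theorem PrimrecPred.imp {p q : α → Prop} (hp : PrimrecPred p) (hq : PrimrecPred q) :
    PrimrecPred fun a => p a → q a :=
  (hp.not.or hq).of_eq fun _ => imp_iff_not_or.symm

/-- Parallel search for witnesses of one of two primitive recursive relations. -/
theorem exists_computable_of_witnesses {P : α → β → Prop} {Q : α → γ → Prop}
    (hP : PrimrecPred fun p : α × β => P p.1 p.2) (hQ : PrimrecPred fun p : α × γ => Q p.1 p.2)
    (h : ∀ a, (∃ b, P a b) ∨ ∃ c, Q a c) :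
    ∃ f : α → Bool, Computable f ∧ ∀ a, (f a = true → ∃ c, Q a c) ∧ (f a = false → ∃ b, P a b) := by
  classical
  -- One search runs through the codes of `β ⊕ γ`; the side on which a valid witness is found gives
  -- the answer.
  let test : α → ℕ → Option Bool := fun a n =>
    (Encodable.decode (α := β ⊕ γ) n).bind fun x =>
      Sum.casesOn x (fun b => if P a b then some false else none)
        (fun c => if Q a c then some true else none)
  have htest : Primrec₂ test := by
    refine Primrec.option_bind (Primrec.decode.comp Primrec.snd) ?_
    refine Primrec.sumCasesOn Primrec.snd ?_ ?_
    · have h1 : Primrec fun q : ((α × ℕ) × (β ⊕ γ)) × β => (q.1.1.1, q.2) :=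
        (Primrec.fst.comp (Primrec.fst.comp Primrec.fst)).pair Primrec.snd
      exact Primrec.ite (hP.comp h1) (Primrec.const _) (Primrec.const _)
    · have h1 : Primrec fun q : ((α × ℕ) × (β ⊕ γ)) × γ => (q.1.1.1, q.2) :=
        (Primrec.fst.comp (Primrec.fst.comp Primrec.fst)).pair Primrec.snd
      exact Primrec.ite (hQ.comp h1) (Primrec.const _) (Primrec.const _)
  have hdom : ∀ a, (Nat.rfindOpt (test a)).Dom := by
    intro a
    rw [Nat.rfindOpt_dom]
    rcases h a with ⟨b, hb⟩ | ⟨c, hc⟩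
    · exact ⟨Encodable.encode (Sum.inl b : β ⊕ γ), false, by
        simp only [test, Encodable.encodek, Option.bind_some, if_pos hb]; rfl⟩
    · exact ⟨Encodable.encode (Sum.inr c : β ⊕ γ), true, by
        simp only [test, Encodable.encodek, Option.bind_some, if_pos hc]; rfl⟩
  have hspec : ∀ a b, b ∈ Nat.rfindOpt (test a) → (b = true → ∃ c, Q a c) ∧
      (b = false → ∃ b, P a b) := by
    intro a b hb
    obtain ⟨n, hn⟩ := Nat.rfindOpt_spec hb
    obtain ⟨x, -, hx⟩ := Option.bind_eq_some_iff.1 hn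
    rcases x with x | x
    · simp only [Option.ite_none_right_eq_some, Option.some.injEq] at hx
      exact ⟨fun h => by simp [h] at hx, fun _ => ⟨x, hx.1⟩⟩
    · simp only [Option.ite_none_right_eq_some, Option.some.injEq] at hx
      exact ⟨fun _ => ⟨x, hx.1⟩, fun h => by simp [h] at hx⟩
  refine ⟨fun a => (Nat.rfindOpt (test a)).get (hdom a), ?_, fun a => hspec a _ (Part.get_mem _)⟩
  exact (Partrec.rfindOpt htest.to_comp).of_eq_tot fun a => Part.get_mem _

end Computability

namespace CounterSystem

open CounterTrans Relation

section Primrec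

variable {α S : Type*} [Primcodable α] [Primcodable S]

theorem primrec_getD {f : α → List ℕ} {g : α → ℕ} (hf : Primrec f) (hg : Primrec g) :
    Primrec fun a => (f a).getD (g a) 0 :=
  (Primrec.list_getD 0).comp hf hg

theorem primrec_pre {f : α → CounterTrans S} {g : α → ℕ} (hf : Primrec f) (hg : Primrec g) :
    Primrec fun a => pre (f a) (g a) :=
  primrec_getD (Primrec.fst.comp (Primrec.snd.comp hf)) hg

theorem primrec_post {f : α → CounterTrans S} {g : α → ℕ} (hf : Primrec f) (hg : Primrec g) :
    Primrec fun a => post (f a) (g a) :=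
  primrec_getD (Primrec.fst.comp (Primrec.snd.comp (Primrec.snd.comp hf))) hg

theorem primrec_kind {f : α → CounterTrans S} (hf : Primrec f) : Primrec fun a => kind (f a) :=
  Primrec.snd.comp (Primrec.snd.comp (Primrec.snd.comp hf))

theorem primrec_bound {f : α → List ℕ} {g : α → ℕ} (hf : Primrec f) (hg : Primrec g) :
    Primrec fun a => bound (f a) (g a) :=
  primrec_getD hf hg

theorem primrec_dot {d : α → ℕ} {f g : α → List ℕ} (hd : Primrec d) (hf : Primrec f)
    (hg : Primrec g) : Primrec fun a => dot (d a) (f a) (g a) := by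
  have h1 : Primrec fun a => (List.range (d a)).map fun i => (f a).getD i 0 * (g a).getD i 0 :=
    Primrec.list_map (Primrec.list_range.comp hd) (Primrec.nat_mul.comp
      (primrec_getD (hf.comp Primrec.fst) Primrec.snd)
      (primrec_getD (hg.comp Primrec.fst) Primrec.snd))
  have h2 : Primrec fun a => (((List.range (d a)).map fun i =>
      (f a).getD i 0 * (g a).getD i 0).foldr (fun x y => x + y) 0) :=
    Primrec.list_foldr h1 (Primrec.const 0)
      (Primrec.nat_add.comp (Primrec.fst.comp Primrec.snd) (Primrec.snd.comp Primrec.snd)).to₂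
  exact h2.of_eq fun a => by simp [dot, List.sum]

theorem primrecPred_enables {d : α → ℕ} {v : α → List ℕ} {t : α → CounterTrans S}
    (hd : Primrec d) (hv : Primrec v) (ht : Primrec t) :
    PrimrecPred fun a => Enables (d a) (v a) (t a) := by
  refine PrimrecPred.forall_lt_of hd ?_
  have hb := primrec_bound (hv.comp (Primrec.fst (β := ℕ))) Primrec.snd
  exact (Primrec.eq.comp hb (Primrec.const 0)).or
    (Primrec.nat_lt.comp (primrec_pre (ht.comp Primrec.fst) Primrec.snd) hb)

theorem primrecPred_covers {d : α → ℕ} {v w : α → List ℕ} {t : α → CounterTrans S}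
    (hd : Primrec d) (hv : Primrec v) (ht : Primrec t) (hw : Primrec w) :
    PrimrecPred fun a => Covers (d a) (v a) (t a) (w a) := by
  refine PrimrecPred.forall_lt_of hd ?_
  have hbv := primrec_bound (hv.comp (Primrec.fst (β := ℕ))) Primrec.snd
  have hbw := primrec_bound (hw.comp (Primrec.fst (β := ℕ))) Primrec.snd
  have ht' := ht.comp (Primrec.fst (β := ℕ))
  refine (Primrec.eq.comp hbw (Primrec.const 0)).or ((Primrec.eq.comp (primrec_kind ht')
    (Primrec.nat_add.comp Primrec.snd (Primrec.const 2))).or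
    ((Primrec.eq.comp hbv (Primrec.const 0)).not.and ?_))
  exact Primrec.nat_le.comp (Primrec.nat_add.comp hbv (primrec_post ht' Primrec.snd))
    (Primrec.nat_add.comp hbw (primrec_pre ht' Primrec.snd))

theorem primrec_level {r : α → List (List ℕ × ℕ)} {l : α → ℕ} (hr : Primrec r) (hl : Primrec l) :
    Primrec fun a => level (r a) (l a) :=
  (Primrec.list_getD ([], 0)).comp hr hl

theorem primrec_levelValues {d : α → ℕ} {t : α → CounterTrans S} {a b : α → List ℕ × ℕ}
    (hd : Primrec d) (ht : Primrec t) (ha : Primrec a) (hb : Primrec b) :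
    (Primrec fun x => dot (d x) (a x).1 (t x).2.2.1 + (b x).2) ∧
      Primrec fun x => dot (d x) (a x).1 (t x).2.1 + (a x).2 :=
  ⟨Primrec.nat_add.comp (primrec_dot hd (Primrec.fst.comp ha)
      (Primrec.fst.comp (Primrec.snd.comp (Primrec.snd.comp ht)))) (Primrec.snd.comp hb),
    Primrec.nat_add.comp (primrec_dot hd (Primrec.fst.comp ha)
      (Primrec.fst.comp (Primrec.snd.comp ht))) (Primrec.snd.comp ha)⟩

theorem primrecPred_tightAt {d : α → ℕ} {t : α → CounterTrans S} {a b : α → List ℕ × ℕ}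
    (hd : Primrec d) (ht : Primrec t) (ha : Primrec a) (hb : Primrec b) :
    PrimrecPred fun x => TightAt (d x) (t x) (a x) (b x) :=
  (Primrec.eq.comp (Primrec.fst.comp ha) (Primrec.fst.comp hb)).and
    (Primrec.eq.comp (primrec_levelValues hd ht ha hb).1 (primrec_levelValues hd ht ha hb).2)

theorem primrecPred_strictAt {d : α → ℕ} {t : α → CounterTrans S} {a b : α → List ℕ × ℕ}
    (hd : Primrec d) (ht : Primrec t) (ha : Primrec a) (hb : Primrec b) :
    PrimrecPred fun x => StrictAt (d x) (t x) (a x) (b x) :=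
  (Primrec.eq.comp (Primrec.fst.comp ha) (Primrec.fst.comp hb)).and
    (Primrec.nat_lt.comp (primrec_levelValues hd ht ha hb).1 (primrec_levelValues hd ht ha hb).2)

theorem primrecPred_lexAt {d L : α → ℕ} {t : α → CounterTrans S} {a b : α → List (List ℕ × ℕ)}
    (hd : Primrec d) (hL : Primrec L) (ht : Primrec t) (ha : Primrec a) (hb : Primrec b) :
    PrimrecPred fun x => LexAt (d x) (L x) (t x) (a x) (b x) := by
  have htight : PrimrecPred fun p : α × ℕ =>
      TightAt (d p.1) (t p.1) (level (a p.1) p.2) (level (b p.1) p.2) :=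
    primrecPred_tightAt (hd.comp Primrec.fst) (ht.comp Primrec.fst)
      (primrec_level (ha.comp Primrec.fst) Primrec.snd)
      (primrec_level (hb.comp Primrec.fst) Primrec.snd)
  refine (PrimrecPred.exists_lt_of hL (.and ?_ ?_)).or ((PrimrecPred.forall_lt_of hL htight).and
    (Primrec.eq.comp (primrec_kind ht) (Primrec.const 1)).not)
  · exact primrecPred_strictAt (hd.comp Primrec.fst) (ht.comp Primrec.fst)
      (primrec_level (ha.comp Primrec.fst) Primrec.snd)
      (primrec_level (hb.comp Primrec.fst) Primrec.snd)
  · exact PrimrecPred.forall_lt_of Primrec.snd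
      (htight.comp ((Primrec.fst.comp Primrec.fst).pair Primrec.snd))

/-- All quantifiers of `IsInvariant` range over members of given lists or over numbers below given
bounds. -/
theorem primrecPred_isInvariant {out : α → S → List (CounterTrans S)} (hout : Primrec₂ out)
    {d : α → ℕ} (hd : Primrec d) {s₀ : α → S} (hs₀ : Primrec s₀) :
    PrimrecPred fun p : α × (ℕ × List (Node S)) =>
      IsInvariant (out p.1) (d p.1) (s₀ p.1) p.2.1 p.2.2 := by
  have hD : Primrec fun p : α × (ℕ × List (Node S)) => p.2.2 := Primrec.snd.comp Primrec.snd
  refine (PrimrecPred.exists_mem_of hD (Primrec.eq.comp (Primrec.fst.comp Primrec.snd)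
    (hs₀.comp (Primrec.fst.comp Primrec.fst)))).and (PrimrecPred.forall_mem_of hD ?_)
  refine PrimrecPred.forall_mem_of (β := CounterTrans S)
    (hout.comp (Primrec.fst.comp Primrec.fst) (Primrec.fst.comp Primrec.snd)) ?_
  have ht : Primrec fun p : ((α × (ℕ × List (Node S))) × Node S) × CounterTrans S => p.2 :=
    Primrec.snd
  have hv : Primrec fun p : ((α × (ℕ × List (Node S))) × Node S) × CounterTrans S => p.1.2.2.1 :=
    Primrec.fst.comp (Primrec.snd.comp (Primrec.snd.comp Primrec.fst))
  have hr : Primrec fun p : ((α × (ℕ × List (Node S))) × Node S) × CounterTrans S => p.1.2.2.2 :=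
    Primrec.snd.comp (Primrec.snd.comp (Primrec.snd.comp Primrec.fst))
  have hL : Primrec fun p : ((α × (ℕ × List (Node S))) × Node S) × CounterTrans S => p.1.1.2.1 :=
    Primrec.fst.comp (Primrec.snd.comp (Primrec.fst.comp Primrec.fst))
  have hd' : Primrec fun p : ((α × (ℕ × List (Node S))) × Node S) × CounterTrans S => d p.1.1.1 :=
    hd.comp (Primrec.fst.comp (Primrec.fst.comp Primrec.fst))
  have hD' := hD.comp (Primrec.fst.comp
    (Primrec.fst (α := (α × (ℕ × List (Node S))) × Node S) (β := CounterTrans S)))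
  have hst : PrimrecPred fun p : (((α × (ℕ × List (Node S))) × Node S) × CounterTrans S) × Node S =>
      p.2.1 = p.1.2.1 :=
    Primrec.eq.comp (Primrec.fst.comp Primrec.snd) (Primrec.fst.comp (ht.comp Primrec.fst))
  have hcov : PrimrecPred fun p : (((α × (ℕ × List (Node S))) × Node S) × CounterTrans S) × Node S =>
      Covers (d p.1.1.1.1) p.1.1.2.2.1 p.1.2 p.2.2.1 :=
    primrecPred_covers (hd'.comp Primrec.fst) (hv.comp Primrec.fst) (ht.comp Primrec.fst)
      (Primrec.fst.comp (Primrec.snd.comp Primrec.snd))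
  refine (primrecPred_enables hd' hv ht).imp (.and ?_ (.imp ?_ ?_))
  · exact PrimrecPred.exists_mem_of hD' (hst.and hcov)
  · exact Primrec.nat_lt.comp (primrec_kind ht) (Primrec.const 2)
  · refine PrimrecPred.forall_mem_of hD' (hst.imp (hcov.imp ?_))
    exact primrecPred_lexAt (hd'.comp Primrec.fst) (hL.comp Primrec.fst) (ht.comp Primrec.fst)
      (hr.comp Primrec.fst) (Primrec.snd.comp (Primrec.snd.comp Primrec.snd))

end Primrec

variable {S : Type*} {d : ℕ} {out : S → List (CounterTrans S)}

/-- The configuration described by a state and a list of counter values. -/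
def config (d : ℕ) (x : S × List ℕ) : S × (Fin d → ℕ) := (x.1, fun i => bound x.2 i)

theorem exists_config (x : S × (Fin d → ℕ)) : ∃ y, config d y = x :=
  ⟨(x.1, List.ofFn x.2), Prod.ext rfl (funext fun i => bound_ofFn x.2 i)⟩

/-- Steps between described configurations. -/
def StepCode (out : S → List (CounterTrans S)) (d : ℕ) (p : ℕ → Prop) (x y : S × List ℕ) : Prop :=
  ∃ t ∈ out x.1, p (kind t) ∧ t.1 = y.1 ∧ ∀ i < d, pre t i ≤ bound x.2 i ∧
    bound y.2 i = if kind t = i + 2 then 0 else bound x.2 i - pre t i + post t i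

theorem stepCode_iff {p : ℕ → Prop} {x y : S × List ℕ} :
    StepCode out d p x y ↔ Step out p (config d x) (config d y) := by
  simp only [StepCode, Step, StepBy, Fires, config, Fin.forall_iff]
  exact ⟨fun ⟨t, h1, h2, h3, h4⟩ => ⟨t, h2, h1, h3, h4⟩,
    fun ⟨t, h2, h1, h3, h4⟩ => ⟨t, h1, h2, h3, h4⟩⟩

/-- The length `n` is independent of the length of `l`. Positions past the end read as `default`,
which does no harm because every step is checked, also between such positions. -/
theorem reflTransGen_iff_exists_list [Inhabited S] {p : ℕ → Prop} {x y : S × (Fin d → ℕ)} :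
    ReflTransGen (Step out p) x y ↔ ∃ (l : List (S × List ℕ)) (n : ℕ),
      config d (l.getD 0 default) = x ∧ config d (l.getD n default) = y ∧
      ∀ k < n, StepCode out d p (l.getD k default) (l.getD (k + 1) default) := by
  constructor
  · intro h
    induction h using ReflTransGen.head_induction_on with
    | refl =>
      obtain ⟨y', rfl⟩ := exists_config y
      exact ⟨[y'], 0, rfl, rfl, by simp⟩
    | @head a c hs _ ih =>
      obtain ⟨l, n, rfl, h2, h3⟩ := ih
      obtain ⟨a', rfl⟩ := exists_config a
      refine ⟨a' :: l, n + 1, rfl, h2, fun k hk => ?_⟩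
      cases k with
      | zero => exact stepCode_iff.2 hs
      | succ k => exact h3 k (by omega)
  · rintro ⟨l, n, rfl, rfl, h⟩
    induction n with
    | zero => exact .refl
    | succ n ih => exact (ih fun k hk => h k (by omega)).tail (stepCode_iff.1 (h n (by omega)))

/-- A witness for `HasLasso`: the two paths, and their lengths. -/
abbrev LassoCode (S : Type*) : Type _ :=
  (List (S × List ℕ) × ℕ) × List (S × List ℕ) × ℕ

/-- The paths described by `w` show that there is a lasso. -/
def IsLasso [Inhabited S] (out : S → List (CounterTrans S)) (d : ℕ) (s₀ : S) (w : LassoCode S) :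
    Prop :=
  ((w.1.1.getD 0 default).1 = s₀ ∧ ∀ i < d, bound (w.1.1.getD 0 default).2 i = 0) ∧
  (∀ k < w.1.2, StepCode out d (fun _ => True) (w.1.1.getD k default) (w.1.1.getD (k + 1) default)) ∧
  StepCode out d (fun k => k = 1) (w.1.1.getD w.1.2 default) (w.2.1.getD 0 default) ∧
  (∀ k < w.2.2, StepCode out d (fun k => k < 2) (w.2.1.getD k default) (w.2.1.getD (k + 1) default)) ∧
  (w.2.1.getD w.2.2 default).1 = (w.1.1.getD w.1.2 default).1 ∧
  ∀ i < d, bound (w.1.1.getD w.1.2 default).2 i ≤ bound (w.2.1.getD w.2.2 default).2 i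

theorem hasLasso_iff [Inhabited S] {s₀ : S} :
    HasLasso out d s₀ ↔ ∃ w, IsLasso out d s₀ w := by
  constructor
  · rintro ⟨x, hx, y, z, hs, hr, hz, hle⟩
    obtain ⟨l, n, h1, rfl, h3⟩ := reflTransGen_iff_exists_list.1 hx
    obtain ⟨l', n', rfl, rfl, h6⟩ := reflTransGen_iff_exists_list.1 hr
    refine ⟨((l, n), l', n'), ⟨congrArg Prod.fst h1, fun i hi => ?_⟩, h3, stepCode_iff.2 hs, h6, hz,
      fun i hi => hle ⟨i, hi⟩⟩
    exact congrFun (congrArg Prod.snd h1) ⟨i, hi⟩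
  · rintro ⟨⟨⟨l, n⟩, l', n'⟩, ⟨h1, h2⟩, h3, h4, h5, h6, h7⟩
    refine ⟨config d (l.getD n default), reflTransGen_iff_exists_list.2 ⟨l, n, ?_, rfl, h3⟩,
      config d (l'.getD 0 default), config d (l'.getD n' default), stepCode_iff.1 h4,
      reflTransGen_iff_exists_list.2 ⟨l', n', rfl, rfl, h5⟩, h6, fun i => h7 i i.2⟩
    exact Prod.ext h1 (funext fun i => h2 i i.2)

section Primrec

variable {α S : Type*} [Primcodable α] [Primcodable S]

theorem primrecPred_stepCode {β : Type*} [Primcodable β] {out : α → S → List (CounterTrans S)}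
    (hout : Primrec₂ out) {d : α → ℕ} (hd : Primrec d) {p : ℕ → Prop} (hp : PrimrecPred p)
    {a : β → α} {x y : β → S × List ℕ} (ha : Primrec a) (hx : Primrec x) (hy : Primrec y) :
    PrimrecPred fun b => StepCode (out (a b)) (d (a b)) p (x b) (y b) := by
  refine PrimrecPred.exists_mem_of (hout.comp ha (Primrec.fst.comp hx)) ?_
  have ht : Primrec fun q : β × CounterTrans S => q.2 := Primrec.snd
  refine (hp.comp (primrec_kind ht)).and (.and ?_ (PrimrecPred.forall_lt_of
    (hd.comp (ha.comp Primrec.fst)) ?_))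
  · exact Primrec.eq.comp (Primrec.fst.comp ht) (Primrec.fst.comp (hy.comp Primrec.fst))
  · have ht' := ht.comp (Primrec.fst (β := ℕ))
    have hbx : Primrec fun q : (β × CounterTrans S) × ℕ => bound (x q.1.1).2 q.2 :=
      primrec_bound (Primrec.snd.comp (hx.comp (Primrec.fst.comp Primrec.fst))) Primrec.snd
    have hby : Primrec fun q : (β × CounterTrans S) × ℕ => bound (y q.1.1).2 q.2 :=
      primrec_bound (Primrec.snd.comp (hy.comp (Primrec.fst.comp Primrec.fst))) Primrec.snd
    have hpre := primrec_pre ht' Primrec.snd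
    refine (Primrec.nat_le.comp hpre hbx).and (Primrec.eq.comp hby (Primrec.ite ?_
      (Primrec.const 0) (Primrec.nat_add.comp (Primrec.nat_sub.comp hbx hpre)
        (primrec_post ht' Primrec.snd))))
    exact Primrec.eq.comp (primrec_kind ht') (Primrec.nat_add.comp Primrec.snd (Primrec.const 2))

theorem primrecPred_isLasso [Inhabited S] {out : α → S → List (CounterTrans S)}
    (hout : Primrec₂ out) {d : α → ℕ} (hd : Primrec d) {s₀ : α → S} (hs₀ : Primrec s₀) :
    PrimrecPred fun p : α × LassoCode S => IsLasso (out p.1) (d p.1) (s₀ p.1) p.2 := by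
  have ha : Primrec fun p : α × LassoCode S => p.1 := Primrec.fst
  have hl : Primrec fun p : α × LassoCode S => p.2.1.1 :=
    Primrec.fst.comp (Primrec.fst.comp Primrec.snd)
  have hn : Primrec fun p : α × LassoCode S => p.2.1.2 :=
    Primrec.snd.comp (Primrec.fst.comp Primrec.snd)
  have hl' : Primrec fun p : α × LassoCode S => p.2.2.1 :=
    Primrec.fst.comp (Primrec.snd.comp Primrec.snd)
  have hn' : Primrec fun p : α × LassoCode S => p.2.2.2 :=
    Primrec.snd.comp (Primrec.snd.comp Primrec.snd)
  have hget := Primrec.list_getD (default : S × List ℕ)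
  have h0 := hget.comp hl (Primrec.const 0)
  have hk : Primrec fun q : (α × LassoCode S) × ℕ => q.2 + 1 :=
    Primrec.nat_add.comp Primrec.snd (Primrec.const 1)
  refine .and (.and ?_ ?_) (.and ?_ (.and ?_ (.and ?_ (.and ?_ ?_))))
  · exact Primrec.eq.comp (Primrec.fst.comp h0) (hs₀.comp ha)
  · exact PrimrecPred.forall_lt_of (hd.comp ha) (Primrec.eq.comp
      (primrec_bound ((Primrec.snd.comp h0).comp Primrec.fst) Primrec.snd) (Primrec.const 0))
  · exact PrimrecPred.forall_lt_of hn (primrecPred_stepCode hout hd (Primrec.const true).primrecPred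
      (ha.comp Primrec.fst) (hget.comp (hl.comp Primrec.fst) Primrec.snd)
      (hget.comp (hl.comp Primrec.fst) hk))
  · exact primrecPred_stepCode hout hd (Primrec.eq.comp Primrec.id (Primrec.const 1)) ha
      (hget.comp hl hn) (hget.comp hl' (Primrec.const 0))
  · exact PrimrecPred.forall_lt_of hn' (primrecPred_stepCode hout hd
      (Primrec.nat_lt.comp Primrec.id (Primrec.const 2))
      (ha.comp Primrec.fst) (hget.comp (hl'.comp Primrec.fst) Primrec.snd)
      (hget.comp (hl'.comp Primrec.fst) hk))
  · exact Primrec.eq.comp (Primrec.fst.comp (hget.comp hl' hn')) (Primrec.fst.comp (hget.comp hl hn))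
  · exact PrimrecPred.forall_lt_of (hd.comp ha) (Primrec.nat_le.comp
      (primrec_bound ((Primrec.snd.comp (hget.comp hl hn)).comp Primrec.fst) Primrec.snd)
      (primrec_bound ((Primrec.snd.comp (hget.comp hl' hn')).comp Primrec.fst) Primrec.snd))

/-- The existence of a lasso is decidable, uniformly for counter systems with finitely many
reachable states. -/
theorem exists_computable_hasLasso [Inhabited S] {out : α → S → List (CounterTrans S)}
    (hout : Primrec₂ out) {d : α → ℕ} (hd : Primrec d) {s₀ : α → S} (hs₀ : Primrec s₀)
    (hfin : ∀ a, ∃ St : Finset S, s₀ a ∈ St ∧ ∀ s ∈ St, ∀ t ∈ out a s, t.1 ∈ St) :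
    ∃ f : α → Bool, Computable f ∧ ∀ a, f a = true ↔ ¬ HasLasso (out a) (d a) (s₀ a) := by
  obtain ⟨f, hf, hspec⟩ := exists_computable_of_witnesses
    (P := fun a w => IsLasso (out a) (d a) (s₀ a) w)
    (Q := fun a (c : ℕ × List (Node S)) => IsInvariant (out a) (d a) (s₀ a) c.1 c.2)
    (primrecPred_isLasso hout hd hs₀) (primrecPred_isInvariant hout hd hs₀) (fun a => by
      by_cases h : HasLasso (out a) (d a) (s₀ a)
      · exact Or.inl (hasLasso_iff.1 h)
      · obtain ⟨St, h1, h2⟩ := hfin a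
        obtain ⟨L, D, hD⟩ := exists_isInvariant h2 h1 h
        exact Or.inr ⟨(L, D), hD⟩)
  refine ⟨f, hf, fun a => ⟨fun h => ?_, fun h => ?_⟩⟩
  · obtain ⟨⟨L, D⟩, hD⟩ := (hspec a).1 h
    exact hD.not_hasLasso
  · by_contra hfa
    exact h (hasLasso_iff.2 ((hspec a).2 (by simpa using hfa)))

end Primrec

end CounterSystem

/-! ### Infinite words and interleaved runs. -/

theorem concatLabels_succ {A : Type*} (ℓ : ℕ → List A) (n : ℕ) :
    concatLabels ℓ (n + 1) = concatLabels ℓ n ++ ℓ n := by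
  simp [concatLabels, List.range_succ]

theorem concatLabels_length_mono {A : Type*} (ℓ : ℕ → List A) :
    Monotone fun n => (concatLabels ℓ n).length :=
  monotone_nat_of_le_succ fun n => by simp [concatLabels_succ]

namespace BuchiResetVASS

variable {Q A : Type*} {d : ℕ}

/-- An infinite sequence of configurations in which the transitions of a run are interleaved with
idle steps and with steps reading the letters of the pending labels of these transitions. -/
structure IsInterleavedRun (V : BuchiResetVASS Q A d) (w : ℕ → A) (q : ℕ → Q)
    (m : ℕ → Fin d → ℕ) (x : ℕ → List A) (p : ℕ → ℕ) : Prop where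
  init : q 0 = V.init ∧ (m 0 = fun _ => 0) ∧ x 0 = [] ∧ p 0 = 0
  step : ∀ n, (∃ t ∈ V.transitions, t.source = q n ∧ t.target = q (n + 1) ∧
      t.op.Fires (m n) (m (n + 1)) ∧ x n = [] ∧ x (n + 1) = t.label ∧ p (n + 1) = p n) ∨
    (q (n + 1) = q n ∧ m (n + 1) = m n ∧
      ((x (n + 1) = x n ∧ p (n + 1) = p n) ∨ (x n = w (p n) :: x (n + 1) ∧ p (n + 1) = p n + 1)))

/-- Deleting the steps outside `P` leaves a run, since state and counters do not change there. At
every time the labels fired so far are the letters read followed by the pending word (`hconcat`). -/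
theorem IsInterleavedRun.mem_language {V : BuchiResetVASS Q A d} {w : ℕ → A} {q : ℕ → Q}
    {m : ℕ → Fin d → ℕ} {x : ℕ → List A} {p : ℕ → ℕ} (h : V.IsInterleavedRun w q m x p)
    (hp : ∀ N, ∃ n, N ≤ p n) (hF : ∀ N, ∃ n, N ≤ n ∧ q n ∈ V.final) : w ∈ V.language := by
  classical
  let P : ℕ → Prop := fun n => ∃ t ∈ V.transitions, t.source = q n ∧ t.target = q (n + 1) ∧
      t.op.Fires (m n) (m (n + 1)) ∧ x n = [] ∧ x (n + 1) = t.label ∧ p (n + 1) = p n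
  have hidle : ∀ n, ¬ P n → q (n + 1) = q n ∧ m (n + 1) = m n ∧
      ((x (n + 1) = x n ∧ p (n + 1) = p n) ∨ (x n = w (p n) :: x (n + 1) ∧ p (n + 1) = p n + 1)) :=
    fun n hn => (h.step n).resolve_left hn
  have : ∃ t : ℕ → ResetTransition Q A d, ∀ n, P n → t n ∈ V.transitions ∧ (t n).source = q n ∧
      (t n).target = q (n + 1) ∧ (t n).op.Fires (m n) (m (n + 1)) ∧ x n = [] ∧
      x (n + 1) = (t n).label ∧ p (n + 1) = p n := by
    have hne : Nonempty (ResetTransition Q A d) := ⟨⟨q 0, Sum.inl 0, [], q 0⟩⟩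
    have : ∀ n, ∃ t : ResetTransition Q A d, P n → t ∈ V.transitions ∧ t.source = q n ∧
      t.target = q (n + 1) ∧ t.op.Fires (m n) (m (n + 1)) ∧ x n = [] ∧
      x (n + 1) = t.label ∧ p (n + 1) = p n := by
      intro n
      by_cases hn : P n
      · exact ⟨hn.choose, fun _ => hn.choose_spec⟩
      · exact ⟨hne.some, fun h' => absurd h' hn⟩
    choose t ht using this
    exact ⟨t, ht⟩
  obtain ⟨t, ht⟩ := this
  let ℓ : ℕ → List A := fun k => (t (Nat.nth P k)).label
  have hconcat : ∀ n, concatLabels ℓ (Nat.count P n) = (List.range (p n)).map w ++ x n := by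
    intro n
    induction n with
    | zero => simp [h.init.2.2.1, h.init.2.2.2, concatLabels]
    | succ n ih =>
      by_cases hn : P n
      · obtain ⟨-, -, -, -, h1, h2, h3⟩ := ht n hn
        rw [Nat.count_succ, if_pos hn, concatLabels_succ, ih, h1, h2, h3]
        simp [ℓ, Nat.nth_count hn]
      · rw [Nat.count_succ, if_neg hn, add_zero, ih]
        rcases (hidle n hn).2.2 with ⟨h1, h2⟩ | ⟨h1, h2⟩
        · rw [h1, h2]
        · rw [h1, h2, List.range_succ]
          simp
  have hle : ∀ n, p n ≤ (concatLabels ℓ (Nat.count P n)).length := by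
    intro n
    rw [hconcat]
    simp
  -- The letters read form a prefix of the labels fired, so finitely many transitions could not
  -- supply the whole word.
  have hinf : (Set.ofPred P).Infinite := by
    intro hfin
    obtain ⟨N, hN⟩ := hfin.bddAbove
    have hbd : ∀ n, Nat.count P n ≤ N + 1 := by
      intro n
      rw [Nat.count_eq_card_filter_range]
      calc _ ≤ (Finset.range (N + 1)).card := Finset.card_le_card fun k hk => by
            have := hN (Finset.mem_filter.1 hk).2
            simpa [Nat.lt_succ_iff] using this
        _ = N + 1 := by simp
    obtain ⟨n, hn⟩ := hp ((concatLabels ℓ (N + 1)).length + 1)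
    have h1 := hle n
    have h2 := concatLabels_length_mono ℓ (hbd n)
    dsimp only at h2
    omega
  have hmono := Nat.nth_strictMono hinf
  have hnth : ∀ k, P (Nat.nth P k) := fun k => Nat.nth_mem_of_infinite hinf k
  have hstay : ∀ n j, (∀ k, n ≤ k → k < n + j → ¬ P k) → q (n + j) = q n ∧ m (n + j) = m n := by
    intro n j
    induction j with
    | zero => simp
    | succ j ih =>
      intro hk
      obtain ⟨h1, h2⟩ := ih fun k hk1 hk2 => hk k hk1 (by omega)
      obtain ⟨h3, h4, -⟩ := hidle (n + j) (hk _ (by omega) (by omega))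
      exact ⟨h3.trans h1, h4.trans h2⟩
  have hnext : ∀ n, n ≤ Nat.nth P (Nat.count P n) := fun n => Nat.le_nth_count hinf n
  have hcount : ∀ n, q (Nat.nth P (Nat.count P n)) = q n ∧ m (Nat.nth P (Nat.count P n)) = m n := by
    intro n
    have h1 := hstay n (Nat.nth P (Nat.count P n) - n) fun k hk1 hk2 hPk => by
      rw [Nat.add_sub_cancel' (hnext n)] at hk2
      have h2 := hmono.monotone (Nat.count_monotone P hk1)
      rw [Nat.nth_count hPk] at h2
      omega
    rwa [Nat.add_sub_cancel' (hnext n)] at h1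
  refine ⟨fun k => (q (Nat.nth P k), m (Nat.nth P k)), fun k => t (Nat.nth P k), ⟨?_, ?_⟩, ?_, ?_, ?_⟩
  · have := hcount 0
    rw [Nat.count_zero] at this
    exact Prod.ext (this.1.trans h.init.1) (this.2.trans h.init.2.1)
  · intro k
    obtain ⟨h1, h2, h3, h4, -⟩ := ht _ (hnth k)
    have h5 := hcount (Nat.nth P k + 1)
    rw [Nat.count_succ, if_pos (hnth k), Nat.count_nth_of_infinite hinf] at h5
    refine ⟨h1, h2, h3.trans h5.1.symm, ?_⟩
    dsimp only
    rw [h5.2]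
    exact h4
  · intro N
    obtain ⟨n, hn, hq⟩ := hF (Nat.nth P N)
    refine ⟨Nat.count P n, ?_, ?_⟩
    · have := Nat.count_monotone P hn
      rwa [Nat.count_nth_of_infinite hinf] at this
    · dsimp only
      rwa [(hcount n).1]
  · intro k
    have h1 := hconcat (Nat.nth P k)
    obtain ⟨-, -, -, -, h2, -⟩ := ht _ (hnth k)
    rw [Nat.count_nth_of_infinite hinf, h2, List.append_nil] at h1
    change concatLabels ℓ k = (List.range (concatLabels ℓ k).length).map w
    rw [h1]
    simp
  · intro N
    obtain ⟨n, hn⟩ := hp N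
    exact ⟨Nat.count P n, hn.trans (hle n)⟩

/-- After a final state a run of a weak automaton does not use resets. -/
theorem IsWeak.exists_forall_not_isReset {V : BuchiResetVASS Q A d} (hV : V.IsWeak)
    {c : ℕ → Q × (Fin d → ℕ)} {t : ℕ → ResetTransition Q A d} (h : V.IsRun c t)
    (hF : ∀ N, ∃ n, N ≤ n ∧ (c n).1 ∈ V.final) : ∃ N, ∀ n, N ≤ n → ¬ (t n).IsReset := by
  obtain ⟨N, -, hN⟩ := hF 0
  refine ⟨N, fun n hn hr => ?_⟩
  have hpath : ∀ j, Relation.ReflTransGen V.Edge (c N).1 (c (N + j)).1 := by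
    intro j
    induction j with
    | zero => exact .refl
    | succ j ih => exact ih.tail ⟨_, (h.2 _).1, (h.2 _).2.1, (h.2 _).2.2.1⟩
  refine hV _ hN _ (h.2 n).1 hr ?_
  have := hpath (n - N)
  rw [Nat.add_sub_cancel' hn] at this
  rwa [(h.2 n).2.1]

end BuchiResetVASS

/-! ### Fair interleaving of two accepting runs. -/

section Scheduler

/-- One step of the scheduler interleaving two runs: the components are the phase, the number of
transitions used from either run, and the number of letters read. -/
def SchedulerStep (len₁ len₂ : ℕ → ℕ) (F₁ F₂ : ℕ → Prop) (N : ℕ) (s s' : ℕ × ℕ × ℕ × ℕ) : Prop :=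
  (s.1 = 0 ∧ N ≤ s.2.1 ∧ N ≤ s.2.2.1 ∧ s' = (1, s.2)) ∨
  (s.1 = 1 ∧ F₁ s.2.1 ∧ s' = (2, s.2)) ∨
  (s.1 = 2 ∧ F₂ s.2.2.1 ∧ s' = (3, s.2)) ∨
  ((¬ (s.1 = 0 ∧ N ≤ s.2.1 ∧ N ≤ s.2.2.1) ∧ ¬ (s.1 = 1 ∧ F₁ s.2.1) ∧ ¬ (s.1 = 2 ∧ F₂ s.2.2.1)) ∧
    ((len₁ s.2.1 ≤ s.2.2.2 ∧ s' = (s.1, s.2.1 + 1, s.2.2)) ∨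
    (s.2.2.2 < len₁ s.2.1 ∧ len₂ s.2.2.1 ≤ s.2.2.2 ∧ s' = (s.1, s.2.1, s.2.2.1 + 1, s.2.2.2)) ∨
    (s.2.2.2 < len₁ s.2.1 ∧ s.2.2.2 < len₂ s.2.2.1 ∧
      s' = (if s.1 = 3 then 1 else s.1, s.2.1, s.2.2.1, s.2.2.2 + 1))))

theorem exists_schedulerStep (len₁ len₂ : ℕ → ℕ) (F₁ F₂ : ℕ → Prop) (N : ℕ) (s : ℕ × ℕ × ℕ × ℕ) :
    ∃ s', SchedulerStep len₁ len₂ F₁ F₂ N s s' := by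
  by_cases h0 : s.1 = 0 ∧ N ≤ s.2.1 ∧ N ≤ s.2.2.1
  · exact ⟨_, Or.inl ⟨h0.1, h0.2.1, h0.2.2, rfl⟩⟩
  by_cases h1 : s.1 = 1 ∧ F₁ s.2.1
  · exact ⟨_, Or.inr (Or.inl ⟨h1.1, h1.2, rfl⟩)⟩
  by_cases h2 : s.1 = 2 ∧ F₂ s.2.2.1
  · exact ⟨_, Or.inr (Or.inr (Or.inl ⟨h2.1, h2.2, rfl⟩))⟩
  rcases le_or_gt (len₁ s.2.1) s.2.2.2 with h3 | h3
  · exact ⟨_, Or.inr (Or.inr (Or.inr ⟨⟨h0, h1, h2⟩, Or.inl ⟨h3, rfl⟩⟩))⟩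
  rcases le_or_gt (len₂ s.2.2.1) s.2.2.2 with h4 | h4
  · exact ⟨_, Or.inr (Or.inr (Or.inr ⟨⟨h0, h1, h2⟩, Or.inr (Or.inl ⟨h3, h4, rfl⟩)⟩))⟩
  · exact ⟨_, Or.inr (Or.inr (Or.inr ⟨⟨h0, h1, h2⟩, Or.inr (Or.inr ⟨h3, h4, rfl⟩)⟩))⟩

/-- A discrete intermediate value theorem: unit steps cannot jump over `v`. -/
theorem exists_ge_eq_of_le_succ {a : ℕ → ℕ} (h1 : ∀ n, a (n + 1) ≤ a n + 1)
    (h2 : ∀ B, ∃ n, B ≤ a n) (hm : Monotone a) {M v : ℕ} (hv : a M ≤ v) : ∃ n, M ≤ n ∧ a n = v := by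
  by_contra! hne
  have hlt : ∀ j, a (M + j) ≤ v := by
    intro j
    induction j with
    | zero => exact hv
    | succ j ih =>
      have h3 := hne (M + j) (by omega)
      have h4 := h1 (M + j)
      have h5 : a (M + (j + 1)) = a (M + j + 1) := rfl
      omega
  obtain ⟨n, hn⟩ := h2 (v + 1)
  have h3 := hlt n
  have h4 : a n ≤ a (M + n) := hm (by omega)
  omega

/-- The scheduler reads the whole word and passes through all phases infinitely often. -/
theorem scheduler_fair {len₁ len₂ : ℕ → ℕ} {F₁ F₂ : ℕ → Prop} {N : ℕ}
    (hm₁ : Monotone len₁) (hm₂ : Monotone len₂)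
    (hu₁ : ∀ B, ∃ n, B ≤ len₁ n) (hu₂ : ∀ B, ∃ n, B ≤ len₂ n)
    (hF₁ : ∀ B, ∃ n, B ≤ n ∧ F₁ n) (hF₂ : ∀ B, ∃ n, B ≤ n ∧ F₂ n)
    {s : ℕ → ℕ × ℕ × ℕ × ℕ} (h0 : s 0 = (0, 0, 0, 0))
    (hs : ∀ n, SchedulerStep len₁ len₂ F₁ F₂ N (s n) (s (n + 1))) :
    (∀ B, ∃ n, B ≤ (s n).2.2.2) ∧
      ∀ M, ∃ n, M ≤ n ∧ (s n).1 = 3 ∧ (s (n + 1)).1 = 1 := by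
  set φ : ℕ → ℕ := fun n => (s n).1 with hφ
  set a : ℕ → ℕ := fun n => (s n).2.1 with ha
  set b : ℕ → ℕ := fun n => (s n).2.2.1 with hb
  set p : ℕ → ℕ := fun n => (s n).2.2.2 with hpdef
  have step : ∀ n,
      (φ n = 0 ∧ N ≤ a n ∧ N ≤ b n ∧ φ (n + 1) = 1 ∧ a (n + 1) = a n ∧ b (n + 1) = b n ∧ p (n + 1) = p n) ∨
      (φ n = 1 ∧ F₁ (a n) ∧ φ (n + 1) = 2 ∧ a (n + 1) = a n ∧ b (n + 1) = b n ∧ p (n + 1) = p n) ∨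
      (φ n = 2 ∧ F₂ (b n) ∧ φ (n + 1) = 3 ∧ a (n + 1) = a n ∧ b (n + 1) = b n ∧ p (n + 1) = p n) ∨
      ((¬ (φ n = 0 ∧ N ≤ a n ∧ N ≤ b n) ∧ ¬ (φ n = 1 ∧ F₁ (a n)) ∧ ¬ (φ n = 2 ∧ F₂ (b n))) ∧
      ((len₁ (a n) ≤ p n ∧ φ (n + 1) = φ n ∧ a (n + 1) = a n + 1 ∧ b (n + 1) = b n ∧ p (n + 1) = p n) ∨
      (p n < len₁ (a n) ∧ len₂ (b n) ≤ p n ∧ φ (n + 1) = φ n ∧ a (n + 1) = a n ∧ b (n + 1) = b n + 1 ∧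
        p (n + 1) = p n) ∨
      (p n < len₁ (a n) ∧ p n < len₂ (b n) ∧ φ (n + 1) = (if φ n = 3 then 1 else φ n) ∧
        a (n + 1) = a n ∧ b (n + 1) = b n ∧ p (n + 1) = p n + 1))) := by
    intro n
    simp only [hφ, ha, hb, hpdef]
    rcases hs n with ⟨h1, h2, h3, h4⟩ | ⟨h1, h2, h4⟩ | ⟨h1, h2, h4⟩ |
      ⟨h1, ⟨h2, h4⟩ | ⟨h2, h3, h4⟩ | ⟨h2, h3, h4⟩⟩
    · exact Or.inl ⟨h1, h2, h3, by simp [h4]⟩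
    · exact Or.inr (Or.inl ⟨h1, h2, by simp [h4]⟩)
    · exact Or.inr (Or.inr (Or.inl ⟨h1, h2, by simp [h4]⟩))
    · exact Or.inr (Or.inr (Or.inr ⟨h1, Or.inl ⟨h2, by simp [h4]⟩⟩))
    · exact Or.inr (Or.inr (Or.inr ⟨h1, Or.inr (Or.inl ⟨h2, h3, by simp [h4]⟩)⟩))
    · exact Or.inr (Or.inr (Or.inr ⟨h1, Or.inr (Or.inr ⟨h2, h3, by simp [h4]⟩)⟩))
  have z1 : φ 0 = 0 := by simp [hφ, h0]
  have z2 : a 0 = 0 := by simp [ha, h0]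
  have z3 : b 0 = 0 := by simp [hb, h0]
  have z4 : p 0 = 0 := by simp [hpdef, h0]
  change (∀ B, ∃ n, B ≤ p n) ∧ ∀ M, ∃ n, M ≤ n ∧ φ n = 3 ∧ φ (n + 1) = 1
  clear_value φ a b p
  have hφ3 : ∀ n, φ n ≤ 3 := by
    intro n
    induction n with
    | zero => omega
    | succ n ih => have := step n; split_ifs at this <;> omega
  have ham : Monotone a := monotone_nat_of_le_succ fun n => by have := step n; omega
  have hbm : Monotone b := monotone_nat_of_le_succ fun n => by have := step n; omega
  have ha1 : ∀ n, a (n + 1) ≤ a n + 1 := fun n => by have := step n; omega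
  have hb1 : ∀ n, b (n + 1) ≤ b n + 1 := fun n => by have := step n; omega
  have hple : ∀ n, p n ≤ len₁ (a n) ∧ p n ≤ len₂ (b n) := by
    intro n
    induction n with
    | zero => omega
    | succ n ih =>
      have h1 : len₁ (a n) ≤ len₁ (a (n + 1)) := hm₁ (ham n.le_succ)
      have h2 : len₂ (b n) ≤ len₂ (b (n + 1)) := hm₂ (hbm n.le_succ)
      have := step n
      omega
  -- Every step raises the right-hand side by at least one. The factor 4 outweighs the loss of 2
  -- when a letter is read in phase 3.
  have hsum : ∀ n, n ≤ 4 * (a n + b n + p n) + φ n := by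
    intro n
    induction n with
    | zero => omega
    | succ n ih =>
      have h1 := hφ3 n
      have := step n
      split_ifs at this <;> omega
  have hpu : ∀ B, ∃ n, B ≤ p n := by
    intro B
    by_contra! hlt
    obtain ⟨B₁, hB₁⟩ := hu₁ B
    obtain ⟨B₂, hB₂⟩ := hu₂ B
    -- A run advances only while its labels do not exceed the letters read, so a bound on `p` also
    -- bounds `a` and `b`, against `hsum`.
    have hab : ∀ n, a n ≤ B₁ ∧ b n ≤ B₂ := by
      intro n
      induction n with
      | zero => omega
      | succ n ih =>
        have h1 : B₁ ≤ a n → len₁ B₁ ≤ len₁ (a n) := fun h => hm₁ h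
        have h2 : B₂ ≤ b n → len₂ B₂ ≤ len₂ (b n) := fun h => hm₂ h
        have h3 := hlt n
        have := step n
        omega
    have h1 := hsum (4 * (B₁ + B₂ + B) + 4)
    have h2 := hab (4 * (B₁ + B₂ + B) + 4)
    have h3 := hlt (4 * (B₁ + B₂ + B) + 4)
    have h4 := hφ3 (4 * (B₁ + B₂ + B) + 4)
    omega
  have hau : ∀ B, ∃ n, B ≤ a n := by
    intro B
    obtain ⟨n, hn⟩ := hpu (len₁ B + 1)
    refine ⟨n, ?_⟩
    by_contra! h
    have h1 : len₁ (a n) ≤ len₁ B := hm₁ h.le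
    have := hple n
    omega
  have hbu : ∀ B, ∃ n, B ≤ b n := by
    intro B
    obtain ⟨n, hn⟩ := hpu (len₂ B + 1)
    refine ⟨n, ?_⟩
    by_contra! h
    have h1 : len₂ (b n) ≤ len₂ B := hm₂ h.le
    have := hple n
    omega
  refine ⟨hpu, fun M => ?_⟩
  by_contra! hno
  -- Without a passage from 3 to 1 after `M` the phase never decreases. It cannot stay at 0, 1 or 2,
  -- as the condition for leaving each of them is met at some time; staying at 3 means that no
  -- letter is read any more, against `hpu`.
  have hφm : ∀ n, M ≤ n → φ n ≤ φ (n + 1) := by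
    intro n hn
    have h1 := hno n hn
    have := step n
    split_ifs at this <;> omega
  have hφj : ∀ n j, M ≤ n → φ n ≤ φ (n + j) := by
    intro n j hn
    induction j with
    | zero => exact le_rfl
    | succ j ih => exact ih.trans (hφm (n + j) (by omega))
  have e1 : ∃ n, M ≤ n ∧ 1 ≤ φ n := by
    by_contra! hlt
    obtain ⟨n₁, hn₁⟩ := hau N
    obtain ⟨n₂, hn₂⟩ := hbu N
    have h1 : a n₁ ≤ a (M + n₁ + n₂) := ham (by omega)
    have h2 : b n₂ ≤ b (M + n₁ + n₂) := hbm (by omega)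
    have h3 := hlt (M + n₁ + n₂) (by omega)
    have h4 := hlt (M + n₁ + n₂ + 1) (by omega)
    have := step (M + n₁ + n₂)
    omega
  obtain ⟨n₁, hn₁, hφ₁⟩ := e1
  have e2 : ∃ n, M ≤ n ∧ 2 ≤ φ n := by
    by_contra! hlt
    -- The index `a` attains every later value, so it meets a final position `v`, where the
    -- scheduler must change the phase.
    obtain ⟨v, hv, hFv⟩ := hF₁ (a n₁)
    obtain ⟨n, hn, rfl⟩ := exists_ge_eq_of_le_succ ha1 hau ham hv
    have h3 := hlt n (by omega)
    have h4 := hlt (n + 1) (by omega)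
    have h5 := hφj n₁ (n - n₁) hn₁
    rw [Nat.add_sub_cancel' hn] at h5
    have h6 : φ n = 1 := by omega
    have := step n
    simp [h6, hFv] at this
    omega
  obtain ⟨n₂, hn₂, hφ₂⟩ := e2
  have e3 : ∃ n, M ≤ n ∧ 3 ≤ φ n := by
    by_contra! hlt
    obtain ⟨v, hv, hFv⟩ := hF₂ (b n₂)
    obtain ⟨n, hn, rfl⟩ := exists_ge_eq_of_le_succ hb1 hbu hbm hv
    have h3 := hlt n (by omega)
    have h4 := hlt (n + 1) (by omega)
    have h5 := hφj n₂ (n - n₂) hn₂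
    rw [Nat.add_sub_cancel' hn] at h5
    have h6 : φ n = 2 := by omega
    have := step n
    simp [h6, hFv] at this
    omega
  obtain ⟨n₃, hn₃, hφ₃⟩ := e3
  have hpc : ∀ j, p (n₃ + j) ≤ p n₃ := by
    intro j
    induction j with
    | zero => exact le_rfl
    | succ j ih =>
      have h1 := hφj n₃ j hn₃
      have h2 := hφj n₃ (j + 1) hn₃
      have h3 := hφ3 (n₃ + j)
      have h4 : φ (n₃ + j) = 3 := by omega
      have h5 : φ (n₃ + (j + 1)) = φ (n₃ + j + 1) := rfl
      have h6 : p (n₃ + (j + 1)) = p (n₃ + j + 1) := rfl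
      have := step (n₃ + j)
      rw [if_pos h4] at this
      omega
  have hpm : Monotone p := monotone_nat_of_le_succ fun n => by have := step n; omega
  obtain ⟨n, hn⟩ := hpu (p n₃ + 1)
  have h1 := hpc n
  have h2 : p n ≤ p (n₃ + n) := hpm (by omega)
  omega

end Scheduler

/-! ### The product and its runs. -/

theorem exists_isInfiniteConcat {A : Type*} {ℓ : ℕ → List A}
    (h : ∀ N, ∃ n, N ≤ (concatLabels ℓ n).length) : ∃ w, IsInfiniteConcat ℓ w := by
  have hpre : ∀ n j, concatLabels ℓ n <+: concatLabels ℓ (n + j) := by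
    intro n j
    induction j with
    | zero => exact List.prefix_rfl
    | succ j ih => exact ih.trans ⟨ℓ (n + j), (concatLabels_succ ℓ (n + j)).symm⟩
  have hw : ∀ i, ∃ a, ∀ n, i < (concatLabels ℓ n).length → (concatLabels ℓ n)[i]? = some a := by
    intro i
    obtain ⟨n, hn⟩ := h (i + 1)
    refine ⟨(concatLabels ℓ n)[i]'hn, fun m hm => ?_⟩
    have h1 := List.IsPrefix.getElem (hpre n m) (i := i) hn
    have h2 := List.IsPrefix.getElem (hpre m n) (i := i) hm
    rw [List.getElem?_eq_getElem hm, h2, h1]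
    simp only [Nat.add_comm m n]
  choose w hw using hw
  refine ⟨w, fun n => ?_, h⟩
  refine List.ext_getElem? fun i => ?_
  by_cases hi : i < (concatLabels ℓ n).length
  · rw [hw i n hi]
    simp [hi]
  · simp [hi]

theorem IsInfiniteConcat.drop_eq_cons {A : Type*} {ℓ : ℕ → List A} {w : ℕ → A}
    (h : IsInfiniteConcat ℓ w) {n p : ℕ} (hp : p < (concatLabels ℓ n).length) :
    (concatLabels ℓ n).drop p = w p :: (concatLabels ℓ n).drop (p + 1) := by
  rw [List.drop_eq_getElem_cons hp]
  congr 1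
  have h1 := h.1 n
  have h2 : (concatLabels ℓ n)[p]? = ((List.range (concatLabels ℓ n).length).map w)[p]? := by
    rw [← h1]
  rw [List.getElem?_eq_getElem hp] at h2
  simpa [hp] using h2

namespace BuchiResetVASS

/-- An infinite run of the transition system given by the outgoing transitions of each state. -/
def IsOutRun {S A : Type*} {d : ℕ} (out : S → List (ResetTransition S A d)) (s₀ : S)
    (c : ℕ → S × (Fin d → ℕ)) (t : ℕ → ResetTransition S A d) : Prop :=
  c 0 = (s₀, fun _ => 0) ∧ ∀ n, t n ∈ out (c n).1 ∧ (t n).target = (c (n + 1)).1 ∧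
    (t n).op.Fires (c n).2 (c (n + 1)).2

/-- States of the product: a phase, and for both automata a state and a pending word. -/
abbrev ProdState (Q₁ Q₂ A : Type*) : Type _ := ℕ × Q₁ × List A × Q₂ × List A

/-- A counter operation acting on the first counters. -/
def leftOp {d₁ : ℕ} (d₂ : ℕ) : CounterOp d₁ → CounterOp (d₁ + d₂) :=
  Sum.map (fun δ => Fin.append δ fun _ => 0) (Fin.castAdd d₂)

/-- A counter operation acting on the last counters. -/
def rightOp (d₁ : ℕ) {d₂ : ℕ} : CounterOp d₂ → CounterOp (d₁ + d₂) :=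
  Sum.map (fun δ => Fin.append (fun _ => 0) δ) (Fin.natAdd d₁)

theorem fires_leftOp {d₁ d₂ : ℕ} {x : CounterOp d₁} {m m' : Fin (d₁ + d₂) → ℕ} :
    (leftOp d₂ x).Fires m m' ↔
      x.Fires (fun i => m (Fin.castAdd d₂ i)) (fun i => m' (Fin.castAdd d₂ i)) ∧
        (fun i => m' (Fin.natAdd d₁ i)) = fun i => m (Fin.natAdd d₁ i) := by
  rcases x with δ | i
  · simp [leftOp, CounterOp.Fires, Fin.forall_fin_add, funext_iff]
  · simp [leftOp, CounterOp.Fires, Fin.forall_fin_add, funext_iff, and_assoc, Fin.ext_iff]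
    intro _ _
    have : ∀ j : Fin d₂, ¬ d₁ + (j : ℕ) = i := fun j => by omega
    simp [this]

theorem fires_rightOp {d₁ d₂ : ℕ} {x : CounterOp d₂} {m m' : Fin (d₁ + d₂) → ℕ} :
    (rightOp d₁ x).Fires m m' ↔
      x.Fires (fun i => m (Fin.natAdd d₁ i)) (fun i => m' (Fin.natAdd d₁ i)) ∧
        (fun i => m' (Fin.castAdd d₂ i)) = fun i => m (Fin.castAdd d₂ i) := by
  rcases x with δ | i
  · simp [rightOp, CounterOp.Fires, Fin.forall_fin_add, funext_iff, and_comm]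
  · simp [rightOp, CounterOp.Fires, Fin.forall_fin_add, funext_iff, and_assoc, Fin.ext_iff]
    have : ∀ j : Fin d₁, ¬ (j : ℕ) = d₁ + i := fun j => by omega
    simp [this, and_comm]

theorem fires_inl_zero {d : ℕ} {m m' : Fin d → ℕ} :
    CounterOp.Fires (Sum.inl fun _ => 0) m m' ↔ m' = m := by
  simp [CounterOp.Fires, funext_iff]

variable {Q₁ Q₂ A : Type*} {d₁ d₂ : ℕ}

/-- Moves of the first automaton, possible if its pending word is empty; resets are only allowed
in phase `0`. -/
def leftMoves [DecidableEq Q₁] (V₁ : BuchiResetVASS Q₁ A d₁) (d₂ : ℕ) (s : ProdState Q₁ Q₂ A) :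
    List (ResetTransition (ProdState Q₁ Q₂ A) A (d₁ + d₂)) :=
  if s.2.2.1 = [] then
    (V₁.transitions.filter fun t => t.source = s.2.1 ∧ (s.1 = 0 ∨ t.op.isLeft = true)).map fun t =>
      ⟨s, leftOp d₂ t.op, [], (s.1, t.target, t.label, s.2.2.2)⟩
  else []

/-- Moves of the second automaton. -/
def rightMoves [DecidableEq Q₂] (d₁ : ℕ) (V₂ : BuchiResetVASS Q₂ A d₂) (s : ProdState Q₁ Q₂ A) :
    List (ResetTransition (ProdState Q₁ Q₂ A) A (d₁ + d₂)) :=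
  if s.2.2.2.2 = [] then
    (V₂.transitions.filter fun t => t.source = s.2.2.2.1 ∧ (s.1 = 0 ∨ t.op.isLeft = true)).map
      fun t => ⟨s, rightOp d₁ t.op, [], (s.1, s.2.1, s.2.2.1, t.target, t.label)⟩
  else []

/-- Reading a letter that both pending words start with. This leads from phase `3` to phase `1`. -/
def readMoves [DecidableEq A] (d : ℕ) (s : ProdState Q₁ Q₂ A) : List (ResetTransition (ProdState Q₁ Q₂ A) A d) :=
  if s.2.2.1 ≠ [] ∧ s.2.2.1.head? = s.2.2.2.2.head? then
    [⟨s, Sum.inl fun _ => 0, s.2.2.1.take 1,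
      (if s.1 = 3 then 1 else s.1, s.2.1, s.2.2.1.tail, s.2.2.2.1, s.2.2.2.2.tail)⟩]
  else []

/-- Changes of the phase: from `0` to `1` at any time, from `1` to `2` in a final state of the first
automaton, and from `2` to `3` in a final state of the second automaton. -/
def phaseMoves [DecidableEq Q₁] [DecidableEq Q₂] (d : ℕ) (F₁ : List Q₁) (F₂ : List Q₂) (s : ProdState Q₁ Q₂ A) :
    List (ResetTransition (ProdState Q₁ Q₂ A) A d) :=
  if s.1 = 0 ∨ (s.1 = 1 ∧ s.2.1 ∈ F₁) ∨ (s.1 = 2 ∧ s.2.2.2.1 ∈ F₂) then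
    [⟨s, Sum.inl fun _ => 0, [], (s.1 + 1, s.2)⟩]
  else []

/-- The outgoing transitions of a state of the product. -/
def prodOut [DecidableEq Q₁] [DecidableEq Q₂] [DecidableEq A]
    (V₁ : BuchiResetVASS Q₁ A d₁) (V₂ : BuchiResetVASS Q₂ A d₂) (s : ProdState Q₁ Q₂ A) :
    List (ResetTransition (ProdState Q₁ Q₂ A) A (d₁ + d₂)) :=
  leftMoves V₁ d₂ s ++ rightMoves d₁ V₂ s ++ readMoves _ s ++ phaseMoves _ V₁.final V₂.final s

/-- The initial state of the product. -/
def prodInit (V₁ : BuchiResetVASS Q₁ A d₁) (V₂ : BuchiResetVASS Q₂ A d₂) : ProdState Q₁ Q₂ A :=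
  (0, V₁.init, [], V₂.init, [])

variable {V₁ : BuchiResetVASS Q₁ A d₁} {V₂ : BuchiResetVASS Q₂ A d₂}

theorem mem_leftMoves [DecidableEq Q₁] {s : ProdState Q₁ Q₂ A} {t} : t ∈ leftMoves V₁ d₂ s ↔ s.2.2.1 = [] ∧
    ∃ t₁ ∈ V₁.transitions, t₁.source = s.2.1 ∧ (s.1 = 0 ∨ t₁.op.isLeft = true) ∧
      t = ⟨s, leftOp d₂ t₁.op, [], (s.1, t₁.target, t₁.label, s.2.2.2)⟩ := by
  rw [leftMoves]
  split_ifs with h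
  · simp only [h, List.mem_map, List.mem_filter, decide_eq_true_eq, true_and]
    exact ⟨fun ⟨t₁, ⟨h1, h2, h3⟩, h4⟩ => ⟨t₁, h1, h2, h3, h4.symm⟩,
      fun ⟨t₁, h1, h2, h3, h4⟩ => ⟨t₁, ⟨h1, h2, h3⟩, h4.symm⟩⟩
  · simp [h]

theorem mem_rightMoves [DecidableEq Q₂] {s : ProdState Q₁ Q₂ A} {t} : t ∈ rightMoves d₁ V₂ s ↔ s.2.2.2.2 = [] ∧
    ∃ t₂ ∈ V₂.transitions, t₂.source = s.2.2.2.1 ∧ (s.1 = 0 ∨ t₂.op.isLeft = true) ∧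
      t = ⟨s, rightOp d₁ t₂.op, [], (s.1, s.2.1, s.2.2.1, t₂.target, t₂.label)⟩ := by
  rw [rightMoves]
  split_ifs with h
  · simp only [h, List.mem_map, List.mem_filter, decide_eq_true_eq, true_and]
    exact ⟨fun ⟨t₁, ⟨h1, h2, h3⟩, h4⟩ => ⟨t₁, h1, h2, h3, h4.symm⟩,
      fun ⟨t₁, h1, h2, h3, h4⟩ => ⟨t₁, ⟨h1, h2, h3⟩, h4.symm⟩⟩
  · simp [h]

theorem mem_readMoves [DecidableEq A] {d : ℕ} {s : ProdState Q₁ Q₂ A} {t} : t ∈ readMoves d s ↔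
    ∃ a l₁ l₂, s.2.2.1 = a :: l₁ ∧ s.2.2.2.2 = a :: l₂ ∧
      t = ⟨s, Sum.inl fun _ => 0, [a], (if s.1 = 3 then 1 else s.1, s.2.1, l₁, s.2.2.2.1, l₂)⟩ := by
  obtain ⟨φ, q₁, x₁, q₂, x₂⟩ := s
  rcases x₁ with _ | ⟨a, l₁⟩
  · simp [readMoves]
  · rcases x₂ with _ | ⟨b, l₂⟩
    · simp [readMoves]
    · by_cases hab : a = b
      · subst hab
        simp [readMoves]
      · have hba : ¬ b = a := fun h => hab h.symm
        simp [readMoves, hab, hba]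

theorem mem_phaseMoves [DecidableEq Q₁] [DecidableEq Q₂] {d : ℕ} {F₁ : List Q₁} {F₂ : List Q₂} {s : ProdState Q₁ Q₂ A} {t} :
    t ∈ phaseMoves d F₁ F₂ s ↔
      (s.1 = 0 ∨ (s.1 = 1 ∧ s.2.1 ∈ F₁) ∨ (s.1 = 2 ∧ s.2.2.2.1 ∈ F₂)) ∧
      t = ⟨s, Sum.inl fun _ => 0, [], (s.1 + 1, s.2)⟩ := by
  rw [phaseMoves]
  split_ifs with h <;> simp [h]

theorem mem_prodOut [DecidableEq Q₁] [DecidableEq Q₂] [DecidableEq A]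
    {s : ProdState Q₁ Q₂ A} {t} : t ∈ prodOut V₁ V₂ s ↔
    t ∈ leftMoves V₁ d₂ s ∨ t ∈ rightMoves d₁ V₂ s ∨ t ∈ readMoves _ s ∨
      t ∈ phaseMoves _ V₁.final V₂.final s := by
  simp [prodOut]

/-- A letter is read by a step of the product iff its label is not empty. -/
theorem label_of_mem_prodOut [DecidableEq Q₁] [DecidableEq Q₂] [DecidableEq A]
    {s : ProdState Q₁ Q₂ A} {t} (ht : t ∈ prodOut V₁ V₂ s) :
    (t.label = [] ∧ (t.target.1 = s.1 ∨ (s.1 = 0 ∧ t.target.1 = 1) ∨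
        (s.1 = 1 ∧ s.2.1 ∈ V₁.final ∧ t.target.1 = 2) ∨
        (s.1 = 2 ∧ s.2.2.2.1 ∈ V₂.final ∧ t.target.1 = 3))) ∨
      (∃ a, t.label = [a]) ∧ t.target.1 = if s.1 = 3 then 1 else s.1 := by
  rcases mem_prodOut.1 ht with h | h | h | h
  · obtain ⟨-, t₁, -, -, -, rfl⟩ := mem_leftMoves.1 h
    simp
  · obtain ⟨-, t₁, -, -, -, rfl⟩ := mem_rightMoves.1 h
    simp
  · obtain ⟨a, l₁, l₂, -, -, rfl⟩ := mem_readMoves.1 h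
    simp
  · obtain ⟨h1 | ⟨h1, h'⟩ | ⟨h1, h'⟩, rfl⟩ := mem_phaseMoves.1 h <;>
      refine Or.inl ⟨rfl, Or.inr ?_⟩
    · exact Or.inl ⟨h1, by simp [h1]⟩
    · exact Or.inr (Or.inl ⟨h1, h', by simp [h1]⟩)
    · exact Or.inr (Or.inr ⟨h1, h', by simp [h1]⟩)

/-- If the phases avoid `3` once a set of phases `X` is entered, phase `3` is not visited
infinitely often while letters are read. -/
theorem not_forall_phase_of_trap {φ p : ℕ → ℕ} (h3 : ∀ N, ∃ n, N ≤ n ∧ φ n = 3)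
    (hp : ∀ B, ∃ n, B ≤ p n) (hpm : Monotone p)
    (hstep : ∀ n, φ n = 3 → φ (n + 1) = 3 → p (n + 1) = p n) {X : ℕ → Prop} (hX3 : ¬ X 3) {N : ℕ}
    (hX : ∀ n, N ≤ n → X (φ n) → X (φ (n + 1)))
    (h3X : ∀ n, N ≤ n → φ n = 3 → φ (n + 1) = 3 ∨ X (φ (n + 1))) : False := by
  obtain ⟨n₀, hn₀, hφ₀⟩ := h3 N
  have hnoX : ∀ n, N ≤ n → ¬ X (φ n) := by
    intro n hn hx
    have hall : ∀ j, X (φ (n + j)) := by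
      intro j
      induction j with
      | zero => exact hx
      | succ j ih => exact hX (n + j) (by omega) ih
    obtain ⟨k, hk, hk3⟩ := h3 n
    have := hall (k - n)
    rw [Nat.add_sub_cancel' hk, hk3] at this
    exact hX3 this
  have hall : ∀ j, φ (n₀ + j) = 3 ∧ p (n₀ + j) = p n₀ := by
    intro j
    induction j with
    | zero => exact ⟨hφ₀, rfl⟩
    | succ j ih =>
      have h1 := (h3X (n₀ + j) (by omega) ih.1).resolve_right (hnoX _ (by omega))
      exact ⟨h1, (hstep _ ih.1 h1).trans ih.2⟩
  obtain ⟨n, hn⟩ := hp (p n₀ + 1)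
  have h1 := (hall n).2
  have h2 : p n ≤ p (n₀ + n) := hpm (by omega)
  omega

section Projection

variable {c : ℕ → ProdState Q₁ Q₂ A × (Fin (d₁ + d₂) → ℕ)}
  {t : ℕ → ResetTransition (ProdState Q₁ Q₂ A) A (d₁ + d₂)} {w : ℕ → A}

theorem IsOutRun.letter_eq {S : Type*} {d : ℕ} {t : ℕ → ResetTransition S A d}
    (hw : IsInfiniteConcat (fun n => (t n).label) w) {n : ℕ} {a : A} (h : (t n).label = [a]) :
    a = w (concatLabels (fun n => (t n).label) n).length := by
  have h1 := hw.1 (n + 1)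
  rw [concatLabels_succ, hw.1 n, h] at h1
  simp only [List.length_append, List.length_map, List.length_range, List.length_singleton,
    List.range_succ, List.map_append, List.map_cons, List.map_nil] at h1
  simpa using h1

/-- Seen from the first automaton, left moves are its transitions, reading moves consume its pending
word, and all other moves are idle. -/
theorem IsOutRun.isInterleavedRun_left [DecidableEq Q₁] [DecidableEq Q₂] [DecidableEq A]
    (h : IsOutRun (prodOut V₁ V₂) (prodInit V₁ V₂) c t)
    (hw : IsInfiniteConcat (fun n => (t n).label) w) :
    V₁.IsInterleavedRun w (fun n => (c n).1.2.1) (fun n i => (c n).2 (Fin.castAdd d₂ i))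
      (fun n => (c n).1.2.2.1) (fun n => (concatLabels (fun n => (t n).label) n).length) where
  init := by
    rw [h.1]
    simp [prodInit, concatLabels]
  step n := by
    obtain ⟨h1, h2, h3⟩ := h.2 n
    have hlen : (concatLabels (fun n => (t n).label) (n + 1)).length =
        (concatLabels (fun n => (t n).label) n).length + (t n).label.length := by
      rw [concatLabels_succ, List.length_append]
    rw [hlen, ← h2]
    rcases mem_prodOut.1 h1 with h4 | h4 | h4 | h4
    · obtain ⟨h5, t₁, h6, h7, -, h8⟩ := mem_leftMoves.1 h4
      rw [h8] at h3 ⊢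
      exact Or.inl ⟨t₁, h6, h7, rfl, (fires_leftOp.1 h3).1, h5, rfl, rfl⟩
    · obtain ⟨h5, t₁, h6, h7, -, h8⟩ := mem_rightMoves.1 h4
      rw [h8] at h3 ⊢
      exact Or.inr ⟨rfl, (fires_rightOp.1 h3).2, Or.inl ⟨rfl, rfl⟩⟩
    · obtain ⟨a, l₁, l₂, h5, h6, h8⟩ := mem_readMoves.1 h4
      have ha := letter_eq hw (n := n) (a := a) (by rw [h8])
      rw [h8] at h3 ⊢
      refine Or.inr ⟨rfl, by rw [fires_inl_zero.1 h3], Or.inr ⟨?_, rfl⟩⟩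
      rw [h5, ← ha]
    · obtain ⟨-, h8⟩ := mem_phaseMoves.1 h4
      rw [h8] at h3 ⊢
      exact Or.inr ⟨rfl, by rw [fires_inl_zero.1 h3], Or.inl ⟨rfl, rfl⟩⟩

theorem IsOutRun.isInterleavedRun_right [DecidableEq Q₁] [DecidableEq Q₂] [DecidableEq A]
    (h : IsOutRun (prodOut V₁ V₂) (prodInit V₁ V₂) c t)
    (hw : IsInfiniteConcat (fun n => (t n).label) w) :
    V₂.IsInterleavedRun w (fun n => (c n).1.2.2.2.1) (fun n i => (c n).2 (Fin.natAdd d₁ i))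
      (fun n => (c n).1.2.2.2.2) (fun n => (concatLabels (fun n => (t n).label) n).length) where
  init := by
    rw [h.1]
    simp [prodInit, concatLabels]
  step n := by
    obtain ⟨h1, h2, h3⟩ := h.2 n
    have hlen : (concatLabels (fun n => (t n).label) (n + 1)).length =
        (concatLabels (fun n => (t n).label) n).length + (t n).label.length := by
      rw [concatLabels_succ, List.length_append]
    rw [hlen, ← h2]
    rcases mem_prodOut.1 h1 with h4 | h4 | h4 | h4
    · obtain ⟨h5, t₁, h6, h7, -, h8⟩ := mem_leftMoves.1 h4
      rw [h8] at h3 ⊢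
      exact Or.inr ⟨rfl, (fires_leftOp.1 h3).2, Or.inl ⟨rfl, rfl⟩⟩
    · obtain ⟨h5, t₁, h6, h7, -, h8⟩ := mem_rightMoves.1 h4
      rw [h8] at h3 ⊢
      exact Or.inl ⟨t₁, h6, h7, rfl, (fires_rightOp.1 h3).1, h5, rfl, rfl⟩
    · obtain ⟨a, l₁, l₂, h5, h6, h8⟩ := mem_readMoves.1 h4
      have ha := letter_eq hw (n := n) (a := a) (by rw [h8])
      rw [h8] at h3 ⊢
      refine Or.inr ⟨rfl, by rw [fires_inl_zero.1 h3], Or.inr ⟨?_, rfl⟩⟩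
      rw [h6, ← ha]
    · obtain ⟨-, h8⟩ := mem_phaseMoves.1 h4
      rw [h8] at h3 ⊢
      exact Or.inr ⟨rfl, by rw [fires_inl_zero.1 h3], Or.inl ⟨rfl, rfl⟩⟩

/-- Since letters are read for ever, phase 3 is left again and again, always to 1, and returning
needs final states of both automata. If the first has none after `N`, phase 1 is a trap; if the
second has none, the phases 1 and 2 together are. -/
theorem IsOutRun.mem_languages [DecidableEq Q₁] [DecidableEq Q₂] [DecidableEq A]
    (h : IsOutRun (prodOut V₁ V₂) (prodInit V₁ V₂) c t)
    (hF : ∀ N, ∃ n, N ≤ n ∧ (c n).1.1 = 3) (hw : IsInfiniteConcat (fun n => (t n).label) w) :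
    w ∈ V₁.language ∩ V₂.language := by
  have hstep : ∀ n, _ := fun n => label_of_mem_prodOut (h.2 n).1
  simp only [(h.2 _).2.1] at hstep
  have hpm := concatLabels_length_mono fun n => (t n).label
  have hp3 : ∀ n, (c n).1.1 = 3 → (c (n + 1)).1.1 = 3 →
      (concatLabels (fun n => (t n).label) (n + 1)).length =
        (concatLabels (fun n => (t n).label) n).length := by
    intro n h1 h2
    rw [concatLabels_succ, List.length_append]
    have := hstep n
    simp only [h1, h2] at this
    rcases this with ⟨h3, -⟩ | ⟨-, h3⟩
    · simp [h3]
    · simp at h3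
  refine ⟨(h.isInterleavedRun_left hw).mem_language hw.2 fun N => ?_,
    (h.isInterleavedRun_right hw).mem_language hw.2 fun N => ?_⟩
  · by_contra! hno
    refine not_forall_phase_of_trap hF hw.2 hpm hp3 (X := fun k => k = 1) (by simp) (N := N) ?_ ?_
    · intro n hn h1
      have h2 := hstep n
      have h3 := hno n hn
      simp only [h1, h3, false_and, and_false, false_or] at h2
      split_ifs at h2 <;> omega
    · intro n hn h1
      have h2 := hstep n
      simp only [h1, if_true] at h2
      omega
  · by_contra! hno
    refine not_forall_phase_of_trap hF hw.2 hpm hp3 (X := fun k => k = 1 ∨ k = 2) (by simp)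
      (N := N) ?_ ?_
    · intro n hn h1
      have h2 := hstep n
      have h3 := hno n hn
      simp only [h3, false_and, and_false, or_false] at h2
      split_ifs at h2 <;> omega
    · intro n hn h1
      have h2 := hstep n
      simp only [h1, if_true] at h2
      omega

end Projection

/-- The configuration of the product described by a state of the scheduler. -/
def schedulerConfig (c₁ : ℕ → Q₁ × (Fin d₁ → ℕ)) (ℓ₁ : ℕ → List A) (c₂ : ℕ → Q₂ × (Fin d₂ → ℕ))
    (ℓ₂ : ℕ → List A) (s : ℕ × ℕ × ℕ × ℕ) : ProdState Q₁ Q₂ A × (Fin (d₁ + d₂) → ℕ) :=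
  ((s.1, (c₁ s.2.1).1, (concatLabels ℓ₁ s.2.1).drop s.2.2.2, (c₂ s.2.2.1).1,
    (concatLabels ℓ₂ s.2.2.1).drop s.2.2.2), Fin.append (c₁ s.2.1).2 (c₂ s.2.2.1).2)

/-- Words accepted by both automata label runs of the product. -/
theorem exists_isOutRun [DecidableEq Q₁] [DecidableEq Q₂] [DecidableEq A]
    (hV₁ : V₁.IsWeak) (hV₂ : V₂.IsWeak) {w : ℕ → A}
    (hw : w ∈ V₁.language ∩ V₂.language) :
    ∃ c t, IsOutRun (prodOut V₁ V₂) (prodInit V₁ V₂) c t ∧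
      (∀ N, ∃ n, N ≤ n ∧ (c n).1.1 = 3 ∧ (c (n + 1)).1.1 = 1) ∧
      IsInfiniteConcat (fun n => (t n).label) w := by
  obtain ⟨⟨c₁, t₁, hr₁, hF₁, hc₁⟩, c₂, t₂, hr₂, hF₂, hc₂⟩ := hw
  obtain ⟨N₁, hN₁⟩ := hV₁.exists_forall_not_isReset hr₁ hF₁
  obtain ⟨N₂, hN₂⟩ := hV₂.exists_forall_not_isReset hr₂ hF₂
  set ℓ₁ : ℕ → List A := fun n => (t₁ n).label with hℓ₁
  set ℓ₂ : ℕ → List A := fun n => (t₂ n).label with hℓ₂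
  -- From index `N` on neither run resets, so phase 0 is left only when both runs have reached it;
  -- later moves are allowed in every phase.
  set N := max N₁ N₂ with hN
  have hleft : ∀ {d : ℕ} (x : CounterOp d), (¬ ∃ i, x = Sum.inr i) → x.isLeft = true := by
    rintro d (δ | i) hx
    · rfl
    · exact absurd ⟨i, rfl⟩ hx
  obtain ⟨s, hs0, hs⟩ := exists_seq_step
    (A := fun _ (s : ℕ × ℕ × ℕ × ℕ) => s.2.2.2 ≤ (concatLabels ℓ₁ s.2.1).length ∧
      s.2.2.2 ≤ (concatLabels ℓ₂ s.2.2.1).length ∧ (s.1 = 0 ∨ (N ≤ s.2.1 ∧ N ≤ s.2.2.1)))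
    (B := fun _ s s' => SchedulerStep (fun n => (concatLabels ℓ₁ n).length)
        (fun n => (concatLabels ℓ₂ n).length) (fun n => (c₁ n).1 ∈ V₁.final)
        (fun n => (c₂ n).1 ∈ V₂.final) N s s' ∧
      ∃ t ∈ prodOut V₁ V₂ (schedulerConfig c₁ ℓ₁ c₂ ℓ₂ s).1,
        t.target = (schedulerConfig c₁ ℓ₁ c₂ ℓ₂ s').1 ∧
        t.op.Fires (schedulerConfig c₁ ℓ₁ c₂ ℓ₂ s).2 (schedulerConfig c₁ ℓ₁ c₂ ℓ₂ s').2 ∧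
        (List.range s.2.2.2).map w ++ t.label = (List.range s'.2.2.2).map w)
    (a₀ := (0, 0, 0, 0)) (by simp) (by
    rintro - ⟨φ, a, b, p⟩ ⟨hpa, hpb, hφN⟩
    obtain ⟨s', hs'⟩ := exists_schedulerStep (fun n => (concatLabels ℓ₁ n).length)
        (fun n => (concatLabels ℓ₂ n).length) (fun n => (c₁ n).1 ∈ V₁.final)
        (fun n => (c₂ n).1 ∈ V₂.final) N (φ, a, b, p)
    have hm₁ : (concatLabels ℓ₁ a).length ≤ (concatLabels ℓ₁ (a + 1)).length :=
      concatLabels_length_mono ℓ₁ a.le_succ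
    have hm₂ : (concatLabels ℓ₂ b).length ≤ (concatLabels ℓ₂ (b + 1)).length :=
      concatLabels_length_mono ℓ₂ b.le_succ
    refine ⟨s', ?_, hs', ?_⟩
    · rcases hs' with ⟨h1, h2, h3, rfl⟩ | ⟨h1, h2, rfl⟩ | ⟨h1, h2, rfl⟩ |
        ⟨h1, ⟨h2, rfl⟩ | ⟨h2, h3, rfl⟩ | ⟨h2, h3, rfl⟩⟩ <;> dsimp only at * <;>
        refine ⟨by omega, by omega, ?_⟩ <;> try omega
      split_ifs <;> omega
    · rcases hs' with ⟨h1, h2, h3, rfl⟩ | ⟨h1, h2, rfl⟩ | ⟨h1, h2, rfl⟩ |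
        ⟨h1, ⟨h2, rfl⟩ | ⟨h2, h3, rfl⟩ | ⟨h2, h3, rfl⟩⟩ <;> dsimp only at * <;>
        simp only [mem_prodOut, schedulerConfig]
      · subst h1
        exact ⟨_, Or.inr (Or.inr (Or.inr (mem_phaseMoves.2 ⟨Or.inl rfl, rfl⟩))), rfl,
          fires_inl_zero.2 rfl, by simp⟩
      · subst h1
        exact ⟨_, Or.inr (Or.inr (Or.inr (mem_phaseMoves.2 ⟨Or.inr (Or.inl ⟨rfl, h2⟩), rfl⟩))), rfl,
          fires_inl_zero.2 rfl, by simp⟩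
      · subst h1
        exact ⟨_, Or.inr (Or.inr (Or.inr (mem_phaseMoves.2 ⟨Or.inr (Or.inr ⟨rfl, h2⟩), rfl⟩))), rfl,
          fires_inl_zero.2 rfl, by simp⟩
      · have hp : p = (concatLabels ℓ₁ a).length := le_antisymm hpa h2
        refine ⟨_, Or.inl (mem_leftMoves.2 ⟨?_, t₁ a, (hr₁.2 a).1, (hr₁.2 a).2.1,
          hφN.imp_right fun h => hleft _ (hN₁ a (by omega)), rfl⟩), ?_, ?_, by simp⟩
        · rw [hp, List.drop_length]
        · rw [concatLabels_succ, hp, List.drop_left]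
          simp only [(hr₁.2 a).2.2.1, hℓ₁]
        · refine fires_leftOp.2 ⟨?_, ?_⟩
          · simpa using (hr₁.2 a).2.2.2
          · simp
      · have hp : p = (concatLabels ℓ₂ b).length := le_antisymm hpb h3
        refine ⟨_, Or.inr (Or.inl (mem_rightMoves.2 ⟨?_, t₂ b, (hr₂.2 b).1, (hr₂.2 b).2.1,
          hφN.imp_right fun h => hleft _ (hN₂ b (by omega)), rfl⟩)), ?_, ?_, by simp⟩
        · rw [hp, List.drop_length]
        · rw [concatLabels_succ, hp, List.drop_left]
          simp only [(hr₂.2 b).2.2.1, hℓ₂]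
        · refine fires_rightOp.2 ⟨?_, ?_⟩
          · simpa using (hr₂.2 b).2.2.2
          · simp
      · exact ⟨_, Or.inr (Or.inr (Or.inl (mem_readMoves.2 ⟨w p, _, _, hc₁.drop_eq_cons h2,
          hc₂.drop_eq_cons h3, rfl⟩))), rfl, fires_inl_zero.2 rfl, by simp [List.range_succ]⟩)
  choose hA hS t ht htgt hfires hlab using hs
  obtain ⟨hu, h31⟩ := scheduler_fair (concatLabels_length_mono ℓ₁) (concatLabels_length_mono ℓ₂)
    hc₁.2 hc₂.2 hF₁ hF₂ hs0 hS
  have hcon : ∀ n, concatLabels (fun n => (t n).label) n = (List.range (s n).2.2.2).map w := by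
    intro n
    induction n with
    | zero => simp [hs0, concatLabels]
    | succ n ih => rw [concatLabels_succ, ih, hlab]
  refine ⟨fun n => schedulerConfig c₁ ℓ₁ c₂ ℓ₂ (s n), t, ⟨?_, fun n => ⟨ht n, htgt n, hfires n⟩⟩,
    h31, fun n => ?_, fun B => ?_⟩
  · simp only [hs0, schedulerConfig, hr₁.1, hr₂.1, prodInit, concatLabels]
    refine Prod.ext (by simp) ?_
    funext i
    refine Fin.addCases (fun i => ?_) (fun i => ?_) i <;> simp
  · rw [hcon]
    simp
  · obtain ⟨n, hn⟩ := hu B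
    exact ⟨n, by simpa [hcon] using hn⟩

end BuchiResetVASS

/-! ### The product on codes. -/

/-- With the coding of integers in arithmetic form, positive and negative parts become simple
functions of the code. -/
theorem intEquivNat_symm_apply (n : ℕ) :
    Equiv.intEquivNat.symm n = if n % 2 = 0 then ((n / 2 : ℕ) : ℤ) else -((n / 2 : ℕ) : ℤ) - 1 := by
  rw [Equiv.symm_apply_eq]
  split_ifs with h
  · change n = 2 * (n / 2)
    omega
  · have h1 : -((n / 2 : ℕ) : ℤ) - 1 = Int.negSucc (n / 2) := by
      rw [Int.negSucc_eq]
      omega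
    rw [h1]
    change n = 2 * (n / 2) + 1
    omega

theorem primrec_toNat : Primrec Int.toNat := by
  rw [Primrec.ofNat_iff]
  have h : Primrec fun n : ℕ => if n % 2 = 0 then n / 2 else 0 :=
    Primrec.ite (Primrec.eq.comp (Primrec.nat_mod.comp Primrec.id (Primrec.const 2)) (Primrec.const 0))
      (Primrec.nat_div.comp Primrec.id (Primrec.const 2)) (Primrec.const 0)
  refine h.of_eq fun n => ?_
  change _ = (Equiv.intEquivNat.symm n).toNat
  rw [intEquivNat_symm_apply]
  split_ifs <;> omega

theorem primrec_neg_toNat : Primrec fun z : ℤ => (-z).toNat := by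
  rw [Primrec.ofNat_iff]
  have h : Primrec fun n : ℕ => if n % 2 = 0 then 0 else n / 2 + 1 :=
    Primrec.ite (Primrec.eq.comp (Primrec.nat_mod.comp Primrec.id (Primrec.const 2)) (Primrec.const 0))
      (Primrec.const 0) (Primrec.succ.comp (Primrec.nat_div.comp Primrec.id (Primrec.const 2)))
  refine h.of_eq fun n => ?_
  change _ = (-(Equiv.intEquivNat.symm n)).toNat
  rw [intEquivNat_symm_apply]
  split_ifs <;> omega

namespace BuchiResetVASS

/-- Encoded states of the product. -/
abbrev ProdCode : Type := ProdState ℕ ℕ ℕ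

/-- The effect of an encoded operation acting on the counters from `p` on: the amounts subtracted and
added, and the kind. -/
def effCode (p : ℕ) (x : List ℤ ⊕ ℕ) : List ℕ × List ℕ × ℕ :=
  Sum.elim (fun δ => (List.replicate p 0 ++ δ.map fun z => (-z).toNat,
    List.replicate p 0 ++ δ.map Int.toNat, 0)) (fun i => ([], [], p + i + 2)) x

/-- Encoded moves of the first automaton. -/
def leftCode (T : List TransitionCode) (s : ProdCode) : List (CounterTrans ProdCode) :=
  if s.2.2.1 = [] then
    (T.filter fun t => t.1 = s.2.1 ∧ (s.1 = 0 ∨ t.2.1.isLeft = true)).map fun t =>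
      ((s.1, t.2.2.2, t.2.2.1, s.2.2.2), effCode 0 t.2.1)
  else []

/-- Encoded moves of the second automaton. -/
def rightCode (p : ℕ) (T : List TransitionCode) (s : ProdCode) : List (CounterTrans ProdCode) :=
  if s.2.2.2.2 = [] then
    (T.filter fun t => t.1 = s.2.2.2.1 ∧ (s.1 = 0 ∨ t.2.1.isLeft = true)).map fun t =>
      ((s.1, s.2.1, s.2.2.1, t.2.2.2, t.2.2.1), effCode p t.2.1)
  else []

/-- Encoded reading moves; the one leading from phase `3` to phase `1` is marked. -/
def readCode (s : ProdCode) : List (CounterTrans ProdCode) :=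
  if s.2.2.1 ≠ [] ∧ s.2.2.1.head? = s.2.2.2.2.head? then
    [((if s.1 = 3 then 1 else s.1, s.2.1, s.2.2.1.tail, s.2.2.2.1, s.2.2.2.2.tail), [], [],
      if s.1 = 3 then 1 else 0)]
  else []

/-- Encoded changes of the phase. -/
def phaseCode (F₁ F₂ : List ℕ) (s : ProdCode) : List (CounterTrans ProdCode) :=
  if s.1 = 0 ∨ (s.1 = 1 ∧ s.2.1 ∈ F₁) ∨ (s.1 = 2 ∧ s.2.2.2.1 ∈ F₂) then
    [((s.1 + 1, s.2), [], [], 0)]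
  else []

/-- The encoded outgoing transitions of an encoded state of the product. -/
def outCode (c : VASSCode × VASSCode) (s : ProdCode) : List (CounterTrans ProdCode) :=
  leftCode c.1.2.2.2.2.1 s ++ rightCode c.1.2.2.1 c.2.2.2.2.2.1 s ++ readCode s ++
    phaseCode c.1.2.2.2.2.2 c.2.2.2.2.2.2 s

/-- The encoded initial state of the product. -/
def initCode (c : VASSCode × VASSCode) : ProdCode := (0, c.1.2.2.2.1, [], c.2.2.2.2.1, [])

section Primrec

variable {α : Type*} [Primcodable α]

theorem primrec_effCode {p : α → ℕ} {x : α → List ℤ ⊕ ℕ} (hp : Primrec p) (hx : Primrec x) :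
    Primrec fun a => effCode (p a) (x a) := by
  have hrep : Primrec fun a => List.replicate (p a) 0 := by
    refine (Primrec.list_map (Primrec.list_range.comp hp) (Primrec.const 0).to₂).of_eq fun a => ?_
    simp [List.map_const']
  have h : Primrec fun a => Sum.casesOn (motive := fun _ => List ℕ × List ℕ × ℕ) (x a)
      (fun δ => (List.replicate (p a) 0 ++ δ.map fun z => (-z).toNat,
        List.replicate (p a) 0 ++ δ.map Int.toNat, 0)) (fun i => ([], [], p a + i + 2)) := by
    refine Primrec.sumCasesOn hx ?_ ?_
    · exact (Primrec.list_append.comp (hrep.comp Primrec.fst)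
        (Primrec.list_map Primrec.snd (primrec_neg_toNat.comp Primrec.snd).to₂)).pair
        ((Primrec.list_append.comp (hrep.comp Primrec.fst)
          (Primrec.list_map Primrec.snd (primrec_toNat.comp Primrec.snd).to₂)).pair (Primrec.const 0))
    · exact (Primrec.const []).pair ((Primrec.const []).pair (Primrec.nat_add.comp
        (Primrec.nat_add.comp (hp.comp Primrec.fst) Primrec.snd) (Primrec.const 2)))
  refine h.of_eq fun a => ?_
  unfold effCode
  rcases x a <;> rfl

theorem primrec_isLeft {x : α → List ℤ ⊕ ℕ} (hx : Primrec x) : Primrec fun a => (x a).isLeft := by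
  have h : Primrec fun a => Sum.casesOn (motive := fun _ => Bool) (x a) (fun _ => true) fun _ => false :=
    Primrec.sumCasesOn hx (Primrec.const true).to₂ (Primrec.const false).to₂
  refine h.of_eq fun a => ?_
  rcases x a <;> rfl

theorem primrec_ite_filter_map {β γ : Type*} [Primcodable β] [Primcodable γ] {T : α → List β}
    {P : α → Prop} [DecidablePred P] {R : α → β → Prop} [∀ a, DecidablePred (R a)] {f : α → β → γ}
    (hT : Primrec T) (hP : PrimrecPred P) (hR : PrimrecRel R) (hf : Primrec₂ f) :
    Primrec fun a => if P a then ((T a).filter (fun b => decide (R a b))).map (f a) else [] := by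
  refine Primrec.ite hP ?_ (Primrec.const [])
  have h : Primrec fun a => (T a).filterMap fun b => if R a b then some (f a b) else none :=
    Primrec.listFilterMap hT (Primrec.ite hR (Primrec.option_some.comp hf) (Primrec.const none))
  refine h.of_eq fun a => ?_
  induction T a with
  | nil => rfl
  | cons b l ih =>
    by_cases hb : R a b <;> simp [hb, ih]

theorem primrecPred_mem {x : α → ℕ} {l : α → List ℕ} (hx : Primrec x) (hl : Primrec l) :
    PrimrecPred fun a => x a ∈ l a := by
  refine (PrimrecPred.exists_mem_of hl (R := fun a b => b = x a)
    (Primrec.eq.comp Primrec.snd (hx.comp Primrec.fst))).of_eq fun a => ?_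
  simp

theorem primrec_leftCode {T : α → List TransitionCode} {s : α → ProdCode} (hT : Primrec T)
    (hs : Primrec s) : Primrec fun a => leftCode (T a) (s a) := by
  have hs' : Primrec fun p : α × TransitionCode => s p.1 := hs.comp Primrec.fst
  have ht : Primrec fun p : α × TransitionCode => p.2 := Primrec.snd
  have hop : Primrec fun p : α × TransitionCode => p.2.2.1 := Primrec.fst.comp (Primrec.snd.comp ht)
  have hlt := Primrec.snd.comp (Primrec.snd.comp ht)
  refine primrec_ite_filter_map hT
    (Primrec.eq.comp (Primrec.fst.comp (Primrec.snd.comp (Primrec.snd.comp hs))) (Primrec.const []))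
    (R := fun a t => t.1 = (s a).2.1 ∧ ((s a).1 = 0 ∨ t.2.1.isLeft = true))
    (f := fun a t => (((s a).1, t.2.2.2, t.2.2.1, (s a).2.2.2), effCode 0 t.2.1)) ?_ ?_
  · exact (Primrec.eq.comp (Primrec.fst.comp ht) (Primrec.fst.comp (Primrec.snd.comp hs'))).and
      ((Primrec.eq.comp (Primrec.fst.comp hs') (Primrec.const 0)).or
        (Primrec.eq.comp (primrec_isLeft hop) (Primrec.const true)))
  · exact ((Primrec.fst.comp hs').pair ((Primrec.snd.comp hlt).pair ((Primrec.fst.comp hlt).pair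
      (Primrec.snd.comp (Primrec.snd.comp (Primrec.snd.comp hs')))))).pair
        (primrec_effCode (Primrec.const 0) hop)

theorem primrec_rightCode {p : α → ℕ} {T : α → List TransitionCode} {s : α → ProdCode}
    (hp : Primrec p) (hT : Primrec T) (hs : Primrec s) :
    Primrec fun a => rightCode (p a) (T a) (s a) := by
  have hs' : Primrec fun p : α × TransitionCode => s p.1 := hs.comp Primrec.fst
  have ht : Primrec fun p : α × TransitionCode => p.2 := Primrec.snd
  have hop : Primrec fun p : α × TransitionCode => p.2.2.1 := Primrec.fst.comp (Primrec.snd.comp ht)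
  have hlt := Primrec.snd.comp (Primrec.snd.comp ht)
  have hy : Primrec fun p : α × TransitionCode => (s p.1).2.2 := Primrec.snd.comp (Primrec.snd.comp hs')
  refine primrec_ite_filter_map hT (Primrec.eq.comp (Primrec.snd.comp (Primrec.snd.comp (Primrec.snd.comp
      (Primrec.snd.comp hs)))) (Primrec.const []))
    (R := fun a t => t.1 = (s a).2.2.2.1 ∧ ((s a).1 = 0 ∨ t.2.1.isLeft = true))
    (f := fun a t => (((s a).1, (s a).2.1, (s a).2.2.1, t.2.2.2, t.2.2.1), effCode (p a) t.2.1)) ?_ ?_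
  · exact (Primrec.eq.comp (Primrec.fst.comp ht) (Primrec.fst.comp (Primrec.snd.comp hy))).and
      ((Primrec.eq.comp (Primrec.fst.comp hs') (Primrec.const 0)).or
        (Primrec.eq.comp (primrec_isLeft hop) (Primrec.const true)))
  · exact ((Primrec.fst.comp hs').pair ((Primrec.fst.comp (Primrec.snd.comp hs')).pair
      ((Primrec.fst.comp hy).pair ((Primrec.snd.comp hlt).pair (Primrec.fst.comp hlt))))).pair
        (primrec_effCode (hp.comp Primrec.fst) hop)

theorem primrec_readCode : Primrec readCode := by
  have hφ : Primrec fun s : ProdCode => s.1 := Primrec.fst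
  have hq₁ : Primrec fun s : ProdCode => s.2.1 := Primrec.fst.comp Primrec.snd
  have hy₁ : Primrec fun s : ProdCode => s.2.2 := Primrec.snd.comp Primrec.snd
  have hx₁ : Primrec fun s : ProdCode => s.2.2.1 := Primrec.fst.comp hy₁
  have hq₂ : Primrec fun s : ProdCode => s.2.2.2.1 := Primrec.fst.comp (Primrec.snd.comp hy₁)
  have hx₂ : Primrec fun s : ProdCode => s.2.2.2.2 := Primrec.snd.comp (Primrec.snd.comp hy₁)
  have hφ3 : PrimrecPred fun s : ProdCode => s.1 = 3 := Primrec.eq.comp hφ (Primrec.const 3)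
  refine Primrec.ite ((Primrec.eq.comp hx₁ (Primrec.const [])).not.and (Primrec.eq.comp
    (Primrec.list_head?.comp hx₁) (Primrec.list_head?.comp hx₂))) ?_ (Primrec.const [])
  exact Primrec.list_cons.comp (((Primrec.ite hφ3 (Primrec.const 1) hφ).pair (hq₁.pair
    ((Primrec.list_tail.comp hx₁).pair (hq₂.pair (Primrec.list_tail.comp hx₂))))).pair
    ((Primrec.const []).pair ((Primrec.const []).pair (Primrec.ite hφ3 (Primrec.const 1)
      (Primrec.const 0))))) (Primrec.const [])

theorem primrec_phaseCode {F₁ F₂ : α → List ℕ} {s : α → ProdCode} (hF₁ : Primrec F₁)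
    (hF₂ : Primrec F₂) (hs : Primrec s) : Primrec fun a => phaseCode (F₁ a) (F₂ a) (s a) := by
  have hφ : Primrec fun a => (s a).1 := Primrec.fst.comp hs
  have hq₁ : Primrec fun a => (s a).2.1 := Primrec.fst.comp (Primrec.snd.comp hs)
  have hq₂ : Primrec fun a => (s a).2.2.2.1 :=
    Primrec.fst.comp (Primrec.snd.comp (Primrec.snd.comp (Primrec.snd.comp hs)))
  refine Primrec.ite ((Primrec.eq.comp hφ (Primrec.const 0)).or
    (((Primrec.eq.comp hφ (Primrec.const 1)).and (primrecPred_mem hq₁ hF₁)).or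
      ((Primrec.eq.comp hφ (Primrec.const 2)).and (primrecPred_mem hq₂ hF₂)))) ?_ (Primrec.const [])
  exact Primrec.list_cons.comp (((Primrec.succ.comp hφ).pair (Primrec.snd.comp hs)).pair
    (Primrec.const ([], [], 0))) (Primrec.const [])

theorem primrec_code_parts : Primrec (fun c : VASSCode => c.2.2.1) ∧
    Primrec (fun c : VASSCode => c.2.2.2.1) ∧ Primrec (fun c : VASSCode => c.2.2.2.2.1) ∧
    Primrec fun c : VASSCode => c.2.2.2.2.2 := by
  have h1 : Primrec fun c : VASSCode => c.2.2 := Primrec.snd.comp Primrec.snd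
  have h2 : Primrec fun c : VASSCode => c.2.2.2 := Primrec.snd.comp h1
  have h3 : Primrec fun c : VASSCode => c.2.2.2.2 := Primrec.snd.comp h2
  exact ⟨Primrec.fst.comp h1, Primrec.fst.comp h2, Primrec.fst.comp h3, Primrec.snd.comp h3⟩

theorem primrec₂_outCode : Primrec₂ outCode := by
  have hc₁ : Primrec fun p : (VASSCode × VASSCode) × ProdCode => p.1.1 := Primrec.fst.comp Primrec.fst
  have hc₂ : Primrec fun p : (VASSCode × VASSCode) × ProdCode => p.1.2 := Primrec.snd.comp Primrec.fst
  obtain ⟨hd, -, hT, hF⟩ := primrec_code_parts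
  exact Primrec.list_append.comp (Primrec.list_append.comp (Primrec.list_append.comp
    (primrec_leftCode (hT.comp hc₁) Primrec.snd)
    (primrec_rightCode (hd.comp hc₁) (hT.comp hc₂) Primrec.snd)) (primrec_readCode.comp Primrec.snd))
    (primrec_phaseCode (hF.comp hc₁) (hF.comp hc₂) Primrec.snd)

theorem primrec_initCode : Primrec initCode := by
  obtain ⟨-, hi, -, -⟩ := primrec_code_parts
  exact (Primrec.const 0).pair ((hi.comp Primrec.fst).pair ((Primrec.const []).pair
    ((hi.comp Primrec.snd).pair (Primrec.const []))))

end Primrec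

theorem mem_leftCode {T : List TransitionCode} {s : ProdCode} {u} : u ∈ leftCode T s ↔ s.2.2.1 = [] ∧
    ∃ t ∈ T, t.1 = s.2.1 ∧ (s.1 = 0 ∨ t.2.1.isLeft = true) ∧
      u = ((s.1, t.2.2.2, t.2.2.1, s.2.2.2), effCode 0 t.2.1) := by
  rw [leftCode]
  split_ifs with h
  · simp only [h, List.mem_map, List.mem_filter, decide_eq_true_eq, true_and]
    exact ⟨fun ⟨t₁, ⟨h1, h2, h3⟩, h4⟩ => ⟨t₁, h1, h2, h3, h4.symm⟩,
      fun ⟨t₁, h1, h2, h3, h4⟩ => ⟨t₁, ⟨h1, h2, h3⟩, h4.symm⟩⟩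
  · simp [h]

theorem mem_rightCode {p : ℕ} {T : List TransitionCode} {s : ProdCode} {u} :
    u ∈ rightCode p T s ↔ s.2.2.2.2 = [] ∧
    ∃ t ∈ T, t.1 = s.2.2.2.1 ∧ (s.1 = 0 ∨ t.2.1.isLeft = true) ∧
      u = ((s.1, s.2.1, s.2.2.1, t.2.2.2, t.2.2.1), effCode p t.2.1) := by
  rw [rightCode]
  split_ifs with h
  · simp only [h, List.mem_map, List.mem_filter, decide_eq_true_eq, true_and]
    exact ⟨fun ⟨t₁, ⟨h1, h2, h3⟩, h4⟩ => ⟨t₁, h1, h2, h3, h4.symm⟩,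
      fun ⟨t₁, h1, h2, h3, h4⟩ => ⟨t₁, ⟨h1, h2, h3⟩, h4.symm⟩⟩
  · simp [h]

theorem mem_readCode {s : ProdCode} {u} : u ∈ readCode s ↔
    ∃ a l₁ l₂, s.2.2.1 = a :: l₁ ∧ s.2.2.2.2 = a :: l₂ ∧
      u = ((if s.1 = 3 then 1 else s.1, s.2.1, l₁, s.2.2.2.1, l₂), [], [], if s.1 = 3 then 1 else 0) := by
  obtain ⟨φ, q₁, x₁, q₂, x₂⟩ := s
  rcases x₁ with _ | ⟨a, l₁⟩
  · simp [readCode]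
  · rcases x₂ with _ | ⟨b, l₂⟩
    · simp [readCode]
    · by_cases hab : a = b
      · subst hab
        simp [readCode]
      · have hba : ¬ b = a := fun h => hab h.symm
        simp [readCode, hab, hba]

theorem mem_phaseCode {F₁ F₂ : List ℕ} {s : ProdCode} {u} :
    u ∈ phaseCode F₁ F₂ s ↔
      (s.1 = 0 ∨ (s.1 = 1 ∧ s.2.1 ∈ F₁) ∨ (s.1 = 2 ∧ s.2.2.2.1 ∈ F₂)) ∧
      u = ((s.1 + 1, s.2), [], [], 0) := by
  rw [phaseCode]
  split_ifs with h <;> simp [h]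

theorem mem_outCode {c : VASSCode × VASSCode} {s : ProdCode} {u} : u ∈ outCode c s ↔
    u ∈ leftCode c.1.2.2.2.2.1 s ∨ u ∈ rightCode c.1.2.2.1 c.2.2.2.2.2.1 s ∨ u ∈ readCode s ∨
      u ∈ phaseCode c.1.2.2.2.2.2 c.2.2.2.2.2.2 s := by
  simp [outCode]

/-- The encoded product has finitely many reachable states. -/
theorem exists_finset_closed (c : VASSCode × VASSCode) : ∃ St : Finset ProdCode, initCode c ∈ St ∧
    ∀ s ∈ St, ∀ u ∈ outCode c s, u.1 ∈ St := by
  let Qs : VASSCode → Finset ℕ := fun c => (c.2.2.2.1 :: c.2.2.2.2.1.map fun t => t.2.2.2).toFinset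
  -- Pending words are suffixes of labels. This family is closed under removing the first letter.
  let Ws : VASSCode → Finset (List ℕ) := fun c =>
    ([] :: c.2.2.2.2.1.flatMap fun t => t.2.2.1.tails).toFinset
  have hQi : ∀ c, c.2.2.2.1 ∈ Qs c := fun c => by simp [Qs]
  have hQt : ∀ c, ∀ t ∈ c.2.2.2.2.1, t.2.2.2 ∈ Qs c := fun c t ht => by
    simp only [Qs, List.toFinset_cons, Finset.mem_insert, List.mem_toFinset, List.mem_map]
    exact Or.inr ⟨t, ht, rfl⟩
  have hWi : ∀ c, [] ∈ Ws c := fun c => by simp [Ws]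
  have hWt : ∀ c, ∀ t ∈ c.2.2.2.2.1, t.2.2.1 ∈ Ws c := fun c t ht => by
    simp only [Ws, List.toFinset_cons, Finset.mem_insert, List.mem_toFinset, List.mem_flatMap,
      List.mem_tails]
    exact Or.inr ⟨t, ht, List.suffix_rfl⟩
  have hWc : ∀ c a l, a :: l ∈ Ws c → l ∈ Ws c := fun c a l h => by
    simp only [Ws, List.toFinset_cons, Finset.mem_insert, List.mem_toFinset, List.mem_flatMap,
      List.mem_tails, reduceCtorEq, false_or] at h ⊢
    obtain ⟨t, ht, h⟩ := h
    exact Or.inr ⟨t, ht, (List.suffix_cons a l).trans h⟩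
  refine ⟨Finset.range 4 ×ˢ Qs c.1 ×ˢ Ws c.1 ×ˢ Qs c.2 ×ˢ Ws c.2, ?_, fun s hs u hu => ?_⟩
  · simp [initCode, hQi, hWi]
  · simp only [Finset.mem_product, Finset.mem_range] at hs ⊢
    obtain ⟨h1, h2, h3, h4, h5⟩ := hs
    rcases mem_outCode.1 hu with h | h | h | h
    · obtain ⟨-, t, ht, -, -, rfl⟩ := mem_leftCode.1 h
      exact ⟨h1, hQt _ t ht, hWt _ t ht, h4, h5⟩
    · obtain ⟨-, t, ht, -, -, rfl⟩ := mem_rightCode.1 h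
      exact ⟨h1, h2, h3, hQt _ t ht, hWt _ t ht⟩
    · obtain ⟨a, l₁, l₂, e1, e2, rfl⟩ := mem_readCode.1 h
      rw [e1] at h3
      rw [e2] at h5
      refine ⟨?_, h2, hWc _ _ _ h3, h4, hWc _ _ _ h5⟩
      dsimp only
      split_ifs <;> omega
    · obtain ⟨h6, rfl⟩ := mem_phaseCode.1 h
      refine ⟨?_, h2, h3, h4, h5⟩
      dsimp only
      omega

end BuchiResetVASS

/-! ### The product and its code simulate each other; nonemptiness as a lasso. -/

namespace BuchiResetVASS

open CounterSystem

section Correspondence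

/-- Subtracting the negative part and then adding the positive part is enabled exactly when the sum
stays nonnegative, since at most one of them is nonzero in each coordinate. -/
theorem fires_effCode_left {S : Type*} {x : S} {d₁ d₂ : ℕ} {y : CounterOp d₁}
    {m m' : Fin (d₁ + d₂) → ℕ} :
    CounterTrans.Fires (x, effCode 0 (Sum.map (fun δ => List.ofFn δ) (fun i => i.val) y)) m m' ↔
      (leftOp d₂ y).Fires m m' := by
  rcases y with δ | i
  · simp only [CounterTrans.Fires, CounterTrans.pre, CounterTrans.post, CounterTrans.kind, effCode,
      Sum.map_inl, Sum.elim_inl, List.replicate_zero, List.nil_append, CounterOp.Fires, leftOp]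
    refine forall_congr' fun j => ?_
    refine Fin.addCases (fun j => ?_) (fun j => ?_) j
    · simp
      omega
    · simp
  · simp only [CounterTrans.Fires, CounterTrans.pre, CounterTrans.post, CounterTrans.kind, effCode,
      Sum.map_inr, Sum.elim_inr, CounterOp.Fires, leftOp, List.getD_nil, Nat.zero_le, true_and,
      Nat.sub_zero, Nat.add_zero, Nat.zero_add, Nat.add_right_cancel_iff]
    constructor
    · intro h
      refine ⟨by simpa using h (Fin.castAdd d₂ i), fun j hj => ?_⟩
      rw [h j, if_neg fun h' => hj (Fin.ext (by simpa using h'.symm))]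
    · rintro ⟨h1, h2⟩ j
      split_ifs with hj
      · rw [show j = Fin.castAdd d₂ i from Fin.ext (by simpa using hj.symm), h1]
      · exact h2 j fun h' => hj (by simp [h'])

theorem fires_effCode_right {S : Type*} {x : S} {d₁ d₂ : ℕ} {y : CounterOp d₂}
    {m m' : Fin (d₁ + d₂) → ℕ} :
    CounterTrans.Fires (x, effCode d₁ (Sum.map (fun δ => List.ofFn δ) (fun i => i.val) y)) m m' ↔
      (rightOp d₁ y).Fires m m' := by
  rcases y with δ | i
  · simp only [CounterTrans.Fires, CounterTrans.pre, CounterTrans.post, CounterTrans.kind, effCode,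
      Sum.map_inl, Sum.elim_inl, CounterOp.Fires, rightOp]
    refine forall_congr' fun j => ?_
    refine Fin.addCases (fun j => ?_) (fun j => ?_) j
    · simp [List.getElem?_append]
    · simp
      omega
  · simp only [CounterTrans.Fires, CounterTrans.pre, CounterTrans.post, CounterTrans.kind, effCode,
      Sum.map_inr, Sum.elim_inr, CounterOp.Fires, rightOp, List.getD_nil, Nat.zero_le, true_and,
      Nat.sub_zero, Nat.add_zero, Nat.add_right_cancel_iff]
    constructor
    · intro h
      refine ⟨by simpa using h (Fin.natAdd d₁ i), fun j hj => ?_⟩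
      rw [h j, if_neg fun h' => hj (Fin.ext (by simpa using h'.symm))]
    · rintro ⟨h1, h2⟩ j
      split_ifs with hj
      · rw [show j = Fin.natAdd d₁ i from Fin.ext (by simpa using hj.symm), h1]
      · exact h2 j fun h' => hj (by simp [h'])

theorem fires_idle {S : Type*} {x : S} {d k : ℕ} (hk : k < 2) {m m' : Fin d → ℕ} :
    CounterTrans.Fires (x, [], [], k) m m' ↔ CounterOp.Fires (Sum.inl fun _ => 0) m m' := by
  rw [fires_inl_zero, funext_iff]
  refine forall_congr' fun j => ?_
  have : ¬ k = j + 2 := by omega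
  simp [CounterTrans.pre, CounterTrans.post, CounterTrans.kind, this]

variable {n₁ n₂ k d₁ d₂ : ℕ}

/-- The code of a state of the product. -/
def stateCode (s : ProdState (Fin n₁) (Fin n₂) (Fin k)) : ProdCode :=
  (s.1, s.2.1.val, s.2.2.1.map (fun a => a.val), s.2.2.2.1.val, s.2.2.2.2.map (fun a => a.val))

theorem stateCode_injective : Function.Injective (stateCode (n₁ := n₁) (n₂ := n₂) (k := k)) := by
  rintro ⟨φ, q₁, x₁, q₂, x₂⟩ ⟨φ', q₁', x₁', q₂', x₂'⟩ h
  have hinj := List.map_injective_iff.2 (Fin.val_injective (n := k))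
  simp only [stateCode, Prod.mk.injEq] at h ⊢
  exact ⟨h.1, Fin.ext h.2.1, hinj h.2.2.1, Fin.ext h.2.2.2.1, hinj h.2.2.2.2⟩

/-- The encoded transition `u` represents the transition `t` of the product from `s`. -/
structure Represents {d : ℕ} (s : ProdState (Fin n₁) (Fin n₂) (Fin k))
    (t : ResetTransition (ProdState (Fin n₁) (Fin n₂) (Fin k)) (Fin k) d)
    (u : CounterTrans ProdCode) : Prop where
  target : u.1 = stateCode t.target
  fires : ∀ m m' : Fin d → ℕ, CounterTrans.Fires u m m' ↔ t.op.Fires m m'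
  marked : CounterTrans.kind u = 1 ↔ s.1 = 3 ∧ t.target.1 = 1
  reset : 2 ≤ CounterTrans.kind u → s.1 = 0

theorem kind_effCode {S : Type*} {x : S} {p : ℕ} {y : List ℤ ⊕ ℕ} :
    CounterTrans.kind (x, effCode p y) ≠ 1 ∧
      (2 ≤ CounterTrans.kind (x, effCode p y) → ¬ y.isLeft = true) := by
  rcases y with δ | i <;> simp [CounterTrans.kind, effCode]

variable {V₁ : BuchiResetVASS (Fin n₁) (Fin k) d₁} {V₂ : BuchiResetVASS (Fin n₂) (Fin k) d₂}
  {s : ProdState (Fin n₁) (Fin n₂) (Fin k)}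

theorem isLeft_map {d : ℕ} (y : CounterOp d) :
    (Sum.map (fun δ => List.ofFn δ) (fun i => i.val) y).isLeft = y.isLeft := by
  rcases y <;> rfl

theorem represents_left {t₁ : ResetTransition (Fin n₁) (Fin k) d₁}
    (h : s.1 = 0 ∨ t₁.op.isLeft = true) :
    Represents s (⟨s, leftOp d₂ t₁.op, [], (s.1, t₁.target, t₁.label, s.2.2.2)⟩ :
        ResetTransition _ (Fin k) (d₁ + d₂))
      (((stateCode s).1, t₁.code.2.2.2, t₁.code.2.2.1, (stateCode s).2.2.2),
        effCode 0 t₁.code.2.1) where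
  target := rfl
  fires _ _ := fires_effCode_left
  marked := iff_of_false kind_effCode.1 (by dsimp only; omega)
  reset h2 := h.resolve_right fun h3 => kind_effCode.2 h2 ((isLeft_map _).trans h3)

theorem represents_right {t₂ : ResetTransition (Fin n₂) (Fin k) d₂}
    (h : s.1 = 0 ∨ t₂.op.isLeft = true) :
    Represents s (⟨s, rightOp d₁ t₂.op, [], (s.1, s.2.1, s.2.2.1, t₂.target, t₂.label)⟩ :
        ResetTransition _ (Fin k) (d₁ + d₂))
      (((stateCode s).1, (stateCode s).2.1, (stateCode s).2.2.1, t₂.code.2.2.2, t₂.code.2.2.1),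
        effCode d₁ t₂.code.2.1) where
  target := rfl
  fires _ _ := fires_effCode_right
  marked := iff_of_false kind_effCode.1 (by dsimp only; omega)
  reset h2 := h.resolve_right fun h3 => kind_effCode.2 h2 ((isLeft_map _).trans h3)

theorem represents_read {d : ℕ} {a : List (Fin k)} {l₁ l₂ : List (Fin k)} :
    Represents s (⟨s, Sum.inl fun _ => 0, a,
        (if s.1 = 3 then 1 else s.1, s.2.1, l₁, s.2.2.2.1, l₂)⟩ : ResetTransition _ (Fin k) d)
      ((if s.1 = 3 then 1 else s.1, (stateCode s).2.1, l₁.map (fun a => a.val),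
        (stateCode s).2.2.2.1, l₂.map (fun a => a.val)), [], [], if s.1 = 3 then 1 else 0) where
  target := rfl
  fires _ _ := fires_idle (by split_ifs <;> omega)
  marked := by
    by_cases h : s.1 = 3 <;> simp [CounterTrans.kind, h]
  reset h := by
    simp only [CounterTrans.kind] at h
    split_ifs at h <;> omega

theorem represents_phase {d : ℕ} (h : s.1 < 3) :
    Represents s (⟨s, Sum.inl fun _ => 0, [], (s.1 + 1, s.2)⟩ : ResetTransition _ (Fin k) d)
      (((stateCode s).1 + 1, (stateCode s).2), [], [], 0) where
  target := rfl
  fires _ _ := fires_idle (by omega)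
  marked := iff_of_false (by simp [CounterTrans.kind]) (by dsimp only; omega)
  reset h := by simp [CounterTrans.kind] at h

/-- Together with `exists_mem_prodOut` this makes `stateCode` a bisimulation that respects marks and
counters. -/
theorem exists_mem_outCode {t} (ht : t ∈ prodOut V₁ V₂ s) :
    ∃ u ∈ outCode (V₁.code, V₂.code) (stateCode s), Represents s t u := by
  rcases mem_prodOut.1 ht with h | h | h | h
  · obtain ⟨h1, t₁, h2, h3, h4, rfl⟩ := mem_leftMoves.1 h
    refine ⟨_, mem_outCode.2 (Or.inl (mem_leftCode.2 ⟨?_, t₁.code, List.mem_map_of_mem h2, ?_, ?_,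
      rfl⟩)), represents_left h4⟩
    · simp [stateCode, h1]
    · simp [stateCode, ResetTransition.code, h3]
    · exact h4.imp_right (isLeft_map _).trans
  · obtain ⟨h1, t₂, h2, h3, h4, rfl⟩ := mem_rightMoves.1 h
    refine ⟨_, mem_outCode.2 (Or.inr (Or.inl (mem_rightCode.2 ⟨?_, t₂.code, List.mem_map_of_mem h2,
      ?_, ?_, rfl⟩))), represents_right h4⟩
    · simp [stateCode, h1]
    · simp [stateCode, ResetTransition.code, h3]
    · exact h4.imp_right (isLeft_map _).trans
  · obtain ⟨a, l₁, l₂, h1, h2, rfl⟩ := mem_readMoves.1 h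
    exact ⟨_, mem_outCode.2 (Or.inr (Or.inr (Or.inl (mem_readCode.2 ⟨a.val, _, _,
      by simp [stateCode, h1], by simp [stateCode, h2], rfl⟩)))), represents_read⟩
  · obtain ⟨h1, rfl⟩ := mem_phaseMoves.1 h
    refine ⟨_, mem_outCode.2 (Or.inr (Or.inr (Or.inr (mem_phaseCode.2 ⟨?_, rfl⟩)))),
      represents_phase (by omega)⟩
    simpa [stateCode, code, Fin.val_inj] using h1

theorem exists_mem_prodOut {u} (hu : u ∈ outCode (V₁.code, V₂.code) (stateCode s)) :
    ∃ t ∈ prodOut V₁ V₂ s, Represents s t u := by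
  rcases mem_outCode.1 hu with h | h | h | h
  · obtain ⟨h1, t, h2, h3, h4, rfl⟩ := mem_leftCode.1 h
    obtain ⟨t₁, h5, rfl⟩ := List.mem_map.1 h2
    have h4' : s.1 = 0 ∨ t₁.op.isLeft = true := h4.imp_right (isLeft_map _).symm.trans
    exact ⟨_, mem_prodOut.2 (Or.inl (mem_leftMoves.2 ⟨by simpa [stateCode] using h1, t₁, h5,
      Fin.ext h3, h4', rfl⟩)), represents_left h4'⟩
  · obtain ⟨h1, t, h2, h3, h4, rfl⟩ := mem_rightCode.1 h
    obtain ⟨t₂, h5, rfl⟩ := List.mem_map.1 h2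
    have h4' : s.1 = 0 ∨ t₂.op.isLeft = true := h4.imp_right (isLeft_map _).symm.trans
    exact ⟨_, mem_prodOut.2 (Or.inr (Or.inl (mem_rightMoves.2 ⟨by simpa [stateCode] using h1, t₂, h5,
      Fin.ext h3, h4', rfl⟩))), represents_right h4'⟩
  · obtain ⟨a, l₁, l₂, h1, h2, rfl⟩ := mem_readCode.1 h
    obtain ⟨a', l₁', e1, rfl, rfl⟩ := List.map_eq_cons_iff.1 h1
    obtain ⟨b', l₂', e2, e3, rfl⟩ := List.map_eq_cons_iff.1 h2
    obtain rfl := Fin.ext e3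
    exact ⟨_, mem_prodOut.2 (Or.inr (Or.inr (Or.inl (mem_readMoves.2 ⟨_, l₁', l₂', e1, e2,
      rfl⟩)))), represents_read⟩
  · obtain ⟨h1, rfl⟩ := mem_phaseCode.1 h
    have h1' : s.1 = 0 ∨ (s.1 = 1 ∧ s.2.1 ∈ V₁.final) ∨ (s.1 = 2 ∧ s.2.2.2.1 ∈ V₂.final) := by
      simpa [stateCode, code, Fin.val_inj] using h1
    exact ⟨_, mem_prodOut.2 (Or.inr (Or.inr (Or.inr (mem_phaseMoves.2 ⟨h1', rfl⟩)))),
      represents_phase (by omega)⟩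

/-- The product has finitely many reachable states. -/
theorem exists_finset_prod_closed (V₁ : BuchiResetVASS (Fin n₁) (Fin k) d₁)
    (V₂ : BuchiResetVASS (Fin n₂) (Fin k) d₂) :
    ∃ St : Finset (ProdState (Fin n₁) (Fin n₂) (Fin k)), prodInit V₁ V₂ ∈ St ∧
      ∀ s ∈ St, ∀ t ∈ prodOut V₁ V₂ s, t.target ∈ St := by
  obtain ⟨St, h1, h2⟩ := exists_finset_closed (V₁.code, V₂.code)
  refine ⟨St.preimage stateCode stateCode_injective.injOn, Finset.mem_preimage.2 h1,
    fun s hs t ht => ?_⟩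
  obtain ⟨u, hu, hr⟩ := exists_mem_outCode ht
  exact Finset.mem_preimage.2 (hr.target ▸ h2 _ (Finset.mem_preimage.1 hs) u hu)

/-- A common word gives a product run with infinitely many passages from phase 3 to 1, which are the
marks. Conversely a lasso unfolds to a run with infinitely many marks; each mark reads a letter, so
the labels form an infinite word, accepted by both automata. -/
theorem nonempty_iff_hasLasso (hV₁ : V₁.IsWeak) (hV₂ : V₂.IsWeak) :
    (V₁.language ∩ V₂.language).Nonempty ↔
      HasLasso (outCode (V₁.code, V₂.code)) (d₁ + d₂) (initCode (V₁.code, V₂.code)) := by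
  constructor
  · rintro ⟨w, hw⟩
    obtain ⟨c, t, hrun, h31, -⟩ := exists_isOutRun hV₁ hV₂ hw
    choose u hu hr using fun n => exists_mem_outCode (hrun.2 n).1
    have htgt : ∀ n, (u n).1 = stateCode (c (n + 1)).1 := fun n => by
      rw [(hr n).target, (hrun.2 n).2.1]
    have hmarked : IsMarkedRun (outCode (V₁.code, V₂.code)) (initCode (V₁.code, V₂.code))
        (fun n => (stateCode (c n).1, (c n).2)) u := by
      refine ⟨?_, fun n => ⟨hu n, htgt n, ((hr n).fires _ _).2 (hrun.2 n).2.2⟩, fun N => ?_⟩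
      · dsimp only
        rw [hrun.1]
        rfl
      · obtain ⟨n, hn, h3, h1⟩ := h31 N
        exact ⟨n, hn, (hr n).marked.2 ⟨h3, by rw [(hrun.2 n).2.1, h1]⟩⟩
    refine hmarked.hasLasso ?_ ?_
    · obtain ⟨St, hi, hSt⟩ := exists_finset_prod_closed V₁ V₂
      refine (St.finite_toSet.image stateCode).subset ?_
      rintro _ ⟨n, rfl⟩
      refine Set.mem_image_of_mem _ ?_
      induction n with
      | zero => rw [hrun.1]; exact hi
      | succ n ih => rw [← (hrun.2 n).2.1]; exact hSt _ ih _ (hrun.2 n).1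
    · intro n j hn hj
      -- Phase 0 is never entered again, so no reset can follow a mark.
      have hpos : ∀ i, (c (n + i)).1.1 ≠ 0 := by
        intro i
        induction i with
        | zero =>
          have := ((hr n).marked.1 hn).1
          rw [Nat.add_zero]
          omega
        | succ i ih =>
          have h1 := label_of_mem_prodOut (hrun.2 (n + i)).1
          rw [(hrun.2 (n + i)).2.1] at h1
          rw [← Nat.add_assoc]
          split_ifs at h1 <;> omega
      by_contra! h2
      have := hpos (j - n)
      rw [Nat.add_sub_cancel' hj] at this
      exact this ((hr j).reset h2)
  · intro h
    obtain ⟨x, u, hx0, hstep, hinf⟩ := h.exists_isMarkedRun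
    obtain ⟨f, hf0, hf⟩ := exists_seq_step
      (A := fun n (s : ProdState (Fin n₁) (Fin n₂) (Fin k)) => stateCode s = (x n).1)
      (B := fun n s s' => ∃ t ∈ prodOut V₁ V₂ s, t.target = s' ∧ Represents s t (u n))
      (a₀ := prodInit V₁ V₂) (by rw [hx0]; rfl) (by
        intro n s hs
        obtain ⟨h1, h2, -⟩ := hstep n
        rw [← hs] at h1
        obtain ⟨t, ht, hr⟩ := exists_mem_prodOut h1
        exact ⟨t.target, hr.target.symm.trans h2, t, ht, rfl, hr⟩)
    choose hA t ht htgt hr using hf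
    have hrun : IsOutRun (prodOut V₁ V₂) (prodInit V₁ V₂) (fun n => (f n, (x n).2)) t := by
      refine ⟨?_, fun n => ⟨ht n, htgt n, ((hr n).fires _ _).1 (hstep n).2.2⟩⟩
      dsimp only
      rw [hf0, hx0]
      rfl
    have h3 : ∀ N, ∃ n, N ≤ n ∧ (f n).1 = 3 ∧ (t n).label.length = 1 := by
      intro N
      obtain ⟨n, hn, hk⟩ := hinf N
      obtain ⟨h3, h1⟩ := (hr n).marked.1 hk
      refine ⟨n, hn, h3, ?_⟩
      rcases label_of_mem_prodOut (ht n) with ⟨-, h4⟩ | ⟨⟨a, h4⟩, -⟩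
      · omega
      · simp [h4]
    have hlen : ∀ N, ∃ n, N ≤ (concatLabels (fun n => (t n).label) n).length := by
      intro N
      induction N with
      | zero => exact ⟨0, Nat.zero_le _⟩
      | succ N ih =>
        obtain ⟨n, hn⟩ := ih
        obtain ⟨j, hj, -, h1⟩ := h3 n
        refine ⟨j + 1, ?_⟩
        have h2 : _ ≤ _ := concatLabels_length_mono (fun n => (t n).label) hj
        dsimp only at h2
        rw [concatLabels_succ, List.length_append, h1]
        omega
    obtain ⟨w, hw⟩ := exists_isInfiniteConcat hlen
    exact ⟨w, hrun.mem_languages (fun N => (h3 N).imp fun n hn => ⟨hn.1, hn.2.1⟩) hw⟩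

end Correspondence

end BuchiResetVASS

/-! ### The product as a weak automaton, and the theorem. -/

namespace BuchiResetVASS

section OfOut

variable {S A : Type*} {d n : ℕ} (out : S → List (ResetTransition S A d)) (s₀ : S)
  (F : S → Bool) (dec : Fin n → S) (enc : S → Fin n)

/-- The automaton with the transitions given by `out` on a set of states enumerated by `dec`. -/
def ofOut : BuchiResetVASS (Fin n) A d where
  init := enc s₀
  transitions := (List.finRange n).flatMap fun j =>
    (out (dec j)).map fun t => ⟨j, t.op, t.label, enc t.target⟩
  final := (List.finRange n).filter fun j => F (dec j)

variable {out s₀ F dec enc}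

theorem mem_ofOut_transitions {t : ResetTransition (Fin n) A d} :
    t ∈ (ofOut out s₀ F dec enc).transitions ↔
      ∃ u ∈ out (dec t.source), u.op = t.op ∧ u.label = t.label ∧ enc u.target = t.target := by
  obtain ⟨p, x, l, q⟩ := t
  simp [ofOut]

theorem mem_ofOut_final {q : Fin n} : q ∈ (ofOut out s₀ F dec enc).final ↔ F (dec q) = true := by
  simp [ofOut]

variable {St : Finset S}

/-- Runs from `s₀` stay in `St`, where `dec` inverts `enc`, so they are transported step by step in
both directions. -/
theorem mem_ofOut_language (hdec : ∀ j, dec j ∈ St) (hde : ∀ s ∈ St, dec (enc s) = s)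
    (hs₀ : s₀ ∈ St) (hSt : ∀ s ∈ St, ∀ t ∈ out s, t.target ∈ St) {w : ℕ → A} :
    w ∈ (ofOut out s₀ F dec enc).language ↔ ∃ c t, IsOutRun out s₀ c t ∧
      (∀ N, ∃ n, N ≤ n ∧ F (c n).1 = true) ∧ IsInfiniteConcat (fun n => (t n).label) w := by
  constructor
  · rintro ⟨c, t, hrun, hF, hw⟩
    choose u hu hop hlab htgt using fun n => mem_ofOut_transitions.1 (hrun.2 n).1
    refine ⟨fun n => (dec (c n).1, (c n).2), u, ⟨?_, fun n => ⟨?_, ?_, ?_⟩⟩, ?_, ?_⟩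
    · dsimp only
      rw [hrun.1]
      simp [ofOut, hde s₀ hs₀]
    · dsimp only
      rw [← (hrun.2 n).2.1]
      exact hu n
    · dsimp only
      rw [← (hrun.2 n).2.2.1, ← htgt, hde _ (hSt _ (hdec _) _ (hu n))]
    · dsimp only
      rw [hop]
      exact (hrun.2 n).2.2.2
    · exact fun N => (hF N).imp fun n hn => ⟨hn.1, mem_ofOut_final.1 hn.2⟩
    · simpa only [hlab] using hw
  · rintro ⟨c, t, hrun, hF, hw⟩
    have hc : ∀ n, (c n).1 ∈ St := by
      intro n
      induction n with
      | zero => rw [hrun.1]; exact hs₀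
      | succ n ih => rw [← (hrun.2 n).2.1]; exact hSt _ ih _ (hrun.2 n).1
    refine ⟨fun n => (enc (c n).1, (c n).2),
      fun n => ⟨enc (c n).1, (t n).op, (t n).label, enc (t n).target⟩,
      ⟨?_, fun n => ⟨?_, rfl, ?_, (hrun.2 n).2.2⟩⟩, ?_, hw⟩
    · dsimp only
      rw [hrun.1]
      rfl
    · refine mem_ofOut_transitions.2 ⟨t n, ?_, rfl, rfl, rfl⟩
      dsimp only
      rw [hde _ (hc n)]
      exact (hrun.2 n).1
    · dsimp only
      rw [(hrun.2 n).2.1]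
    · refine fun N => (hF N).imp fun n hn => ⟨hn.1, mem_ofOut_final.2 ?_⟩
      dsimp only
      rw [hde _ (hc n)]
      exact hn.2

/-- The property `I` is an inductive invariant: it contains the final states, it is preserved by all
transitions, and it excludes resets. -/
theorem isWeak_ofOut (hdec : ∀ j, dec j ∈ St) (hde : ∀ s ∈ St, dec (enc s) = s)
    (hSt : ∀ s ∈ St, ∀ t ∈ out s, t.target ∈ St) {I : S → Prop}
    (hF : ∀ s, F s = true → I s) (hstep : ∀ s, I s → ∀ t ∈ out s, I t.target ∧ ¬ t.IsReset) :
    (ofOut out s₀ F dec enc).IsWeak := by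
  intro q hq t ht hr hpath
  have hI : ∀ p, Relation.ReflTransGen (ofOut out s₀ F dec enc).Edge q p → I (dec p) := by
    intro p hp
    induction hp with
    | refl => exact hF _ (mem_ofOut_final.1 hq)
    | tail _ he ih =>
      obtain ⟨t', ht', rfl, rfl⟩ := he
      obtain ⟨u, hu, -, -, htgt⟩ := mem_ofOut_transitions.1 ht'
      rw [← htgt, hde _ (hSt _ (hdec _) _ hu)]
      exact (hstep _ ih u hu).1
  obtain ⟨u, hu, hop, -, -⟩ := mem_ofOut_transitions.1 ht
  refine (hstep _ (hI _ hpath) u hu).2 ?_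
  obtain ⟨i, hi⟩ := hr
  exact ⟨i, hop.trans hi⟩

end OfOut

variable {n₁ n₂ k d₁ d₂ : ℕ}

/-- Weak Büchi reset VASS are closed under intersection. -/
theorem exists_isWeak_inter {V₁ : BuchiResetVASS (Fin n₁) (Fin k) d₁}
    {V₂ : BuchiResetVASS (Fin n₂) (Fin k) d₂} (hV₁ : V₁.IsWeak) (hV₂ : V₂.IsWeak) :
    ∃ (n d : ℕ) (V : BuchiResetVASS (Fin n) (Fin k) d),
      V.IsWeak ∧ V.language = V₁.language ∩ V₂.language := by
  classical
  obtain ⟨St, hi, hSt⟩ := exists_finset_prod_closed V₁ V₂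
  let dec : Fin St.card → ProdState (Fin n₁) (Fin n₂) (Fin k) := fun j => (St.equivFin.symm j).1
  let enc : ProdState (Fin n₁) (Fin n₂) (Fin k) → Fin St.card := fun s =>
    if h : s ∈ St then St.equivFin ⟨s, h⟩ else St.equivFin ⟨prodInit V₁ V₂, hi⟩
  have hdec : ∀ j, dec j ∈ St := fun j => (St.equivFin.symm j).2
  have hde : ∀ s ∈ St, dec (enc s) = s := fun s hs => by simp [dec, enc, hs]
  -- Phase 3 is final, and weakness is witnessed by the invariant that the phase is nonzero.
  refine ⟨St.card, d₁ + d₂, ofOut (prodOut V₁ V₂) (prodInit V₁ V₂) (fun s => decide (s.1 = 3)) dec enc,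
    isWeak_ofOut hdec hde hSt (I := fun s => s.1 ≠ 0) (fun s hs => ?_) (fun s hs t ht => ⟨?_, ?_⟩), ?_⟩
  · have : s.1 = 3 := by simpa using hs
    omega
  · have h1 := label_of_mem_prodOut ht
    split_ifs at h1 <;> omega
  · rintro ⟨i, h1⟩
    rcases mem_prodOut.1 ht with h | h | h | h
    · obtain ⟨-, t₁, -, -, h2, rfl⟩ := mem_leftMoves.1 h
      have h3 := h2.resolve_left hs
      rcases hop : t₁.op with δ | i
      · simp [leftOp, hop] at h1
      · simp [hop] at h3
    · obtain ⟨-, t₂, -, -, h2, rfl⟩ := mem_rightMoves.1 h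
      have h3 := h2.resolve_left hs
      rcases hop : t₂.op with δ | i
      · simp [rightOp, hop] at h1
      · simp [hop] at h3
    · obtain ⟨a, l₁, l₂, -, -, rfl⟩ := mem_readMoves.1 h
      simp at h1
    · obtain ⟨-, rfl⟩ := mem_phaseMoves.1 h
      simp at h1
  · ext w
    rw [mem_ofOut_language hdec hde hi hSt]
    constructor
    · rintro ⟨c, t, hrun, hF, hw⟩
      exact hrun.mem_languages (by simpa using hF) hw
    · intro hw
      obtain ⟨c, t, hrun, hF, hw⟩ := exists_isOutRun hV₁ hV₂ hw
      exact ⟨c, t, hrun, fun N => (hF N).imp fun n hn => ⟨hn.1, by simpa using hn.2.1⟩, hw⟩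

/-- Emptiness of the intersection of two weak Büchi reset VASS is decidable. -/
theorem exists_computable_inter_eq_empty : ∃ g : VASSCode × VASSCode → Bool, Computable g ∧
    ∀ (n₁ n₂ k d₁ d₂ : ℕ) (V₁ : BuchiResetVASS (Fin n₁) (Fin k) d₁)
      (V₂ : BuchiResetVASS (Fin n₂) (Fin k) d₂), V₁.IsWeak → V₂.IsWeak →
        (g (V₁.code, V₂.code) = true ↔ V₁.language ∩ V₂.language = ∅) := by
  obtain ⟨hd, -, -, -⟩ := primrec_code_parts
  -- Finiteness of the reachable states holds for arbitrary codes, so the search also ends on inputs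
  -- that describe no weak automaton.
  obtain ⟨g, hg, hspec⟩ := CounterSystem.exists_computable_hasLasso primrec₂_outCode
    (Primrec.nat_add.comp (hd.comp Primrec.fst) (hd.comp Primrec.snd)) primrec_initCode
    exists_finset_closed
  refine ⟨g, hg, fun n₁ n₂ k d₁ d₂ V₁ V₂ hV₁ hV₂ => ?_⟩
  rw [hspec, ← Set.not_nonempty_iff_eq_empty, nonempty_iff_hasLasso hV₁ hV₂]
  rfl

end BuchiResetVASS

/-- Emptiness is decidable for weak Büchi reset VASS, they are closed under intersection, and
emptiness of the intersection of two of them is decidable. -/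
theorem mainTheorem7 :
    (∃ f : VASSCode → Bool, Computable f ∧
      ∀ (n k d : ℕ) (V : BuchiResetVASS (Fin n) (Fin k) d), V.IsWeak →
        (f V.code = true ↔ V.language = ∅)) ∧
    (∀ (n₁ n₂ k d₁ d₂ : ℕ) (V₁ : BuchiResetVASS (Fin n₁) (Fin k) d₁)
      (V₂ : BuchiResetVASS (Fin n₂) (Fin k) d₂), V₁.IsWeak → V₂.IsWeak →
        ∃ (n d : ℕ) (V : BuchiResetVASS (Fin n) (Fin k) d),
          V.IsWeak ∧ V.language = V₁.language ∩ V₂.language) ∧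
    (∃ g : VASSCode × VASSCode → Bool, Computable g ∧
      ∀ (n₁ n₂ k d₁ d₂ : ℕ) (V₁ : BuchiResetVASS (Fin n₁) (Fin k) d₁)
        (V₂ : BuchiResetVASS (Fin n₂) (Fin k) d₂), V₁.IsWeak → V₂.IsWeak →
          (g (V₁.code, V₂.code) = true ↔ V₁.language ∩ V₂.language = ∅)) := by
  obtain ⟨g, hg, hspec⟩ := BuchiResetVASS.exists_computable_inter_eq_empty
  -- Emptiness of one automaton is tested by intersecting it with itself.
  refine ⟨⟨fun c => g (c, c), hg.comp (Computable.id.pair Computable.id), fun n k d V hV => ?_⟩,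
    fun n₁ n₂ k d₁ d₂ V₁ V₂ hV₁ hV₂ => BuchiResetVASS.exists_isWeak_inter hV₁ hV₂, g, hg, hspec⟩
  rw [hspec n n k d d V V hV hV, Set.inter_self]
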